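/- Let $n\ge 2$ and $\lambda>2$. Let $C_\lambda\subset[0,1]$ be the central Cantor set, i.e. the attractor of $\phi_0(x)=x/\lambda$, $\phi_1(x)=x/\lambda+(\lambda-1)/\lambda$, and let $C_\lambda^n\subset\mathbb R^n$ be its $n$-th power. A standard interval is an image of $[0,1]$ under an element of the monoid generated by $\phi_0,\phi_1$; a standard parallelepiped is a product of $n$ standard intervals (possibly of different lengths). Let $\mathfrak{diff}^{1,+}_{\mathbb R^n}(C_\lambda^n)$ be the group of transformations of $C_\lambda^n$ that are restrictions of orientation preserving $\mathcal C^1$-diffeomorphisms of $\mathbb R^n$ sending $C_\lambda^n$ onto itself. Let $D_n$ be the group of orthogonal integer $n\times n$ matrices of determinant $1$, acting on the cube $[0,1]^n$ as its orientation preserving symmetries (fixing the centre). Theorem. (1) For every $\varphi\in\mathfrak{diff}^{1,+}_{\mathbb R^n}(C_\lambda^n)$ there are a covering of $C_\lambda^n$ by a finite collection of pairwise disjoint standard parallelepipeds $I_j$, integers $k_{j,i}\in\mathbb Z$, points $a_{j,i},b_{j,i}\in C_\lambda$ and orientation preserving symmetries $S_j\in D_n$ of the cube $[0,1]^n$ such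 that $$\varphi(x)=\bigl(b_{j,i}+\lambda^{k_{j,i}}\,(S_j(x)_i-a_{j,i})\bigr)_{i=1,\dots,n}\qquad\text{for all }x\in I_j\cap C_\lambda^n .$$ (2) The group $\mathfrak{diff}^{1,+}_{\mathbb R^n}(C_\lambda^n)$ is isomorphic to the symmetry extension $nV^{sym}$ of Brin's group $nV$. Here $nV^{sym}$ is the following group of homeomorphisms of $C_3^n$, where $C_3$ is the triadic Cantor set. A numbered pattern is a numbered finite partition of $[0,1]^n$ into dyadic parallelepipeds, obtained from the cube by finitely many steps, each cutting one parallelepiped into two equal halves by a hyperplane parallel to a coordinate hyperplane. Replacing halving by removal of the open middle third, each dyadic parallelepiped $R$ determines a standard parallelepiped $X(R)$ (for $\lambda=3$), and the sets $A(R)=X(R)\cap C_3^n$, with $R$ in a pattern, form a clopen partition of $C_3^n$. For numbered patterns $P=(L_1,\dots,L_m)$, $Q=(R_1,\dots,R_m)$ and $\Sigma=(\sigma_1,\dots,\sigma_m)\in D_n^m$, let $h_{P,Q,\Sigma}$ be the homeomorphism of $C_3^n$ which on $A(L_j)$ equals $\beta_{R_j}\circ\sigma_j\circ\beta_{L_j}^{-1}$,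 where $\beta_R$ is the coordinatewise affine increasing bijection from $[0,1]^n$ onto $X(R)$. The elements of $nV^{sym}$ are exactly the $h_{P,Q,\Sigma}$. -/

import Mathlib

open scoped Manifold

noncomputable section

namespace CantorDust

/-- The two contractions `φ₀ x = x / lam` and `φ₁ x = x / lam + (lam - 1) / lam` of the line. -/
def ifs (lam : ℝ) (b : Bool) (x : ℝ) : ℝ :=
  cond b (x / lam + (lam - 1) / lam) (x / lam)

/-- The stages of the construction of the central Cantor set, starting with `[0, 1]`. -/
def preCentralCantor (lam : ℝ) : ℕ → Set ℝ
  | 0 => Set.Icc 0 1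
  | k + 1 => ifs lam false '' preCentralCantor lam k ∪ ifs lam true '' preCentralCantor lam k

/-- The central Cantor set `C_lam`, the attractor of the two contractions `ifs lam` (see
`centralCantor_eq_of_attractor` below); for `lam = 3` it is the triadic Cantor set. -/
def centralCantor (lam : ℝ) : Set ℝ := ⋂ k, preCentralCantor lam k

/-- The product `C_lam ^ n` inside `ℝ ^ n`. -/
def dust (n : ℕ) (lam : ℝ) : Set (Fin n → ℝ) := Set.univ.pi fun _ => centralCantor lam

/-- The element `φ_{b₁} ∘ φ_{b₂} ∘ ⋯ ∘ φ_{b_r}` of the monoid generated by the contractions. -/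
def word (lam : ℝ) : List Bool → ℝ → ℝ
  | [] => id
  | b :: w => ifs lam b ∘ word lam w

/-- Addresses of parallelepipeds: one finite binary word for each coordinate. -/
abbrev Address (n : ℕ) : Type := Fin n → List Bool

/-- The coordinatewise affine increasing map from the unit cube onto the standard parallelepiped
with address `L`. -/
def boxMap {n : ℕ} (lam : ℝ) (L : Address n) (x : Fin n → ℝ) : Fin n → ℝ :=
  fun i => word lam (L i) (x i)

/-- The standard parallelepiped with address `L`: a product of standard intervals, i.e. of images
of `[0, 1]` under words in the two contractions. For `lam = 2` this is a dyadic parallelepiped of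
the unit cube; for `lam = 3` it is the corresponding parallelepiped of the construction of the
power of the triadic Cantor set. -/
def box {n : ℕ} (lam : ℝ) (L : Address n) : Set (Fin n → ℝ) :=
  boxMap lam L '' Set.Icc 0 1

/-- The symmetry of the unit cube `[0, 1] ^ n` whose linear part is `σ`; it fixes the centre.
It is an orientation preserving symmetry of the cube when `σ` is an orthogonal integer matrix
of determinant one, that is, `σ ∈ Matrix.specialOrthogonalGroup (Fin n) ℤ`. -/
def cubeMap {n : ℕ} (σ : Matrix (Fin n) (Fin n) ℤ) (x : Fin n → ℝ) : Fin n → ℝ :=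
  fun i => 1 / 2 + ∑ k, (σ i k : ℝ) * (x k - 1 / 2)

/-- One of the two halves of the dyadic parallelepiped with address `L`, cut orthogonally to the
`i`-th axis. -/
def half {n : ℕ} (L : Address n) (i : Fin n) (b : Bool) : Address n :=
  Function.update L i (L i ++ [b])

/-- Dyadic partitions of the unit cube: obtained from the cube by finitely many steps, each cutting
one parallelepiped into two equal halves by a hyperplane parallel to a coordinate hyperplane. -/
inductive IsDyadicPartition {n : ℕ} : Multiset (Address n) → Prop
  | cube : IsDyadicPartition {fun _ => []}
  | cut {P : Multiset (Address n)} {L : Address n} (i : Fin n) :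
      IsDyadicPartition (L ::ₘ P) →
      IsDyadicPartition (half L i false ::ₘ half L i true ::ₘ P)

/-- A numbered pattern: a dyadic partition of the cube whose members are numbered. -/
def IsNumberedPattern {n m : ℕ} (L : Fin m → Address n) : Prop :=
  IsDyadicPartition (Finset.univ.val.map L)

/-- `h` maps the part of the triadic `C ^ n` in the parallelepiped `L` to the part in the
parallelepiped `R`, by the symmetry `σ` of the cube followed by the coordinatewise increasing
affine identification (both parallelepipeds being identified with the unit cube). -/
def MapsBox {n : ℕ} (h : dust n 3 ≃ₜ dust n 3) (L : Address n) (σ : Matrix (Fin n) (Fin n) ℤ)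
    (R : Address n) : Prop :=
  ∀ x : dust n 3, ∀ y ∈ dust n 3, (x : Fin n → ℝ) = boxMap 3 L y →
    (h x : Fin n → ℝ) = boxMap 3 R (cubeMap σ y)

/-- `h` is the homeomorphism of the triadic `C ^ n` given by two numbered patterns with the same
number of parallelepipeds and a tuple of orientation preserving symmetries of the cube. -/
def IsPatternMap {n : ℕ} (h : dust n 3 ≃ₜ dust n 3) : Prop :=
  ∃ (m : ℕ) (L R : Fin m → Address n) (σ : Fin m → Matrix (Fin n) (Fin n) ℤ),
    IsNumberedPattern L ∧ IsNumberedPattern R ∧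
      ∀ j, σ j ∈ Matrix.specialOrthogonalGroup (Fin n) ℤ ∧ MapsBox h (L j) (σ j) (R j)

/-! The facts needed for these homeomorphisms to form a group. -/

theorem preCentralCantor_flip {lam : ℝ} (hl : lam ≠ 0) (k : ℕ) {x : ℝ}
    (hx : x ∈ preCentralCantor lam k) : 1 - x ∈ preCentralCantor lam k := by
  induction k generalizing x with
  | zero =>
    simp only [preCentralCantor, Set.mem_Icc] at hx ⊢
    constructor <;> linarith
  | succ k ih =>
    rcases hx with ⟨y, hy, rfl⟩ | ⟨y, hy, rfl⟩
    · refine Or.inr ⟨1 - y, ih hy, ?_⟩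
      simp only [ifs, cond_true, cond_false]
      field_simp
      ring
    · refine Or.inl ⟨1 - y, ih hy, ?_⟩
      simp only [ifs, cond_true, cond_false]
      field_simp
      ring

theorem centralCantor_flip {lam : ℝ} (hl : lam ≠ 0) {x : ℝ} (hx : x ∈ centralCantor lam) :
    1 - x ∈ centralCantor lam :=
  Set.mem_iInter.2 fun k => preCentralCantor_flip hl k (Set.mem_iInter.1 hx k)

theorem ifs_mem_Icc {lam : ℝ} (hl : 1 ≤ lam) (b : Bool) {x : ℝ} (hx : x ∈ Set.Icc (0 : ℝ) 1) :
    ifs lam b x ∈ Set.Icc (0 : ℝ) 1 := by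
  have h0 : 0 < lam := by linarith
  obtain ⟨h1, h2⟩ := hx
  cases b
  · simp only [ifs, cond_false, Set.mem_Icc]
    exact ⟨by positivity, by rw [div_le_one h0]; linarith⟩
  · simp only [ifs, cond_true, Set.mem_Icc, ← add_div]
    exact ⟨div_nonneg (by linarith) h0.le, by rw [div_le_one h0]; linarith⟩

theorem ifs_mem {lam : ℝ} (hl : 1 ≤ lam) (b : Bool) {x : ℝ} (hx : x ∈ centralCantor lam) :
    ifs lam b x ∈ centralCantor lam := by
  refine Set.mem_iInter.2 fun k => ?_
  cases k with
  | zero => exact ifs_mem_Icc hl b (Set.mem_iInter.1 hx 0)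
  | succ k =>
    cases b
    · exact Or.inl ⟨x, Set.mem_iInter.1 hx k, rfl⟩
    · exact Or.inr ⟨x, Set.mem_iInter.1 hx k, rfl⟩

theorem preCentralCantor_subset {lam : ℝ} (hl : 1 ≤ lam) (k : ℕ) :
    preCentralCantor lam k ⊆ Set.Icc 0 1 := by
  induction k with
  | zero => exact subset_rfl
  | succ k ih =>
    rintro x (⟨y, hy, rfl⟩ | ⟨y, hy, rfl⟩) <;> exact ifs_mem_Icc hl _ (ih hy)

theorem isCompact_preCentralCantor {lam : ℝ} (k : ℕ) :
    IsCompact (preCentralCantor lam k) := by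
  induction k with
  | zero => exact isCompact_Icc
  | succ k ih =>
    refine (ih.image ?_).union (ih.image ?_)
    · change Continuous fun x : ℝ => x / lam
      fun_prop
    · change Continuous fun x : ℝ => x / lam + (lam - 1) / lam
      fun_prop

/-- For `2 < lam`, `centralCantor lam` is the attractor of the two contractions: the unique
nonempty compact set which is the union of its two images. -/
theorem centralCantor_eq_of_attractor {lam : ℝ} (hl : 2 < lam) (K : Set ℝ) :
    (IsCompact K ∧ K.Nonempty ∧ K = ifs lam false '' K ∪ ifs lam true '' K) ↔
      K = centralCantor lam := by
  have h0 : 0 < lam := by linarith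
  have h1 : 1 ≤ lam := by linarith
  have hsub : centralCantor lam ⊆ Set.Icc 0 1 := fun x hx => Set.mem_iInter.1 hx 0
  constructor
  · rintro ⟨hK, hne, hfix⟩
    have hi : ∀ b, ∀ x ∈ K, ifs lam b x ∈ K := by
      intro b x hx
      rw [hfix]
      cases b
      · exact Or.inl ⟨x, hx, rfl⟩
      · exact Or.inr ⟨x, hx, rfl⟩
    have hK1 : K ⊆ Set.Icc 0 1 := by
      obtain ⟨M, hM, hMub⟩ := hK.exists_isGreatest hne
      obtain ⟨m, hm, hmlb⟩ := hK.exists_isLeast hne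
      have hM1 : M ≤ 1 := by
        rw [hfix] at hM
        rcases hM with ⟨y, hy, rfl⟩ | ⟨y, hy, rfl⟩
        · have := hMub hy
          simp only [ifs, cond_false] at this ⊢
          rw [le_div_iff₀ h0] at this
          rw [div_le_one h0]
          by_contra hc
          nlinarith
        · have := hMub hy
          simp only [ifs, cond_true, ← add_div] at this ⊢
          rw [le_div_iff₀ h0] at this
          rw [div_le_one h0]
          by_contra hc
          nlinarith
      have hm0 : 0 ≤ m := by
        rw [hfix] at hm
        rcases hm with ⟨y, hy, rfl⟩ | ⟨y, hy, rfl⟩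
        · have := hmlb hy
          simp only [ifs, cond_false] at this ⊢
          rw [div_le_iff₀ h0] at this
          refine div_nonneg ?_ h0.le
          nlinarith
        · have := hmlb hy
          simp only [ifs, cond_true, ← add_div] at this ⊢
          rw [div_le_iff₀ h0] at this
          refine div_nonneg ?_ h0.le
          by_contra hc
          nlinarith
      exact fun x hx => ⟨hm0.trans (hmlb hx), (hMub hx).trans hM1⟩
    apply Set.Subset.antisymm
    · have : ∀ k, K ⊆ preCentralCantor lam k := by
        intro k
        induction k with
        | zero => exact hK1
        | succ k ih =>
          rw [hfix]
          exact Set.union_subset_union (Set.image_mono ih) (Set.image_mono ih)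
      exact Set.subset_iInter this
    · have key : ∀ k, ∀ x ∈ preCentralCantor lam k, ∃ y ∈ K, |x - y| ≤ (1 / lam) ^ k := by
        intro k
        induction k with
        | zero =>
          intro x hx
          obtain ⟨y, hy⟩ := hne
          refine ⟨y, hy, ?_⟩
          have hy1 := hK1 hy
          have hx' : x ∈ Set.Icc (0 : ℝ) 1 := hx
          rw [pow_zero, abs_le]
          constructor <;> linarith [hx'.1, hx'.2, hy1.1, hy1.2]
        | succ k ih =>
          have step : ∀ b x y, |x - y| ≤ (1 / lam) ^ k →
              |ifs lam b x - ifs lam b y| ≤ (1 / lam) ^ (k + 1) := by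
            intro b x y h
            have e : ifs lam b x - ifs lam b y = (x - y) * (1 / lam) := by
              cases b <;> simp only [ifs, cond_true, cond_false] <;> ring
            rw [e, abs_mul, abs_of_pos (by positivity : 0 < 1 / lam), pow_succ]
            gcongr
          rintro x (⟨x, hx, rfl⟩ | ⟨x, hx, rfl⟩)
          · obtain ⟨y, hy, h⟩ := ih x hx
            exact ⟨_, hi false y hy, step _ _ _ h⟩
          · obtain ⟨y, hy, h⟩ := ih x hx
            exact ⟨_, hi true y hy, step _ _ _ h⟩
      intro x hx
      rw [← hK.isClosed.closure_eq, Metric.mem_closure_iff]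
      intro ε hε
      obtain ⟨k, hk⟩ := exists_pow_lt_of_lt_one hε (by
        rw [div_lt_one h0]
        linarith : 1 / lam < 1)
      obtain ⟨y, hy, h⟩ := key k x (Set.mem_iInter.1 hx k)
      exact ⟨y, hy, by rw [Real.dist_eq]; exact h.trans_lt hk⟩
  · rintro rfl
    refine ⟨isCompact_Icc.of_isClosed_subset
      (isClosed_iInter fun k => (isCompact_preCentralCantor k).isClosed) hsub, ⟨0, ?_⟩, ?_⟩
    · refine Set.mem_iInter.2 fun k => ?_
      induction k with
      | zero => exact ⟨le_rfl, zero_le_one⟩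
      | succ k ih => exact Or.inl ⟨0, ih, by simp [ifs]⟩
    · apply Set.Subset.antisymm
      · intro x hx
        have hx' : ∀ k, x ∈ preCentralCantor lam (k + 1) := fun k => Set.mem_iInter.1 hx (k + 1)
        by_cases hc : x * lam ≤ 1
        · refine Or.inl ⟨x * lam, Set.mem_iInter.2 fun k => ?_, by simp [ifs, h0.ne']⟩
          rcases hx' k with ⟨y, hy, rfl⟩ | ⟨y, hy, rfl⟩
          · have e : ifs lam false y * lam = y := by simp [ifs, h0.ne']
            rwa [e]
          · have := (preCentralCantor_subset h1 k hy).1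
            have e : ifs lam true y * lam = y + (lam - 1) := by
              simp only [ifs, cond_true]
              field_simp
            rw [e] at hc
            linarith
        · refine Or.inr ⟨x * lam - (lam - 1), Set.mem_iInter.2 fun k => ?_, ?_⟩
          · rcases hx' k with ⟨y, hy, rfl⟩ | ⟨y, hy, rfl⟩
            · have := (preCentralCantor_subset h1 k hy).2
              have e : ifs lam false y * lam = y := by simp [ifs, h0.ne']
              rw [e] at hc
              linarith
            · have e : ifs lam true y * lam - (lam - 1) = y := by
                simp only [ifs, cond_true]
                field_simp
                ring
              rwa [e]
          · simp only [ifs, cond_true]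
            field_simp
            ring
      · rintro x (⟨y, hy, rfl⟩ | ⟨y, hy, rfl⟩) <;> exact ifs_mem h1 _ hy

theorem word_mem {lam : ℝ} (hl : 1 ≤ lam) (w : List Bool) {x : ℝ} (hx : x ∈ centralCantor lam) :
    word lam w x ∈ centralCantor lam := by
  induction w with
  | nil => exact hx
  | cons b w ih => exact ifs_mem hl b ih

theorem boxMap_mem {n : ℕ} {lam : ℝ} (hl : 1 ≤ lam) (L : Address n) {x : Fin n → ℝ}
    (hx : x ∈ dust n lam) : boxMap lam L x ∈ dust n lam :=
  fun i _ => word_mem hl (L i) (hx i trivial)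

theorem word_append (lam : ℝ) (w : List Bool) (b : Bool) (x : ℝ) :
    word lam (w ++ [b]) x = word lam w (ifs lam b x) := by
  induction w with
  | nil => rfl
  | cons c w ih => simp only [List.cons_append, word, Function.comp_apply, ih]

theorem boxMap_half {n : ℕ} (lam : ℝ) (L : Address n) (i : Fin n) (b : Bool) (y : Fin n → ℝ) :
    boxMap lam (half L i b) y = boxMap lam L (Function.update y i (ifs lam b (y i))) := by
  funext k
  by_cases hk : k = i
  · subst hk
    simp [boxMap, half, word_append]
  · simp [boxMap, half, hk]

theorem row_aux {n : ℕ} {f : Fin n → ℤ} (hf : ∑ k, f k * f k = 1) {k₀ : Fin n} (h0 : f k₀ ≠ 0) :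
    (f k₀ = 1 ∨ f k₀ = -1) ∧ ∀ k, k ≠ k₀ → f k = 0 := by
  rw [← Finset.add_sum_erase _ _ (Finset.mem_univ k₀)] at hf
  have h1 : 1 ≤ f k₀ * f k₀ := by
    have : 0 < f k₀ * f k₀ := mul_self_pos.2 h0
    omega
  have h2 : 0 ≤ ∑ k ∈ Finset.univ.erase k₀, f k * f k :=
    Finset.sum_nonneg fun k _ => mul_self_nonneg _
  have h3 : ∑ k ∈ Finset.univ.erase k₀, f k * f k = 0 := by omega
  refine ⟨mul_self_eq_one_iff.1 (by omega), fun k hk => ?_⟩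
  have := (Finset.sum_eq_zero_iff_of_nonneg fun k _ => mul_self_nonneg (f k)).1 h3 k
    (by simp [hk])
  simpa using this

theorem transpose_mem {n : ℕ} {σ : Matrix (Fin n) (Fin n) ℤ}
    (hσ : σ ∈ Matrix.specialOrthogonalGroup (Fin n) ℤ) :
    σ.transpose ∈ Matrix.specialOrthogonalGroup (Fin n) ℤ := by
  rw [Matrix.mem_specialOrthogonalGroup_iff] at hσ ⊢
  refine ⟨?_, by rw [Matrix.det_transpose]; exact hσ.2⟩
  rw [Matrix.mem_orthogonalGroup_iff, Matrix.transpose_transpose]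
  exact (Matrix.mem_orthogonalGroup_iff' _ _).1 hσ.1

theorem exists_entry {n : ℕ} {σ : Matrix (Fin n) (Fin n) ℤ}
    (hσ : σ ∈ Matrix.specialOrthogonalGroup (Fin n) ℤ) (i : Fin n) :
    ∃ k, (σ i k = 1 ∨ σ i k = -1) ∧ (∀ k', k' ≠ k → σ i k' = 0) ∧ ∀ i', i' ≠ i → σ i' k = 0 := by
  rw [Matrix.mem_specialOrthogonalGroup_iff] at hσ
  have hr : ∑ k, σ i k * σ i k = 1 := by
    have := congrFun (congrFun ((Matrix.mem_orthogonalGroup_iff _ _).1 hσ.1) i) i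
    simpa [Matrix.mul_apply] using this
  obtain ⟨k, hk⟩ : ∃ k, σ i k ≠ 0 := by
    by_contra! hc
    simp [hc] at hr
  have hc : ∑ i', σ i' k * σ i' k = 1 := by
    have := congrFun (congrFun ((Matrix.mem_orthogonalGroup_iff' _ _).1 hσ.1) k) k
    simpa [Matrix.mul_apply] using this
  exact ⟨k, (row_aux hr hk).1, (row_aux hr hk).2, (row_aux (f := fun i' => σ i' k) hc hk).2⟩

theorem cubeMap_apply_entry {n : ℕ} {σ : Matrix (Fin n) (Fin n) ℤ} {i k : Fin n}
    (h : ∀ k', k' ≠ k → σ i k' = 0) (y : Fin n → ℝ) :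
    cubeMap σ y i = 1 / 2 + (σ i k : ℝ) * (y k - 1 / 2) := by
  simp only [cubeMap]
  rw [Finset.sum_eq_single k]
  · intro k' _ hk'
    simp [h k' hk']
  · simp

theorem cubeMap_mem {n : ℕ} {lam : ℝ} (hl : lam ≠ 0) {σ : Matrix (Fin n) (Fin n) ℤ}
    (hσ : σ ∈ Matrix.specialOrthogonalGroup (Fin n) ℤ) {y : Fin n → ℝ} (hy : y ∈ dust n lam) :
    cubeMap σ y ∈ dust n lam := by
  intro i _
  obtain ⟨k, hk, hr, -⟩ := exists_entry hσ i
  have hyk := hy k trivial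
  rw [cubeMap_apply_entry hr]
  rcases hk with hk | hk <;> rw [hk]
  · have e : (1 / 2 + ((1 : ℤ) : ℝ) * (y k - 1 / 2) : ℝ) = y k := by push_cast; ring
    rw [e]
    exact hyk
  · have e : (1 / 2 + ((-1 : ℤ) : ℝ) * (y k - 1 / 2) : ℝ) = 1 - y k := by push_cast; ring
    rw [e]
    exact centralCantor_flip hl hyk

theorem cubeMap_one {n : ℕ} (y : Fin n → ℝ) : cubeMap 1 y = y := by
  funext i
  rw [cubeMap_apply_entry (k := i) fun k' hk' => Matrix.one_apply_ne' hk']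
  simp

theorem cubeMap_mul {n : ℕ} (σ τ : Matrix (Fin n) (Fin n) ℤ) (y : Fin n → ℝ) :
    cubeMap (σ * τ) y = cubeMap σ (cubeMap τ y) := by
  funext i
  simp only [cubeMap, Matrix.mul_apply, Int.cast_sum, Int.cast_mul, Finset.sum_mul,
    add_sub_cancel_left, Finset.mul_sum]
  rw [Finset.sum_comm]
  simp only [mul_assoc]

theorem cubeMap_update {n : ℕ} {lam : ℝ} (hl : lam ≠ 0) {σ : Matrix (Fin n) (Fin n) ℤ}
    (hσ : σ ∈ Matrix.specialOrthogonalGroup (Fin n) ℤ) (i : Fin n) :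
    ∃ k c, ∀ (b : Bool) (y : Fin n → ℝ),
      cubeMap σ (Function.update y k (ifs lam b (y k))) =
        Function.update (cubeMap σ y) i (ifs lam (xor b c) (cubeMap σ y i)) := by
  obtain ⟨k, hk, hr, hc⟩ := exists_entry hσ i
  refine ⟨k, decide (σ i k = -1), fun b y => ?_⟩
  funext i'
  by_cases hi : i' = i
  · subst hi
    rw [Function.update_self, cubeMap_apply_entry hr, cubeMap_apply_entry hr, Function.update_self]
    rcases hk with hk | hk <;> rw [hk] <;> cases b <;> simp [ifs] <;> field_simp <;> ring
  · rw [Function.update_of_ne hi]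
    simp only [cubeMap]
    congr 1
    refine Finset.sum_congr rfl fun k' _ => ?_
    by_cases hk' : k' = k
    · subst hk'
      simp [hc i' hi]
    · rw [Function.update_of_ne hk']

theorem update_mem {n : ℕ} {lam : ℝ} (hl : 1 ≤ lam) (k : Fin n) (b : Bool) {y : Fin n → ℝ}
    (hy : y ∈ dust n lam) : Function.update y k (ifs lam b (y k)) ∈ dust n lam := by
  intro i _
  by_cases hi : i = k
  · subst hi
    rw [Function.update_self]
    exact ifs_mem hl b (hy i trivial)
  · rw [Function.update_of_ne hi]
    exact hy i trivial

/-- A piece of a pattern map: source, symmetry, target. -/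
abbrev Piece (n : ℕ) : Type := Address n × Matrix (Fin n) (Fin n) ℤ × Address n

/-- The pieces in `T` describe `h`. -/
def Describes {n : ℕ} (h : dust n 3 ≃ₜ dust n 3) (T : Multiset (Piece n)) : Prop :=
  ∀ t ∈ T, t.2.1 ∈ Matrix.specialOrthogonalGroup (Fin n) ℤ ∧ MapsBox h t.1 t.2.1 t.2.2

theorem isPatternMap_iff {n : ℕ} {h : dust n 3 ≃ₜ dust n 3} :
    IsPatternMap h ↔ ∃ T : Multiset (Piece n), Describes h T ∧
      IsDyadicPartition (T.map fun t => t.1) ∧ IsDyadicPartition (T.map fun t => t.2.2) := by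
  constructor
  · rintro ⟨m, L, R, σ, hL, hR, hh⟩
    refine ⟨Finset.univ.val.map fun j => (L j, σ j, R j), ?_, ?_, ?_⟩
    · intro t ht
      obtain ⟨j, -, rfl⟩ := Multiset.mem_map.1 ht
      exact hh j
    · rw [Multiset.map_map]
      exact hL
    · rw [Multiset.map_map]
      exact hR
  · rintro ⟨T, hT, h1, h2⟩
    have key : (Finset.univ : Finset (Fin T.toList.length)).val.map T.toList.get = T := by
      rw [Fin.univ_val_map, List.ofFn_get, Multiset.coe_toList]
    refine ⟨T.toList.length, fun j => (T.toList.get j).1, fun j => (T.toList.get j).2.2,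
      fun j => (T.toList.get j).2.1, ?_, ?_, fun j => hT _ ?_⟩
    · rw [← key, Multiset.map_map] at h1
      exact h1
    · rw [← key, Multiset.map_map] at h2
      exact h2
    · exact Multiset.mem_toList.1 (List.get_mem _ _)

theorem mapsBox_half {n : ℕ} {h : dust n 3 ≃ₜ dust n 3} {L R : Address n}
    {σ : Matrix (Fin n) (Fin n) ℤ} (hσ : σ ∈ Matrix.specialOrthogonalGroup (Fin n) ℤ)
    (hh : MapsBox h L σ R) (i : Fin n) :
    ∃ k c, ∀ b, MapsBox h (half L k b) σ (half R i (xor b c)) := by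
  obtain ⟨k, c, hkc⟩ := cubeMap_update (lam := 3) (by norm_num) hσ i
  refine ⟨k, c, fun b x y hy hx => ?_⟩
  rw [boxMap_half] at hx ⊢
  rw [hh x _ (update_mem (by norm_num) k b hy) hx, hkc]

theorem mapsBox_inv {n : ℕ} {h : dust n 3 ≃ₜ dust n 3} {L R : Address n}
    {σ : Matrix (Fin n) (Fin n) ℤ} (hσ : σ ∈ Matrix.specialOrthogonalGroup (Fin n) ℤ)
    (hh : MapsBox h L σ R) : MapsBox h⁻¹ R σ.transpose L := by
  intro x y hy hx
  have hy' := cubeMap_mem (lam := 3) (by norm_num) (transpose_mem hσ) hy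
  have e := hh ⟨_, boxMap_mem (by norm_num) L hy'⟩ _ hy' rfl
  rw [← cubeMap_mul, (Matrix.mem_orthogonalGroup_iff _ _).1
    (Matrix.mem_specialOrthogonalGroup_iff.1 hσ).1, cubeMap_one, ← hx] at e
  have e' : h ⟨_, boxMap_mem (by norm_num) L hy'⟩ = x := Subtype.ext e
  have : h⁻¹ x = ⟨_, boxMap_mem (by norm_num) L hy'⟩ := by
    rw [← e']
    exact h.symm_apply_apply _
  rw [this]

theorem isPatternMap_one (n : ℕ) : IsPatternMap (1 : dust n 3 ≃ₜ dust n 3) := by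
  rw [isPatternMap_iff]
  refine ⟨{(fun _ => [], 1, fun _ => [])}, ?_, ?_, ?_⟩
  · intro t ht
    rw [Multiset.mem_singleton] at ht
    subst ht
    refine ⟨one_mem _, fun x y _ hx => ?_⟩
    rw [cubeMap_one]
    exact hx
  · simpa using IsDyadicPartition.cube
  · simpa using IsDyadicPartition.cube

theorem isPatternMap_inv {n : ℕ} {h : dust n 3 ≃ₜ dust n 3} (hh : IsPatternMap h) :
    IsPatternMap h⁻¹ := by
  rw [isPatternMap_iff] at hh ⊢
  obtain ⟨T, hT, h1, h2⟩ := hh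
  refine ⟨T.map fun t => (t.2.2, t.2.1.transpose, t.1), ?_, ?_, ?_⟩
  · intro t ht
    obtain ⟨s, hs, rfl⟩ := Multiset.mem_map.1 ht
    exact ⟨transpose_mem (hT s hs).1, mapsBox_inv (hT s hs).1 (hT s hs).2⟩
  · simpa [Multiset.map_map, Function.comp_def] using h2
  · simpa [Multiset.map_map, Function.comp_def] using h1

/-- Cutting one parallelepiped of a family. -/
def CutStep {n : ℕ} (P Q : Multiset (Address n)) : Prop :=
  ∃ L i P', P = L ::ₘ P' ∧ Q = half L i false ::ₘ half L i true ::ₘ P'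

/-- Both halves of a parallelepiped. -/
def halves {n : ℕ} (i : Fin n) (L : Address n) : Multiset (Address n) :=
  {half L i false, half L i true}

/-- Cutting several parallelepipeds of a family in the same direction. -/
def ParStep {n : ℕ} (P Q : Multiset (Address n)) : Prop :=
  ∃ i A B, P = A + B ∧ Q = A.bind (halves i) + B

theorem half_comm {n : ℕ} (L : Address n) {i k : Fin n} (hik : i ≠ k) (b c : Bool) :
    half (half L i b) k c = half (half L k c) i b := by
  simp only [half, Function.update_of_ne hik, Function.update_of_ne hik.symm]
  exact Function.update_comm hik _ _ _

theorem halves_comm {n : ℕ} {i k : Fin n} (hik : i ≠ k) (A : Multiset (Address n)) :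
    (A.bind (halves i)).bind (halves k) = (A.bind (halves k)).bind (halves i) := by
  rw [Multiset.bind_assoc, Multiset.bind_assoc]
  congr 1
  funext L
  have e : ∀ (M : Address n) (j : Fin n), halves j M = half M j false ::ₘ {half M j true} :=
    fun _ _ => rfl
  simp only [e, Multiset.cons_bind, Multiset.singleton_bind, half_comm L hik]
  simp only [← Multiset.singleton_add]
  abel

theorem exists_split {α : Type*} [DecidableEq α] {A B A' B' : Multiset α} (h : A + B = A' + B') :
    ∃ p q r s : Multiset α, A = p + q ∧ B = r + s ∧ A' = p + r ∧ B' = q + s := by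
  refine ⟨A ∩ A', A - A', A' - A, B - (A' - A), ?_, ?_, ?_, ?_⟩ <;> ext x <;>
    (have := congrArg (Multiset.count x) h
     simp only [Multiset.count_add, Multiset.count_sub, Multiset.count_inter] at this ⊢
     omega)

theorem parStep_diamond {n : ℕ} {P Q Q' : Multiset (Address n)} (h : ParStep P Q)
    (h' : ParStep P Q') : ∃ T, ParStep Q T ∧ ParStep Q' T := by
  obtain ⟨i, A, B, rfl, rfl⟩ := h
  obtain ⟨k, A', B', e, rfl⟩ := h'
  obtain ⟨p, q, r, s, rfl, rfl, rfl, rfl⟩ := exists_split e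
  by_cases hik : i = k
  · subst hik
    clear e
    refine ⟨p.bind (halves i) + q.bind (halves i) + r.bind (halves i) + s,
      ⟨i, r, p.bind (halves i) + q.bind (halves i) + s, ?_, ?_⟩,
      ⟨i, q, p.bind (halves i) + r.bind (halves i) + s, ?_, ?_⟩⟩ <;>
    · try simp only [Multiset.add_bind]
      abel
  · refine ⟨(p.bind (halves i)).bind (halves k) + q.bind (halves i) + r.bind (halves k) + s,
      ⟨k, p.bind (halves i) + r, q.bind (halves i) + s, ?_, ?_⟩,
      ⟨i, p.bind (halves k) + q, r.bind (halves k) + s, ?_, ?_⟩⟩ <;>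
    · try simp only [Multiset.add_bind, halves_comm hik]
      abel

theorem ParStep.toCutSteps {n : ℕ} {P Q : Multiset (Address n)} (h : ParStep P Q) :
    Relation.ReflTransGen CutStep P Q := by
  obtain ⟨i, A, B, rfl, rfl⟩ := h
  induction A using Multiset.induction generalizing B with
  | empty => simpa using Relation.ReflTransGen.refl
  | cons L A ih =>
    refine Relation.ReflTransGen.head (b := A + (halves i L + B)) ⟨L, i, A + B, ?_, ?_⟩ ?_
    · rw [Multiset.cons_add]
    · simp only [halves, Multiset.insert_eq_cons, ← Multiset.singleton_add]
      abel
    · have := ih (halves i L + B)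
      rw [Multiset.cons_bind]
      convert this using 1
      abel

theorem IsDyadicPartition.parSteps {n : ℕ} {P : Multiset (Address n)} (h : IsDyadicPartition P) :
    Relation.ReflTransGen ParStep {fun _ => []} P := by
  induction h with
  | cube => exact Relation.ReflTransGen.refl
  | @cut P L i _ ih =>
    refine ih.tail ⟨i, {L}, P, ?_, ?_⟩
    · rw [Multiset.singleton_add]
    · rw [Multiset.singleton_bind]
      simp only [halves, Multiset.insert_eq_cons, ← Multiset.singleton_add]
      abel

theorem exists_common {n : ℕ} {P Q : Multiset (Address n)} (hP : IsDyadicPartition P)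
    (hQ : IsDyadicPartition Q) :
    ∃ T, Relation.ReflTransGen CutStep P T ∧ Relation.ReflTransGen CutStep Q T := by
  have toCut : ∀ {P Q : Multiset (Address n)}, Relation.ReflTransGen ParStep P Q →
      Relation.ReflTransGen CutStep P Q := by
    intro P Q h
    induction h with
    | refl => exact Relation.ReflTransGen.refl
    | tail _ h ih => exact ih.trans h.toCutSteps
  obtain ⟨T, h1, h2⟩ := Relation.church_rosser (r := ParStep (n := n))
    (fun a b c hb hc => by
      obtain ⟨d, h1, h2⟩ := parStep_diamond hb hc
      exact ⟨d, Relation.ReflGen.single h1, Relation.ReflTransGen.single h2⟩)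
    hP.parSteps hQ.parSteps
  exact ⟨T, toCut h1, toCut h2⟩

theorem refine_target {n : ℕ} {h : dust n 3 ≃ₜ dust n 3} {T : Multiset (Piece n)}
    (hT : Describes h T) (hP : IsDyadicPartition (T.map fun t => t.1))
    {Q : Multiset (Address n)} (hQ : Relation.ReflTransGen CutStep (T.map fun t => t.2.2) Q) :
    ∃ T' : Multiset (Piece n), Describes h T' ∧ IsDyadicPartition (T'.map fun t => t.1) ∧
      T'.map (fun t => t.2.2) = Q := by
  induction hQ with
  | refl => exact ⟨T, hT, hP, rfl⟩
  | tail _ hs ih =>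
    obtain ⟨S, hS, hSP, hSQ⟩ := ih
    obtain ⟨R, i, Q', rfl, rfl⟩ := hs
    classical
    obtain ⟨⟨L, σ, R'⟩, ht, e, hmap⟩ := (Multiset.map_eq_cons _ _ _ _).2 hSQ
    obtain rfl : R' = R := e
    obtain ⟨S', rfl⟩ := Multiset.exists_cons_of_mem ht
    rw [Multiset.erase_cons_head] at hmap
    obtain ⟨hσ, hL⟩ := hS _ (Multiset.mem_cons_self _ _)
    obtain ⟨k, c, hkc⟩ := mapsBox_half hσ hL i
    refine ⟨(half L k c, σ, half R' i false) ::ₘ (half L k !c, σ, half R' i true) ::ₘ S',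
      ?_, ?_, ?_⟩
    · intro t ht
      rw [Multiset.mem_cons, Multiset.mem_cons] at ht
      rcases ht with rfl | rfl | ht
      · refine ⟨hσ, ?_⟩
        have := hkc c
        rwa [Bool.xor_self] at this
      · refine ⟨hσ, ?_⟩
        have := hkc !c
        rwa [Bool.not_xor_self] at this
      · exact hS t (Multiset.mem_cons_of_mem ht)
    · have := IsDyadicPartition.cut (P := S'.map fun t => t.1) (L := L) k (by simpa using hSP)
      cases c
      · simpa using this
      · rw [Multiset.cons_swap] at this
        simpa using this
    · simp [hmap]

theorem exists_compose {n : ℕ} {g f : dust n 3 ≃ₜ dust n 3} {T U : Multiset (Piece n)}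
    (hT : Describes f T) (hU : Describes g U)
    (h : Multiset.Rel (fun t u : Piece n => t.2.2 = u.1) T U) :
    ∃ V : Multiset (Piece n), Describes (g * f) V ∧
      V.map (fun t => t.1) = T.map (fun t => t.1) ∧
      V.map (fun t => t.2.2) = U.map (fun t => t.2.2) := by
  induction h with
  | zero => exact ⟨0, by simp [Describes], rfl, rfl⟩
  | @cons t u T U htu _ ih =>
    obtain ⟨V, hV, h1, h2⟩ := ih (fun s hs => hT s (Multiset.mem_cons_of_mem hs))
      (fun s hs => hU s (Multiset.mem_cons_of_mem hs))
    obtain ⟨hσ, hf⟩ := hT t (Multiset.mem_cons_self _ _)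
    obtain ⟨hτ, hg⟩ := hU u (Multiset.mem_cons_self _ _)
    refine ⟨(t.1, u.2.1 * t.2.1, u.2.2) ::ₘ V, ?_, by simp [h1], by simp [h2]⟩
    intro s hs
    rcases Multiset.mem_cons.1 hs with rfl | hs
    · refine ⟨mul_mem hτ hσ, fun x y hy hx => ?_⟩
      have e := hf x y hy hx
      rw [htu] at e
      rw [Homeomorph.mul_apply, hg (f x) _ (cubeMap_mem (by norm_num) hσ hy) e, cubeMap_mul]
    · exact hV s hs

theorem isPatternMap_mul {n : ℕ} {g f : dust n 3 ≃ₜ dust n 3} (hg : IsPatternMap g)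
    (hf : IsPatternMap f) : IsPatternMap (g * f) := by
  have hg' := isPatternMap_inv hg
  rw [isPatternMap_iff] at hg' hf ⊢
  obtain ⟨T, hT, hT1, hT2⟩ := hf
  obtain ⟨U, hU, hU1, hU2⟩ := hg'
  obtain ⟨Q, hTQ, hUQ⟩ := exists_common hT2 hU2
  obtain ⟨T', hT', hT1', hTQ'⟩ := refine_target hT hT1 hTQ
  obtain ⟨U', hU', hU1', hUQ'⟩ := refine_target hU hU1 hUQ
  have hW : Describes g (U'.map fun t => (t.2.2, t.2.1.transpose, t.1)) := by
    intro t ht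
    obtain ⟨s, hs, rfl⟩ := Multiset.mem_map.1 ht
    refine ⟨transpose_mem (hU' s hs).1, ?_⟩
    have := mapsBox_inv (hU' s hs).1 (hU' s hs).2
    rwa [inv_inv] at this
  obtain ⟨V, hV, h1, h2⟩ := exists_compose hT' hW (by
    rw [Multiset.rel_map_right]
    have : Multiset.Rel Eq (T'.map fun t => t.2.2) (U'.map fun t => t.2.2) := by
      rw [Multiset.rel_eq, hTQ', hUQ']
    rwa [Multiset.rel_map] at this)
  refine ⟨V, hV, by rwa [h1], ?_⟩
  rw [h2, Multiset.map_map]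
  exact hU1'

/-- The symmetry extension `nV^sym` of Brin's group `nV`: the group of all homeomorphisms of the
`n`-th power of the triadic Cantor set given by two numbered patterns and a tuple of orientation
preserving symmetries of the cube. -/
def nVSym (n : ℕ) : Subgroup (dust n 3 ≃ₜ dust n 3) where
  carrier := {h | IsPatternMap h}
  one_mem' := isPatternMap_one n
  mul_mem' := isPatternMap_mul
  inv_mem' := isPatternMap_inv

/-- The group of the transformations of `C_lam ^ n` that are restrictions of orientation preserving
`C ^ 1` diffeomorphisms of `ℝ ^ n` sending `C_lam ^ n` to itself. -/
def diffPlus (n : ℕ) (lam : ℝ) : Subgroup (dust n lam ≃ₜ dust n lam) where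
  carrier := {φ | ∃ Φ : Diffeomorph 𝓘(ℝ, Fin n → ℝ) 𝓘(ℝ, Fin n → ℝ) (Fin n → ℝ) (Fin n → ℝ) 1,
    (∀ x, 0 < (fderiv ℝ Φ x).det) ∧ ∀ x : dust n lam, Φ x = φ x}
  one_mem' := by
    refine ⟨Diffeomorph.refl _ _ _, fun x => ?_, fun x => rfl⟩
    rw [Diffeomorph.coe_refl, fderiv_id]
    simp [ContinuousLinearMap.det]
  mul_mem' := by
    rintro φ ψ ⟨Φ, hΦ, hφ⟩ ⟨Ψ, hΨ, hψ⟩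
    refine ⟨Ψ.trans Φ, fun x => ?_, fun x => ?_⟩
    · have h1 : DifferentiableAt ℝ Ψ x :=
        (Ψ.contMDiff.contDiff.differentiable one_ne_zero) x
      have h2 : DifferentiableAt ℝ Φ (Ψ x) :=
        (Φ.contMDiff.contDiff.differentiable one_ne_zero) _
      rw [Diffeomorph.coe_trans, fderiv_comp x h2 h1]
      have : ((fderiv ℝ Φ (Ψ x)).comp (fderiv ℝ Ψ x)).det =
          (fderiv ℝ Φ (Ψ x)).det * (fderiv ℝ Ψ x).det := LinearMap.det_comp _ _
      rw [this]
      exact mul_pos (hΦ _) (hΨ _)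
    · rw [Diffeomorph.coe_trans, Function.comp_apply, hψ, hφ]
      rfl
  inv_mem' := by
    rintro φ ⟨Φ, hΦ, hφ⟩
    refine ⟨Φ.symm, fun x => ?_, fun x => ?_⟩
    · have h1 : DifferentiableAt ℝ Φ.symm x :=
        (Φ.symm.contMDiff.contDiff.differentiable one_ne_zero) x
      have h2 : DifferentiableAt ℝ Φ (Φ.symm x) :=
        (Φ.contMDiff.contDiff.differentiable one_ne_zero) _
      have e : (fderiv ℝ Φ (Φ.symm x)).comp (fderiv ℝ Φ.symm x) =
          ContinuousLinearMap.id ℝ (Fin n → ℝ) := by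
        rw [← fderiv_comp x h2 h1, ← fderiv_id (x := x)]
        congr 1
        funext y
        exact Φ.apply_symm_apply y
      have e2 : (fderiv ℝ Φ (Φ.symm x)).det * (fderiv ℝ Φ.symm x).det = 1 := by
        have : ((fderiv ℝ Φ (Φ.symm x)).comp (fderiv ℝ Φ.symm x)).det =
          (fderiv ℝ Φ (Φ.symm x)).det * (fderiv ℝ Φ.symm x).det := LinearMap.det_comp _ _
        rw [← this, e]
        simp [ContinuousLinearMap.det]
      have h3 := hΦ (Φ.symm x)
      by_contra hneg
      nlinarith [mul_nonneg h3.le (neg_nonneg.2 (not_lt.1 hneg))]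
    · have := hφ (φ⁻¹ x)
      have e : φ (φ⁻¹ x) = x := φ.apply_symm_apply x
      rw [e] at this
      rw [← this]
      exact Φ.symm_apply_apply _

end CantorDust

end

open scoped Manifold

noncomputable section

namespace CantorDust

/-! ### The central Cantor set -/

section Cantor

variable {lam : ℝ}

/-! Both assertions rest on a rigidity property: at small scales the gaps of the Cantor set leave a
smooth map no freedom. On a standard cube of side `λ⁻ʳ`, a `C¹` map `Φ` preserving the dust is, up
to an error small relative to the scale, its derivative `A`. So each coordinate of `Φ` gives a
nearly linear map from the dust to `C_λ`. Motion along one axis with slope `v` cannot jump over a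
gap much longer than `(1 - 2/λ) v`, whereas two non-negligible slopes in a row of `A` would force a
jump of about `1 - 2/λ` times their sum. Hence each row has one nonzero entry (`small_of_two`). The
coordinate map then has its image in a standard interval of comparable length. Once that interval is
rescaled to `[0, 1]`, the map must preserve every binary digit, so it is a coordinate, up to
reflection (`eq_coord_of_near`, `eq_word_of_near`). The signs of `A` form a symmetry of the cube, of
determinant one because `det A > 0`, and compactness provides one level `r` valid everywhere
(`exists_level_boxToBox`). This gives the affine form in (1), after rewriting
(`exists_affine_form`).

For (2), identifying points with equal binary addresses conjugates the dust of ratio `λ` to the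
triadic one. This respects boxes and symmetries, so a diffeomorphism becomes a homeomorphism
carrying the boxes of a dyadic partition to boxes. Cutting the targets down to a common level turns
them into a full grid, hence it is a pattern map (`isPatternMap_of_mapsBox`).

Conversely, a pattern map is realised by a diffeomorphism (`exists_diffeo_boxes`): shrink the source
boxes to tiny equal cubes about their centres, move the centres with the required rotations as
germs, and undo the analogous shrinking at the targets. Germs of determinant one at distinct points
can be prescribed freely by composing shears (`germRel_of_injective`); this is where two axes are
needed. -/

theorem centralCantor_attractor (hl : 2 < lam) :
    IsCompact (centralCantor lam) ∧ (centralCantor lam).Nonempty ∧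
      centralCantor lam = ifs lam false '' centralCantor lam ∪ ifs lam true '' centralCantor lam :=
  (centralCantor_eq_of_attractor hl _).2 rfl

theorem mem_Icc_of_mem_centralCantor {x : ℝ} (hx : x ∈ centralCantor lam) :
    x ∈ Set.Icc (0 : ℝ) 1 :=
  Set.mem_iInter.1 hx 0

theorem zero_mem_centralCantor : (0 : ℝ) ∈ centralCantor lam := by
  refine Set.mem_iInter.2 fun k => ?_
  induction k with
  | zero => exact ⟨le_rfl, zero_le_one⟩
  | succ k ih => exact Or.inl ⟨0, ih, by simp [ifs]⟩

theorem one_mem_centralCantor (hl : 2 < lam) : (1 : ℝ) ∈ centralCantor lam := by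
  simpa using centralCantor_flip (by linarith : lam ≠ 0) zero_mem_centralCantor

theorem exists_ifs (hl : 2 < lam) {x : ℝ} (hx : x ∈ centralCantor lam) :
    ∃ b, ∃ y ∈ centralCantor lam, x = ifs lam b y := by
  rw [(centralCantor_attractor hl).2.2] at hx
  rcases hx with ⟨y, hy, rfl⟩ | ⟨y, hy, rfl⟩
  exacts [⟨false, y, hy, rfl⟩, ⟨true, y, hy, rfl⟩]

theorem ifs_sub (b : Bool) (x y : ℝ) : ifs lam b x - ifs lam b y = (x - y) / lam := by
  cases b <;> simp only [ifs, cond_true, cond_false] <;> ring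

theorem ifs_lt_ifs (hl : 2 < lam) (b : Bool) {x y : ℝ} :
    ifs lam b x < ifs lam b y ↔ x < y := by
  rw [← sub_pos, ifs_sub, div_pos_iff_of_pos_right (by linarith), sub_pos]

theorem ifs_le_ifs (hl : 2 < lam) (b : Bool) {x y : ℝ} :
    ifs lam b x ≤ ifs lam b y ↔ x ≤ y := by
  rw [← not_lt, ifs_lt_ifs hl, not_lt]

theorem ifs_injective (hl : 2 < lam) (b : Bool) : Function.Injective (ifs lam b) := by
  intro x y h
  exact le_antisymm ((ifs_le_ifs hl b).1 h.le) ((ifs_le_ifs hl b).1 h.ge)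

theorem ifs_false_le (hl : 2 < lam) {x : ℝ} (hx : x ≤ 1) : ifs lam false x ≤ 1 / lam := by
  simp only [ifs, cond_false]
  have : 0 < lam := by linarith
  gcongr

theorem le_ifs_true (hl : 2 < lam) {x : ℝ} (hx : 0 ≤ x) : 1 - 1 / lam ≤ ifs lam true x := by
  have : 0 < lam := by linarith
  have h : ifs lam true x = x / lam + (1 - 1 / lam) := by
    simp only [ifs, cond_true]
    field_simp
  have := div_nonneg hx this.le
  linarith

theorem one_div_lt_half (hl : 2 < lam) : 0 < 1 / lam ∧ 1 / lam < 1 / 2 :=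
  ⟨by positivity, one_div_lt_one_div_of_lt (by norm_num) hl⟩

theorem ifs_disjoint (hl : 2 < lam) {x y : ℝ} (hx : x ∈ Set.Icc (0 : ℝ) 1)
    (hy : y ∈ Set.Icc (0 : ℝ) 1) {b c : Bool} (h : ifs lam b x = ifs lam c y) : b = c := by
  have := one_div_lt_half hl
  cases b <;> cases c <;> try rfl
  · have h1 := ifs_false_le hl hx.2
    have h2 := le_ifs_true hl hy.1
    linarith
  · have h1 := ifs_false_le hl hy.2
    have h2 := le_ifs_true hl hx.1
    linarith

theorem word_sub (w : List Bool) (x y : ℝ) :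
    word lam w x - word lam w y = (x - y) * (1 / lam) ^ w.length := by
  induction w with
  | nil => simp [word]
  | cons b w ih =>
    simp only [word, Function.comp_apply, ifs_sub, ih, List.length_cons, pow_succ]
    ring

theorem word_eq (w : List Bool) (x : ℝ) :
    word lam w x = word lam w 0 + x * (1 / lam) ^ w.length := by
  have := word_sub (lam := lam) w x 0
  rw [sub_zero] at this
  linarith

theorem word_injective (hl : 2 < lam) (w : List Bool) : Function.Injective (word lam w) := by
  intro x y h
  have h1 := word_sub (lam := lam) w x y
  rw [h, sub_self] at h1
  have : (1 / lam) ^ w.length ≠ 0 := by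
    have := one_div_lt_half hl
    exact pow_ne_zero _ this.1.ne'
  rcases mul_eq_zero.1 h1.symm with h | h
  · linarith
  · exact absurd h this

theorem word_mem_Icc (hl : 2 < lam) (w : List Bool) {x : ℝ} (hx : x ∈ Set.Icc (0 : ℝ) 1) :
    word lam w x ∈ Set.Icc (0 : ℝ) 1 := by
  induction w with
  | nil => exact hx
  | cons b w ih => exact ifs_mem_Icc (by linarith) b ih

/-- A point of `[0, 1]` in a standard interval which lies in the Cantor set comes from a point of
the Cantor set. -/
theorem mem_of_word_mem (hl : 2 < lam) (w : List Bool) {x : ℝ} (hx : x ∈ Set.Icc (0 : ℝ) 1)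
    (h : word lam w x ∈ centralCantor lam) : x ∈ centralCantor lam := by
  induction w with
  | nil => exact h
  | cons b w ih =>
    obtain ⟨c, y, hy, e⟩ := exists_ifs hl h
    have hbc := ifs_disjoint hl (word_mem_Icc hl w hx) (mem_Icc_of_mem_centralCantor hy) e
    subst hbc
    rw [← ifs_injective hl b e] at hy
    exact ih hy

theorem not_mem_gap (hl : 2 < lam) {x : ℝ} (hx : x ∈ centralCantor lam) :
    x ≤ 1 / lam ∨ 1 - 1 / lam ≤ x := by
  obtain ⟨b, y, hy, rfl⟩ := exists_ifs hl hx
  have := mem_Icc_of_mem_centralCantor hy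
  cases b
  · exact Or.inl (ifs_false_le hl this.2)
  · exact Or.inr (le_ifs_true hl this.1)

theorem exists_ifs_false (hl : 2 < lam) {x : ℝ} (hx : x ∈ centralCantor lam)
    (h : x < 1 - 1 / lam) : ∃ y ∈ centralCantor lam, x = ifs lam false y := by
  obtain ⟨b, y, hy, rfl⟩ := exists_ifs hl hx
  cases b
  · exact ⟨y, hy, rfl⟩
  · have := le_ifs_true hl (mem_Icc_of_mem_centralCantor hy).1
    linarith

theorem exists_ifs_true (hl : 2 < lam) {x : ℝ} (hx : x ∈ centralCantor lam)
    (h : 1 / lam < x) : ∃ y ∈ centralCantor lam, x = ifs lam true y := by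
  obtain ⟨b, y, hy, rfl⟩ := exists_ifs hl hx
  cases b
  · have := ifs_false_le hl (mem_Icc_of_mem_centralCantor hy).2
    linarith
  · exact ⟨y, hy, rfl⟩

/-- Two points of the Cantor set are separated by the central gap of a standard interval. -/
theorem exists_span (hl : 2 < lam) {a b : ℝ} (ha : a ∈ centralCantor lam)
    (hb : b ∈ centralCantor lam) (hab : a < b) :
    ∃ w, ∃ a' ∈ centralCantor lam, ∃ b' ∈ centralCantor lam, a = word lam w a' ∧
      b = word lam w b' ∧ a' ≤ 1 / lam ∧ 1 - 1 / lam ≤ b' := by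
  have h0 : 0 < lam := by linarith
  -- Zooming into a common half multiplies the distance by `lam`, so the two points share fewer than
  -- `N` digits.
  obtain ⟨N, hN⟩ := exists_pow_lt_of_lt_one (sub_pos.2 hab) (by
    rw [div_lt_one h0]; linarith : 1 / lam < 1)
  induction N generalizing a b with
  | zero =>
    have h1 := (mem_Icc_of_mem_centralCantor ha).1
    have h2 := (mem_Icc_of_mem_centralCantor hb).2
    rw [pow_zero] at hN
    linarith
  | succ N ih =>
    obtain ⟨c, y, hy, rfl⟩ := exists_ifs hl ha
    obtain ⟨d, z, hz, rfl⟩ := exists_ifs hl hb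
    have hy1 := mem_Icc_of_mem_centralCantor hy
    have hz1 := mem_Icc_of_mem_centralCantor hz
    have hlt := one_div_lt_half hl
    have same : ∀ e, ifs lam e y < ifs lam e z →
        (1 / lam) ^ (N + 1) < ifs lam e z - ifs lam e y →
        ∃ w, ∃ a' ∈ centralCantor lam, ∃ b' ∈ centralCantor lam, ifs lam e y = word lam w a' ∧
          ifs lam e z = word lam w b' ∧ a' ≤ 1 / lam ∧ 1 - 1 / lam ≤ b' := by
      intro e h1 h2
      rw [ifs_sub, pow_succ, mul_one_div, div_lt_div_iff_of_pos_right h0] at h2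
      obtain ⟨w, a', ha', b', hb', rfl, rfl, h3, h4⟩ := ih hy hz ((ifs_lt_ifs hl e).1 h1) h2
      exact ⟨e :: w, a', ha', b', hb', rfl, rfl, h3, h4⟩
    cases c <;> cases d
    · exact same false hab hN
    · exact ⟨[], _, ha, _, hb, rfl, rfl, ifs_false_le hl hy1.2, le_ifs_true hl hz1.1⟩
    · have h1 := ifs_false_le hl hz1.2
      have h2 := le_ifs_true hl hy1.1
      linarith
    · exact same true hab hN

/-- Zoom in on `x` at most `N` times. Either `x` falls into a central gap, and the ends of that gap
bracket it, or it is still in a standard interval of level `N`, whose ends serve. -/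
theorem exists_near (hl : 2 < lam) (N : ℕ) {x : ℝ} (hx : x ∈ Set.Icc (0 : ℝ) 1) :
    ∃ c ∈ centralCantor lam, ∃ d ∈ centralCantor lam, c ≤ x ∧ x ≤ d ∧
      d - c ≤ max (1 - 2 / lam) ((1 / lam) ^ N) := by
  have h0 : 0 < lam := by linarith
  have hlt := one_div_lt_half hl
  have h2 : 2 / lam = 2 * (1 / lam) := by ring
  induction N generalizing x with
  | zero =>
    exact ⟨0, zero_mem_centralCantor, 1, one_mem_centralCantor hl, hx.1, hx.2, by simp⟩
  | succ N ih =>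
    have step : ∀ b, ∀ y ∈ Set.Icc (0 : ℝ) 1, x = ifs lam b y →
        ∃ c ∈ centralCantor lam, ∃ d ∈ centralCantor lam, c ≤ x ∧ x ≤ d ∧
          d - c ≤ max (1 - 2 / lam) ((1 / lam) ^ (N + 1)) := by
      rintro b y hy rfl
      obtain ⟨c, hc, d, hd, h1, h2, h3⟩ := ih hy
      refine ⟨_, ifs_mem (by linarith) b hc, _, ifs_mem (by linarith) b hd,
        (ifs_le_ifs hl b).2 h1, (ifs_le_ifs hl b).2 h2, ?_⟩
      rw [ifs_sub]
      rcases le_max_iff.1 h3 with h | h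
      · refine le_max_of_le_left ?_
        rw [div_le_iff₀ h0]
        nlinarith
      · refine le_max_of_le_right ?_
        rw [pow_succ, mul_one_div]
        gcongr
    by_cases h1 : x ≤ 1 / lam
    · refine step false (x * lam) ⟨by have := hx.1; positivity, ?_⟩ ?_
      · rwa [le_div_iff₀ h0] at h1
      · simp [ifs, h0.ne']
    by_cases h3 : 1 - 1 / lam ≤ x
    · refine step true ((x - (1 - 1 / lam)) * lam) ⟨?_, ?_⟩ ?_
      · exact mul_nonneg (by linarith) h0.le
      · rw [← le_div_iff₀ h0]
        linarith [hx.2]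
      · simp only [ifs, cond_true]
        field_simp
        ring
    refine ⟨ifs lam false 1, ifs_mem (by linarith) _ (one_mem_centralCantor hl),
      ifs lam true 0, ifs_mem (by linarith) _ zero_mem_centralCantor, ?_, ?_, ?_⟩
    · simp only [ifs, cond_false]
      linarith
    · have : ifs lam true 0 = 1 - 1 / lam := by
        simp only [ifs, cond_true]
        field_simp
        ring
      linarith
    · refine le_max_of_le_left (le_of_eq ?_)
      simp only [ifs, cond_true, cond_false]
      field_simp
      ring

/-- No gap of the Cantor set is longer than the central one. -/
theorem exists_mem_Ioo (hl : 2 < lam) {s t : ℝ} (hs : 0 ≤ s) (ht : t ≤ 1)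
    (hst : 1 - 2 / lam < t - s) : ∃ x ∈ centralCantor lam, s < x ∧ x < t := by
  have h0 : 0 < lam := by linarith
  have hlt := one_div_lt_half hl
  have h2 : 2 / lam = 2 * (1 / lam) := by ring
  -- For this depth the maximum in `exists_near` is the central gap. If no Cantor point lay strictly
  -- between `s` and `t`, the points bracketing the midpoint would lie outside, too far apart.
  obtain ⟨N, hN⟩ := exists_pow_lt_of_lt_one (by linarith : 0 < 1 - 2 / lam)
    (by linarith : 1 / lam < 1)
  obtain ⟨c, hc, d, hd, h1, h2, h3⟩ := exists_near hl N (x := (s + t) / 2)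
    ⟨by linarith, by linarith⟩
  rw [max_eq_left hN.le] at h3
  by_contra! h
  have hc' : c ≤ s := by
    by_contra hcs
    have := h c hc (not_le.1 hcs)
    linarith
  have hd' : t ≤ d := h d hd (by linarith)
  linarith

/-- Points of the Cantor set near a standard interval lie in it. -/
theorem mem_image_word_of_near (hl : 2 < lam) (w : List Bool) {x η : ℝ}
    (hx : x ∈ centralCantor lam) (h1 : word lam w 0 - η ≤ x) (h2 : x ≤ word lam w 1 + η)
    (hη : η < (1 - 2 / lam) * (1 / lam) ^ w.length) : ∃ y ∈ centralCantor lam, x = word lam w y := by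
  have h0 : 0 < lam := by linarith
  have hlt := one_div_lt_half hl
  have e2 : 2 / lam = 2 * (1 / lam) := by ring
  induction w generalizing x η with
  | nil => exact ⟨x, hx, rfl⟩
  | cons b w ih =>
    obtain ⟨c, y, hy, rfl⟩ := exists_ifs hl hx
    have hpow : (1 / lam) ^ w.length ≤ 1 := pow_le_one₀ hlt.1.le (by linarith)
    have hg : 0 < 1 - 2 / lam := by linarith
    have hη' : η * lam < (1 - 2 / lam) * (1 / lam) ^ w.length := by
      rw [List.length_cons, pow_succ, ← mul_assoc, mul_one_div, lt_div_iff₀ h0] at hη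
      exact hη
    have hη1 : η < 1 - 2 / lam := by
      have h3 : (1 / lam) ^ (b :: w).length ≤ 1 := pow_le_one₀ hlt.1.le (by linarith)
      nlinarith
    have hw0 := word_mem_Icc hl w (x := 0) ⟨le_rfl, zero_le_one⟩
    have hw1 := word_mem_Icc hl w (x := 1) ⟨zero_le_one, le_rfl⟩
    have hy1 := mem_Icc_of_mem_centralCantor hy
    -- The first digit of the point agrees with that of the word, since `η` is less than the central
    -- gap.
    have hbc : b = c := by
      simp only [word, Function.comp_apply] at h1 h2
      cases b <;> cases c <;> try rfl
      · have h3 := ifs_false_le hl hw1.2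
        have h4 := le_ifs_true hl hy1.1
        linarith
      · have h3 := le_ifs_true hl hw0.1
        have h4 := ifs_false_le hl hy1.2
        linarith
    subst hbc
    simp only [word, Function.comp_apply] at h1 h2
    obtain ⟨z, hz, rfl⟩ := ih hy (η := η * lam) (by
        have : word lam w 0 - y ≤ η * lam := by
          rw [← div_le_iff₀ h0, ← ifs_sub b]
          linarith
        linarith) (by
        have : y - word lam w 1 ≤ η * lam := by
          rw [← div_le_iff₀ h0, ← ifs_sub b]
          linarith
        linarith) hη'
    exact ⟨z, hz, rfl⟩

end Cantor

/-! ### Almost affine maps from the dust to the Cantor set -/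

section Rigidity

variable {n : ℕ} {lam : ℝ}

theorem single_mem_dust {j : Fin n} {s : ℝ} (hs : s ∈ centralCantor lam) :
    Pi.single j s ∈ dust n lam := by
  intro i _
  by_cases h : i = j
  · subst h
    simpa using hs
  · simpa [Pi.single_eq_of_ne h] using zero_mem_centralCantor

theorem zero_mem_dust : (0 : Fin n → ℝ) ∈ dust n lam := fun _ _ => zero_mem_centralCantor

/-- Were the gap `(c, d)` longer, its part at distance more than `δ` from the ends would pull back
under the slope `ℓ` to an interval longer than `1 - 2 / lam`. By `exists_mem_Ioo` this contains a
Cantor point, which `p` would send into the gap. -/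
theorem gap_le_of_cross (hl : 2 < lam) {p : ℝ → ℝ} {ℓ δ c d : ℝ}
    (hp : ∀ s ∈ centralCantor lam, p s ∈ centralCantor lam)
    (hδ : ∀ s ∈ centralCantor lam, ∀ s' ∈ centralCantor lam, |p s - p s' - ℓ * (s - s')| ≤ δ)
    (hℓ : 0 < ℓ) (hcd : ∀ x ∈ centralCantor lam, x ≤ c ∨ d ≤ x) (h0 : p 0 ≤ c) (h1 : d ≤ p 1) :
    d - c ≤ (1 - 2 / lam) * ℓ + 2 * δ := by
  have z := zero_mem_centralCantor (lam := lam)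
  have o := one_mem_centralCantor hl
  have hδ0 : 0 ≤ δ := (abs_nonneg _).trans (hδ 0 z 0 z)
  by_contra! hc
  have h10 := abs_le.1 (hδ 1 o 0 z)
  obtain ⟨x, hx, hx1, hx2⟩ := exists_mem_Ioo hl (s := (c + δ - p 0) / ℓ) (t := (d - δ - p 0) / ℓ)
    (by apply div_nonneg _ hℓ.le; linarith) (by rw [div_le_one hℓ]; linarith [h10.1, h10.2])
    (by rw [← sub_div, lt_div_iff₀ hℓ]; linarith)
  rw [div_lt_iff₀ hℓ] at hx1
  rw [lt_div_iff₀ hℓ] at hx2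
  have hx0 := abs_le.1 (hδ x hx 0 z)
  rcases hcd _ (hp x hx) with h | h <;> nlinarith [hx0.1, hx0.2]

theorem gap_of_word (hl : 2 < lam) (w : List Bool) {x : ℝ} (hx : x ∈ centralCantor lam) :
    x ≤ word lam w (1 / lam) ∨ word lam w (1 - 1 / lam) ≤ x := by
  induction w generalizing x with
  | nil => exact not_mem_gap hl hx
  | cons b w ih =>
    have hlt := one_div_lt_half hl
    obtain ⟨c, y, hy, rfl⟩ := exists_ifs hl hx
    have hy1 := mem_Icc_of_mem_centralCantor hy
    have hw0 := word_mem_Icc hl w (x := 1 / lam) ⟨by linarith, by linarith⟩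
    have hw1 := word_mem_Icc hl w (x := 1 - 1 / lam) ⟨by linarith, by linarith⟩
    simp only [word, Function.comp_apply]
    cases b <;> cases c
    · simpa only [ifs_le_ifs hl] using ih hy
    · have h1 := ifs_false_le hl hw1.2
      have h2 := le_ifs_true hl hy1.1
      exact Or.inr (by linarith)
    · have h1 := ifs_false_le hl hy1.2
      have h2 := le_ifs_true hl hw0.1
      exact Or.inl (by linarith)
    · simpa only [ifs_le_ifs hl] using ih hy

theorem word_mono (hl : 2 < lam) (w : List Bool) {x y : ℝ} (h : x ≤ y) :
    word lam w x ≤ word lam w y := by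
  rw [← sub_nonneg, word_sub]
  have := one_div_lt_half hl
  have := sub_nonneg.2 h
  positivity

theorem word_one_sub_word_zero (w : List Bool) :
    word lam w 1 - word lam w 0 = (1 / lam) ^ w.length := by
  rw [word_sub]
  ring

theorem word_gap_length (w : List Bool) :
    word lam w (1 - 1 / lam) - word lam w (1 / lam) = (1 - 2 / lam) * (1 / lam) ^ w.length := by
  rw [word_sub]
  ring

/-- The interval of `w` is the smallest standard interval containing both points. Its length is
therefore at least `b - a`, which bounds its central gap from below. -/
theorem exists_gap (hl : 2 < lam) {a b : ℝ} (ha : a ∈ centralCantor lam)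
    (hb : b ∈ centralCantor lam) (hab : a < b) :
    ∃ w, (∀ x ∈ centralCantor lam, x ≤ word lam w (1 / lam) ∨ word lam w (1 - 1 / lam) ≤ x) ∧
      word lam w 0 ≤ a ∧ a ≤ word lam w (1 / lam) ∧ word lam w (1 - 1 / lam) ≤ b ∧
      b ≤ word lam w 1 := by
  obtain ⟨w, a', ha', b', hb', rfl, rfl, h1, h2⟩ := exists_span hl ha hb hab
  exact ⟨w, fun x hx => gap_of_word hl w hx, word_mono hl w (mem_Icc_of_mem_centralCantor ha').1,
    word_mono hl w h1, word_mono hl w h2, word_mono hl w (mem_Icc_of_mem_centralCantor hb').2⟩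

theorem sum_single_sub (v : Fin n → ℝ) (j k : Fin n) (s t s' t' : ℝ) :
    ∑ i, v i * ((Pi.single j s + Pi.single k t : Fin n → ℝ) i -
      (Pi.single j s' + Pi.single k t' : Fin n → ℝ) i) = v j * (s - s') + v k * (t - t') := by
  simp only [Pi.add_apply, Pi.single_apply, mul_sub, mul_add, Finset.sum_sub_distrib,
    Finset.sum_add_distrib, mul_ite, mul_zero, Finset.sum_ite_eq', Finset.mem_univ, if_true]
  ring

theorem add_single_mem_dust {j k : Fin n} (hjk : j ≠ k) {s t : ℝ} (hs : s ∈ centralCantor lam)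
    (ht : t ∈ centralCantor lam) : (Pi.single j s + Pi.single k t : Fin n → ℝ) ∈ dust n lam := by
  intro i _
  by_cases h : i = j
  · subst h
    simpa [Pi.single_eq_of_ne hjk] using hs
  · simpa [Pi.single_eq_of_ne h] using single_mem_dust ht i trivial

/-- Look at the square spanned by the axes `j` and `k`. The values at opposite corners differ by
about `v j + v k`, so they are separated by a gap of at least about `1 - 2 / lam` times this. Unless
the two other corners contradict `v k ≤ v j` up to `δ`, some edge in direction `j` crosses that gap,
and `gap_le_of_cross` allows it only the length `(1 - 2 / lam) * v j + 2 * δ`. Comparison bounds `v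
k`. -/
theorem small_of_two_nonneg (hl : 2 < lam) {f : (Fin n → ℝ) → ℝ} {v : Fin n → ℝ} {δ : ℝ}
    (hf : ∀ z ∈ dust n lam, f z ∈ centralCantor lam)
    (hδ : ∀ z ∈ dust n lam, ∀ z' ∈ dust n lam, |f z - f z' - ∑ i, v i * (z i - z' i)| ≤ δ)
    {j k : Fin n} (hjk : j ≠ k) (hk : 0 < v k) (hkj : v k ≤ v j) :
    (1 - 2 / lam) * (v k - δ) ≤ 2 * δ := by
  have hlt := one_div_lt_half hl
  have e2 : 2 / lam = 2 * (1 / lam) := by ring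
  have hg : 0 < 1 - 2 / lam := by linarith
  have z := zero_mem_centralCantor (lam := lam)
  have o := one_mem_centralCantor hl
  set F : ℝ → ℝ → ℝ := fun s t => f (Pi.single j s + Pi.single k t) with hF
  have hFm : ∀ s ∈ centralCantor lam, ∀ t ∈ centralCantor lam, F s t ∈ centralCantor lam :=
    fun s hs t ht => hf _ (add_single_mem_dust hjk hs ht)
  have hFδ : ∀ s ∈ centralCantor lam, ∀ t ∈ centralCantor lam, ∀ s' ∈ centralCantor lam,
      ∀ t' ∈ centralCantor lam,
      |F s t - F s' t' - (v j * (s - s') + v k * (t - t'))| ≤ δ := by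
    intro s hs t ht s' hs' t' ht'
    have := hδ _ (add_single_mem_dust hjk hs ht) _ (add_single_mem_dust hjk hs' ht')
    rwa [sum_single_sub] at this
  have hδ0 : 0 ≤ δ := (abs_nonneg _).trans (hFδ 0 z 0 z 0 z 0 z)
  have e1 := abs_le.1 (hFδ 1 o 1 o 0 z 0 z)
  by_cases hab : F 0 0 < F 1 1
  · obtain ⟨w, hw, h1, h2, h3, h4⟩ := exists_gap hl (hFm 0 z 0 z) (hFm 1 o 1 o) hab
    have h5 := word_gap_length (lam := lam) w
    have h6 := word_one_sub_word_zero (lam := lam) w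
    set c := word lam w (1 / lam)
    set d := word lam w (1 - 1 / lam)
    have h7 : (1 - 2 / lam) * (v j + v k - δ) ≤ d - c := by
      rw [h5, ← h6]
      exact mul_le_mul_of_nonneg_left (by linarith [e1.1]) hg.le
    rcases hw _ (hFm 1 o 0 z) with hc | hd
    · have e3 := abs_le.1 (hFδ 0 z 1 o 1 o 0 z)
      rcases hw _ (hFm 0 z 1 o) with hc' | hd'
      · have := gap_le_of_cross hl (p := fun s => F s 1) (ℓ := v j) (δ := δ)
          (fun s hs => hFm s hs 1 o)
          (fun s hs s' hs' => by simpa using hFδ s hs 1 o s' hs' 1 o)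
          (by linarith) hw hc' h3
        nlinarith
      -- From `F 1 0` to `F 0 1` the value rises across the gap, although `v k ≤ v j` permits a rise
      -- of at most `δ`.
      · nlinarith [e3.1, e3.2]
    · have := gap_le_of_cross hl (p := fun s => F s 0) (ℓ := v j) (δ := δ)
        (fun s hs => hFm s hs 0 z)
        (fun s hs s' hs' => by simpa using hFδ s hs 0 z s' hs' 0 z)
        (by linarith) hw h2 hd
      nlinarith
  · nlinarith [e1.1, e1.2]

/-- Reflecting the coordinates of negative slope preserves the dust and makes all slopes
nonnegative; exchanging `j` and `k` orders them. -/
theorem small_of_two (hl : 2 < lam) {f : (Fin n → ℝ) → ℝ} {v : Fin n → ℝ} {δ μ : ℝ}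
    (hf : ∀ z ∈ dust n lam, f z ∈ centralCantor lam)
    (hδ : ∀ z ∈ dust n lam, ∀ z' ∈ dust n lam, |f z - f z' - ∑ i, v i * (z i - z' i)| ≤ δ)
    {j k : Fin n} (hjk : j ≠ k) (hμ : 0 < μ) (hj : μ ≤ |v j|) (hk : μ ≤ |v k|) :
    (1 - 2 / lam) * (μ - δ) ≤ 2 * δ := by
  have hlt := one_div_lt_half hl
  have e2 : 2 / lam = 2 * (1 / lam) := by ring
  have hg : 0 < 1 - 2 / lam := by linarith
  set r : (Fin n → ℝ) → Fin n → ℝ := fun z i => if v i < 0 then 1 - z i else z i with hr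
  have hrm : ∀ z ∈ dust n lam, r z ∈ dust n lam := by
    intro z hz i _
    by_cases h : v i < 0
    · simp only [hr, h, if_true]
      exact centralCantor_flip (by linarith) (hz i trivial)
    · simp only [hr, h, if_false]
      exact hz i trivial
  have hδ' : ∀ z ∈ dust n lam, ∀ z' ∈ dust n lam,
      |f (r z) - f (r z') - ∑ i, |v i| * (z i - z' i)| ≤ δ := by
    intro z hz z' hz'
    convert hδ _ (hrm z hz) _ (hrm z' hz') using 4 with i
    by_cases h : v i < 0
    · simp only [hr, h, if_true, abs_of_neg h]
      ring
    · simp only [hr, h, if_false, abs_of_nonneg (not_lt.1 h)]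
  have key : ∀ j k : Fin n, j ≠ k → 0 < |v k| → |v k| ≤ |v j| →
      (1 - 2 / lam) * (|v k| - δ) ≤ 2 * δ := fun j k hjk h1 h2 =>
    small_of_two_nonneg hl (f := fun z => f (r z)) (v := fun i => |v i|)
      (fun z hz => hf _ (hrm z hz)) hδ' hjk h1 h2
  rcases le_total |v k| |v j| with h | h
  · have := key j k hjk (by linarith) h
    nlinarith
  · have := key k j hjk.symm (by linarith) h
    nlinarith

/-- The word spans the values at the two ends of the `j`-th axis. Every other value is within `δ` of
the segment between them, and `δ` is less than the gaps around that standard interval. Its central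
gap is crossed along the axis, which bounds its length from above. -/
theorem image_subset_word (hl : 2 < lam) {f : (Fin n → ℝ) → ℝ} {j : Fin n} {c δ : ℝ}
    (hf : ∀ z ∈ dust n lam, f z ∈ centralCantor lam)
    (hδ : ∀ z ∈ dust n lam, ∀ z' ∈ dust n lam, |f z - f z' - c * (z j - z' j)| ≤ δ)
    (hc : 0 < c) (hcδ : δ < (1 - 2 / lam) * (c - δ)) :
    ∃ w, (∀ z ∈ dust n lam, ∃ y ∈ centralCantor lam, f z = word lam w y) ∧
      c - δ ≤ (1 / lam) ^ w.length ∧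
      (1 - 2 / lam) * (1 / lam) ^ w.length ≤ (1 - 2 / lam) * c + 2 * δ := by
  have hlt := one_div_lt_half hl
  have e2 : 2 / lam = 2 * (1 / lam) := by ring
  have hg : 0 < 1 - 2 / lam := by linarith
  have z := zero_mem_centralCantor (lam := lam)
  have o := one_mem_centralCantor hl
  have hδ0 : 0 ≤ δ := (abs_nonneg _).trans (hδ 0 zero_mem_dust 0 zero_mem_dust)
  have hm : ∀ s ∈ centralCantor lam, f (Pi.single j s) ∈ centralCantor lam :=
    fun s hs => hf _ (single_mem_dust hs)
  have hs1 : ∀ z ∈ dust n lam, |f z - f (Pi.single j 0) - c * z j| ≤ δ := by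
    intro z' hz
    simpa using hδ z' hz _ (single_mem_dust (j := j) z)
  have hs2 : ∀ z ∈ dust n lam, |f (Pi.single j 1) - f z - c * (1 - z j)| ≤ δ := by
    intro z' hz
    simpa using hδ _ (single_mem_dust (j := j) o) z' hz
  have e1 := abs_le.1 (hs1 _ (single_mem_dust (j := j) o))
  rw [Pi.single_eq_same] at e1
  obtain ⟨w, hw, h1, h2, h3, h4⟩ := exists_gap hl (hm 0 z) (hm 1 o) (by nlinarith [e1.1])
  have h5 := word_gap_length (lam := lam) w
  have h6 := word_one_sub_word_zero (lam := lam) w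
  have h7 : c - δ ≤ (1 / lam) ^ w.length := by linarith [e1.1]
  have h8 := gap_le_of_cross hl (p := fun s => f (Pi.single j s)) (ℓ := c) (δ := δ) hm
    (fun s hs s' hs' => by
      simpa using hδ _ (single_mem_dust (j := j) hs) _ (single_mem_dust (j := j) hs')) hc hw h2 h3
  refine ⟨w, fun x hx => ?_, h7, by rwa [← h5]⟩
  have hxj := mem_Icc_of_mem_centralCantor (hx j trivial)
  have a1 := abs_le.1 (hs1 x hx)
  have a2 := abs_le.1 (hs2 x hx)
  refine mem_image_word_of_near hl w (hf x hx) (η := δ) ?_ ?_ ?_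
  · nlinarith [a1.1, mul_nonneg hc.le hxj.1]
  · nlinarith [a2.1, mul_nonneg hc.le (sub_nonneg.2 hxj.2)]
  · refine hcδ.trans_le ?_
    gcongr

theorem norm_sub_le_one {z z' : Fin n → ℝ} (hz : z ∈ dust n lam) (hz' : z' ∈ dust n lam) :
    ‖z - z'‖ ≤ 1 := by
  refine (pi_norm_le_iff_of_nonneg zero_le_one).2 fun i => ?_
  have h1 := mem_Icc_of_mem_centralCantor (hz i trivial)
  have h2 := mem_Icc_of_mem_centralCantor (hz' i trivial)
  rw [Pi.sub_apply, Real.norm_eq_abs, abs_le]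
  constructor <;> linarith [h1.1, h1.2, h2.1, h2.2]

/-- A map from the dust to the Cantor set close to a coordinate is this coordinate. -/
theorem eq_coord_of_near (hl : 2 < lam) {f : (Fin n → ℝ) → ℝ} {j : Fin n} {c δ : ℝ}
    (hf : ∀ z ∈ dust n lam, f z ∈ centralCantor lam)
    (hδ : ∀ z ∈ dust n lam, ∀ z' ∈ dust n lam, |f z - f z' - c * (z j - z' j)| ≤ δ * ‖z - z'‖)
    (hδ0 : 0 ≤ δ) (hc : |c - 1| ≤ (1 - 2 / lam) / 5) (hδ1 : δ ≤ (1 - 2 / lam) / 5)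
    {z : Fin n → ℝ} (hz : z ∈ dust n lam) : f z = z j := by
  have h0 : 0 < lam := by linarith
  have hlt := one_div_lt_half hl
  have e2 : 2 / lam = 2 * (1 / lam) := by ring
  have hg : 0 < 1 - 2 / lam := by linarith
  -- The induction ranges over all `f`: an error proportional to the distance makes the hypotheses
  -- invariant, with the same `c` and `δ`, under zooming by one digit in every coordinate.
  have key : ∀ N : ℕ, ∀ f : (Fin n → ℝ) → ℝ, (∀ z ∈ dust n lam, f z ∈ centralCantor lam) →
      (∀ z ∈ dust n lam, ∀ z' ∈ dust n lam, |f z - f z' - c * (z j - z' j)| ≤ δ * ‖z - z'‖) →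
      ∀ z ∈ dust n lam, |f z - z j| ≤ (1 / lam) ^ N := by
    intro N
    induction N with
    | zero =>
      intro f hf _ z hz
      have h1 := mem_Icc_of_mem_centralCantor (hf z hz)
      have h2 := mem_Icc_of_mem_centralCantor (hz j trivial)
      rw [pow_zero, abs_le]
      constructor <;> linarith [h1.1, h1.2, h2.1, h2.2]
    | succ N ih =>
      intro f hf hδ z hz
      have hδ' : ∀ z ∈ dust n lam, ∀ z' ∈ dust n lam, |f z - f z' - c * (z j - z' j)| ≤ δ :=
        fun z hz z' hz' => (hδ z hz z' hz').trans
          (mul_le_of_le_one_right hδ0 (norm_sub_le_one hz hz'))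
      choose b y hy hby using fun i => exists_ifs hl (hz i trivial)
      have hB : ∀ x ∈ dust n lam, (fun i => ifs lam (b i) (x i)) ∈ dust n lam :=
        fun x hx i _ => ifs_mem (by linarith) _ (hx i trivial)
      have hc' := abs_le.1 hc
      -- The first digit is preserved: the slope error and two errors `δ` total at most three fifths
      -- of the central gap.
      have hfb : ∀ x ∈ dust n lam, ∃ t ∈ centralCantor lam,
          f (fun i => ifs lam (b i) (x i)) = ifs lam (b j) t := by
        intro x hx
        have hfx := hf _ (hB x hx)
        have hxj := mem_Icc_of_mem_centralCantor (hx j trivial)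
        have a1 := abs_le.1 (hδ' _ (hB x hx) 0 zero_mem_dust)
        have a2 := abs_le.1 (hδ' _ (single_mem_dust (j := j) (one_mem_centralCantor hl)) _
          (zero_mem_dust))
        have f0 := mem_Icc_of_mem_centralCantor (hf 0 zero_mem_dust)
        have f1 := mem_Icc_of_mem_centralCantor
          (hf _ (single_mem_dust (j := j) (one_mem_centralCantor hl)))
        simp only [Pi.zero_apply, sub_zero, Pi.single_eq_same, mul_one] at a1 a2
        cases hb : b j
        · refine exists_ifs_false hl hfx ?_
          rw [hb] at a1
          have h1 := ifs_false_le hl hxj.2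
          have h2 := (ifs_mem_Icc (by linarith : 1 ≤ lam) false hxj).1
          nlinarith [a1.2, a2.1, f1.2, mul_le_mul_of_nonneg_right hc'.2 h2]
        · refine exists_ifs_true hl hfx ?_
          rw [hb] at a1
          have h1 := le_ifs_true hl hxj.1
          have h2 := (ifs_mem_Icc (by linarith : 1 ≤ lam) true hxj)
          nlinarith [a1.1, f0.1, mul_le_mul_of_nonneg_right hc'.1 h2.1]
      set g : (Fin n → ℝ) → ℝ := fun x =>
        (f (fun i => ifs lam (b i) (x i)) - ifs lam (b j) 0) * lam with hgdef
      have hgt : ∀ x t, f (fun i => ifs lam (b i) (x i)) = ifs lam (b j) t → g x = t := by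
        intro x t h
        simp only [hgdef, h, ifs_sub]
        field_simp
        ring
      have hfg : ∀ x, f (fun i => ifs lam (b i) (x i)) = ifs lam (b j) (g x) := by
        intro x
        have := ifs_sub (lam := lam) (b j) (g x) 0
        have e : (g x - 0) / lam = f (fun i => ifs lam (b i) (x i)) - ifs lam (b j) 0 := by
          simp only [hgdef]
          field_simp
          ring
        linarith
      have hzy : z = fun i => ifs lam (b i) (y i) := funext hby
      have := ih g (fun x hx => by
          obtain ⟨t, ht, h⟩ := hfb x hx
          rwa [hgt x t h]) (fun x hx x' hx' => by
          have := hδ _ (hB x hx) _ (hB x' hx')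
          rw [hfg, hfg, ifs_sub, ifs_sub] at this
          have e : (fun i => ifs lam (b i) (x i)) - (fun i => ifs lam (b i) (x' i)) =
              (1 / lam) • (x - x') := by
            funext i
            simp only [Pi.sub_apply, ifs_sub, Pi.smul_apply, smul_eq_mul]
            ring
          rw [e, norm_smul, Real.norm_eq_abs, abs_of_pos hlt.1] at this
          have e' : (g x - g x') / lam - c * ((x j - x' j) / lam) =
              (g x - g x' - c * (x j - x' j)) * (1 / lam) := by ring
          rw [e', abs_mul, abs_of_pos hlt.1, mul_left_comm, mul_comm] at this
          exact le_of_mul_le_mul_left this hlt.1) y (fun i _ => hy i)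
      rw [hzy, hfg, ifs_sub, abs_div, abs_of_pos h0, pow_succ, mul_one_div]
      gcongr
  by_contra hne
  obtain ⟨N, hN⟩ := exists_pow_lt_of_lt_one (abs_pos.2 (sub_ne_zero.2 hne))
    (by linarith : 1 / lam < 1)
  exact absurd (key N f hf hδ z hz) (not_le.2 hN)

/-- Rescale the standard interval containing the image to `[0, 1]` and apply `eq_coord_of_near`. The
upper bound on its length `ℓ` comes from its gap, so the error is divided by `1 - 2 / lam`; the
square in the hypothesis still leaves `c / ℓ` close enough to one. -/
theorem eq_word_of_near_pos (hl : 2 < lam) {f : (Fin n → ℝ) → ℝ} {j : Fin n} {c δ : ℝ}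
    (hf : ∀ z ∈ dust n lam, f z ∈ centralCantor lam)
    (hδ : ∀ z ∈ dust n lam, ∀ z' ∈ dust n lam, |f z - f z' - c * (z j - z' j)| ≤ δ * ‖z - z'‖)
    (hδ0 : 0 ≤ δ) (hc : 0 < c) (hcδ : δ ≤ (1 - 2 / lam) ^ 2 / 20 * c) :
    ∃ w, ∀ z ∈ dust n lam, f z = word lam w (z j) := by
  have h0 : 0 < lam := by linarith
  have hlt := one_div_lt_half hl
  have e2 : 2 / lam = 2 * (1 / lam) := by ring
  set g := 1 - 2 / lam with hgdef
  have hg : 0 < g := by linarith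
  have hg1 : g < 1 := by linarith
  have hg2 : g ^ 2 ≤ g := by nlinarith
  have hcδ' : δ ≤ c / 20 := by
    have : g ^ 2 / 20 * c ≤ 1 / 20 * c := by gcongr; linarith
    linarith
  have hcδ2 : δ ≤ g * c / 20 := by
    have : g ^ 2 / 20 * c ≤ g / 20 * c := by gcongr
    linarith
  obtain ⟨w, hw, h1, h2⟩ := image_subset_word hl hf (fun z hz z' hz' => (hδ z hz z' hz').trans
    (mul_le_of_le_one_right hδ0 (norm_sub_le_one hz hz'))) hc (by
      rw [← hgdef]
      nlinarith)
  rw [← hgdef] at h2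
  set ℓ := (1 / lam) ^ w.length with hℓ
  have hℓ0 : 0 < ℓ := pow_pos hlt.1 _
  refine ⟨w, fun z hz => ?_⟩
  have hfw : ∀ z ∈ dust n lam, ((f z - word lam w 0) / ℓ) ∈ centralCantor lam ∧
      f z = word lam w ((f z - word lam w 0) / ℓ) := by
    intro z hz
    obtain ⟨y, hy, e⟩ := hw z hz
    have : (f z - word lam w 0) / ℓ = y := by
      rw [e, word_sub, ← hℓ, sub_zero, mul_div_cancel_right₀ _ hℓ0.ne']
    rw [this]
    exact ⟨hy, e⟩
  rw [(hfw z hz).2]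
  congr 1
  refine eq_coord_of_near hl (f := fun z => (f z - word lam w 0) / ℓ) (c := c / ℓ) (δ := δ / ℓ)
    (fun z hz => (hfw z hz).1) (fun z hz z' hz' => ?_) (by positivity) ?_ ?_ hz
  · have e : (f z - word lam w 0) / ℓ - (f z' - word lam w 0) / ℓ - c / ℓ * (z j - z' j) =
        (f z - f z' - c * (z j - z' j)) / ℓ := by ring
    rw [e, abs_div, abs_of_pos hℓ0, div_mul_eq_mul_div]
    gcongr
    exact hδ z hz z' hz'
  · rw [← hgdef]
    have e : c / ℓ - 1 = (c - ℓ) / ℓ := by field_simp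
    rw [e, abs_div, abs_of_pos hℓ0, div_le_iff₀ hℓ0, abs_le]
    have h3 : g * (ℓ - c) ≤ g * (g * c / 10) := by nlinarith
    have h4 := le_of_mul_le_mul_left h3 hg
    constructor
    · nlinarith
    · nlinarith
  · rw [← hgdef, div_le_iff₀ hℓ0]
    nlinarith

theorem eq_word_of_near (hl : 2 < lam) {f : (Fin n → ℝ) → ℝ} {j : Fin n} {c δ : ℝ}
    (hf : ∀ z ∈ dust n lam, f z ∈ centralCantor lam)
    (hδ : ∀ z ∈ dust n lam, ∀ z' ∈ dust n lam, |f z - f z' - c * (z j - z' j)| ≤ δ * ‖z - z'‖)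
    (hδ0 : 0 ≤ δ) (hc : c ≠ 0) (hcδ : δ ≤ (1 - 2 / lam) ^ 2 / 20 * |c|) :
    ∃ w, ∀ z ∈ dust n lam, f z = word lam w (if c < 0 then 1 - z j else z j) := by
  by_cases h : c < 0
  · have hflip : ∀ z ∈ dust n lam, 1 - z ∈ dust n lam :=
      fun z hz i _ => centralCantor_flip (by linarith) (hz i trivial)
    rw [abs_of_neg h] at hcδ
    obtain ⟨w, hw⟩ := eq_word_of_near_pos hl (f := fun z => f (1 - z)) (c := -c) (j := j)
      (fun z hz => hf _ (hflip z hz)) (fun z hz z' hz' => by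
        have := hδ _ (hflip z hz) _ (hflip z' hz')
        rw [sub_sub_sub_cancel_left, ← norm_neg, neg_sub] at this
        convert this using 3
        simp only [Pi.sub_apply, Pi.one_apply]
        ring) hδ0 (by linarith) hcδ
    refine ⟨w, fun z hz => ?_⟩
    have := hw _ (hflip z hz)
    rw [sub_sub_cancel] at this
    simpa [h] using this
  · rw [abs_of_nonneg (not_lt.1 h)] at hcδ
    obtain ⟨w, hw⟩ := eq_word_of_near_pos hl hf hδ hδ0 (lt_of_le_of_ne (not_lt.1 h) hc.symm) hcδ
    exact ⟨w, fun z hz => by simpa [h] using hw z hz⟩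

end Rigidity

/-! ### Local structure of diffeomorphisms preserving the dust -/

section Local

variable {n : ℕ} {lam : ℝ}

theorem exists_pos_le_of_ne_zero {ι : Type*} [Finite ι] (a : ι → ℝ) :
    ∃ μ > 0, ∀ i, a i ≠ 0 → μ ≤ |a i| := by
  rcases isEmpty_or_nonempty ι with h | h
  · exact ⟨1, one_pos, fun i => h.elim i⟩
  -- Zero entries are replaced by the value one, which keeps the minimum positive.
  obtain ⟨i₀, hi₀⟩ := Finite.exists_min fun i => if a i = 0 then (1 : ℝ) else |a i|
  refine ⟨_, ?_, fun i hi => (hi₀ i).trans_eq (if_neg hi)⟩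
  split_ifs with h0
  exacts [one_pos, abs_pos.2 h0]

theorem sum_mul_of_single {ι R : Type*} [Fintype ι] [DecidableEq ι] [NonUnitalNonAssocSemiring R]
    {f : ι → R} {k : ι} (h : ∀ k', k' ≠ k → f k' = 0) (x : ι → R) :
    ∑ k', f k' * x k' = f k * x k :=
  Finset.sum_eq_single k (fun k' _ hk' => by rw [h k' hk', zero_mul]) (by simp)

/-- The signs of a matrix of positive determinant with one nonzero entry in each row form an
orthogonal matrix of determinant one. -/
theorem sign_mem_specialOrthogonalGroup {a : Matrix (Fin n) (Fin n) ℝ} (ha : 0 < a.det)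
    {π : Fin n → Fin n} (h : ∀ i k, k ≠ π i → a i k = 0) :
    (Matrix.of fun i k => ((SignType.sign (a i k) : SignType) : ℤ)) ∈
      Matrix.specialOrthogonalGroup (Fin n) ℤ := by
  set S : Matrix (Fin n) (Fin n) ℤ := Matrix.of fun i k => ((SignType.sign (a i k) : SignType) : ℤ)
    with hS
  have hS0 : ∀ i k, k ≠ π i → S i k = 0 := fun i k hk => by simp [hS, h i k hk]
  have hne : ∀ i, a i (π i) ≠ 0 := by
    intro i hi
    refine ha.ne' (Matrix.det_eq_zero_of_row_eq_zero i fun k => ?_)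
    by_cases hk : k = π i
    · rw [hk, hi]
    · exact h i k hk
  have hsurj : Function.Surjective π := by
    intro k
    by_contra! hk
    exact ha.ne' (Matrix.det_eq_zero_of_column_eq_zero k fun i => h i k (hk i).symm)
  have hinj : Function.Injective π := Finite.injective_iff_surjective.2 hsurj
  -- The diagonal factor has nonnegative determinant, so the sign matrix has positive determinant;
  -- orthogonality then forces the value one.
  have hfac : a = Matrix.diagonal (fun i => |a i (π i)|) * S.map (fun x => (x : ℝ)) := by
    ext i k
    rw [Matrix.diagonal_mul, Matrix.map_apply]
    by_cases hk : k = π i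
    · subst hk
      have : ((S i (π i) : ℤ) : ℝ) = (SignType.sign (a i (π i)) : ℝ) := by
        rcases lt_trichotomy (a i (π i)) 0 with h | h | h <;> simp [hS, h]
      rw [this, abs_mul_sign]
    · rw [hS0 i k hk, h i k hk, Int.cast_zero, mul_zero]
  have hdet : 0 < S.det := by
    rw [hfac, Matrix.det_mul, Matrix.det_diagonal, ← Int.cast_det] at ha
    exact_mod_cast pos_of_mul_pos_right ha (Finset.prod_nonneg fun i _ => abs_nonneg _)
  have hOO : S * S.transpose = 1 := by
    ext i i'
    rw [Matrix.mul_apply]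
    simp only [Matrix.transpose_apply]
    rw [sum_mul_of_single (hS0 i)]
    by_cases hii : i = i'
    · subst hii
      rw [Matrix.one_apply_eq]
      rcases lt_or_gt_of_ne (hne i) with h | h <;> simp [hS, h]
    · rw [Matrix.one_apply_ne hii, hS0 i' _ fun e => hii (hinj e), mul_zero]
  rw [Matrix.mem_specialOrthogonalGroup_iff, Matrix.mem_orthogonalGroup_iff]
  refine ⟨hOO, ?_⟩
  have := congrArg Matrix.det hOO
  rw [Matrix.det_mul, Matrix.det_transpose, Matrix.det_one] at this
  nlinarith

theorem boxMap_sub {r : ℕ} {u : Address n} (hu : ∀ i, (u i).length = r) (x y : Fin n → ℝ) :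
    boxMap lam u x - boxMap lam u y = (1 / lam) ^ r • (x - y) := by
  funext i
  simp only [boxMap, Pi.sub_apply, word_sub, hu, Pi.smul_apply, smul_eq_mul]
  ring

/-- `Φ` maps the part of the dust in the box `u` to the part in the box `R`, by the symmetry `σ`
of the cube followed by the affine identification. -/
def BoxToBox (lam : ℝ) (Φ : (Fin n → ℝ) → Fin n → ℝ) (u : Address n)
    (σ : Matrix (Fin n) (Fin n) ℤ) (R : Address n) : Prop :=
  ∀ z ∈ dust n lam, Φ (boxMap lam u z) = boxMap lam R (cubeMap σ z)

/-- The rigidity lemmas apply to each coordinate of `Φ` on a small cube. Slopes and errors both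
carry the factor `(1 / lam) ^ r`, so the neighbourhood can be chosen independently of the level. -/
theorem exists_boxToBox_near (hl : 2 < lam) {Φ : (Fin n → ℝ) → Fin n → ℝ}
    {A : (Fin n → ℝ) →L[ℝ] (Fin n → ℝ)} {p : Fin n → ℝ} (hA : HasStrictFDerivAt Φ A p)
    (hdet : 0 < A.det) (hΦ : ∀ x ∈ dust n lam, Φ x ∈ dust n lam) :
    ∃ U, IsOpen U ∧ p ∈ U ∧ ∀ r : ℕ, ∀ u : Address n, (∀ i, (u i).length = r) →
      (∀ z ∈ dust n lam, boxMap lam u z ∈ U) →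
      ∃ σ ∈ Matrix.specialOrthogonalGroup (Fin n) ℤ, ∃ R, BoxToBox lam Φ u σ R := by
  have hlt := one_div_lt_half hl
  have e2 : 2 / lam = 2 * (1 / lam) := by ring
  have hg : 0 < 1 - 2 / lam := by linarith
  have hg1 : 1 - 2 / lam < 1 := by linarith
  set g := 1 - 2 / lam with hgdef
  set a : Matrix (Fin n) (Fin n) ℝ := LinearMap.toMatrix' (A : (Fin n → ℝ) →ₗ[ℝ] Fin n → ℝ)
    with ha
  have hAa : ∀ x i, A x i = ∑ k, a i k * x k := by
    intro x i
    have := congrFun (LinearMap.toMatrix'_mulVec (A : (Fin n → ℝ) →ₗ[ℝ] Fin n → ℝ) x) i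
    rw [← ha] at this
    exact this.symm
  have hadet : 0 < a.det := by
    rw [ha, LinearMap.det_toMatrix']
    exact hdet
  obtain ⟨μ, hμ, hμa⟩ := exists_pos_le_of_ne_zero fun q : Fin n × Fin n => a q.1 q.2
  -- This is the threshold of `eq_word_of_near` for the smallest nonzero entry of the derivative. It
  -- is also small enough to contradict `small_of_two` when a row has two nonzero entries.
  set ε := g ^ 2 / 20 * μ with hε
  have hε0 : 0 < ε := by positivity
  have hlit := hA.isLittleO.def hε0
  obtain ⟨U₁, hU₁, U₂, hU₂, hU⟩ := mem_nhds_prod_iff.1 hlit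
  refine ⟨interior (U₁ ∩ U₂), isOpen_interior,
    mem_interior_iff_mem_nhds.2 (Filter.inter_mem hU₁ hU₂), fun r u hu hbox => ?_⟩
  set s := (1 / lam) ^ r with hs
  have hs0 : 0 < s := pow_pos hlt.1 _
  -- Strict differentiability controls all pairs of points near `p`, which gives an error
  -- proportional to their distance.
  have est : ∀ i, ∀ z ∈ dust n lam, ∀ z' ∈ dust n lam,
      |Φ (boxMap lam u z) i - Φ (boxMap lam u z') i - ∑ k, (s * a i k) * (z k - z' k)| ≤
        (ε * s) * ‖z - z'‖ := by
    intro i z hz z' hz'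
    have h1 : (boxMap lam u z, boxMap lam u z') ∈ U₁ ×ˢ U₂ :=
      ⟨(interior_subset (hbox z hz)).1, (interior_subset (hbox z' hz')).2⟩
    have h2 := hU h1
    simp only [Set.mem_ofPred_eq] at h2
    rw [boxMap_sub hu, norm_smul, Real.norm_eq_abs, abs_of_pos hs0, ← mul_assoc] at h2
    refine le_trans ?_ h2
    refine le_trans (le_of_eq ?_) (norm_le_pi_norm _ i)
    rw [Real.norm_eq_abs, Pi.sub_apply, Pi.sub_apply, hAa]
    congr 2
    refine Finset.sum_congr rfl fun k _ => ?_
    simp only [Pi.smul_apply, Pi.sub_apply, smul_eq_mul]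
    ring
  have hmem : ∀ i, ∀ z ∈ dust n lam, Φ (boxMap lam u z) i ∈ centralCantor lam :=
    fun i z hz => hΦ _ (boxMap_mem (by linarith) u hz) i trivial
  have huniq : ∀ i j k, a i j ≠ 0 → a i k ≠ 0 → j = k := by
    intro i j k hj hk
    by_contra hjk
    have h1 := small_of_two hl (f := fun z => Φ (boxMap lam u z) i) (v := fun k => s * a i k)
      (δ := ε * s) (μ := s * μ) (hmem i)
      (fun z hz z' hz' => (est i z hz z' hz').trans
        (mul_le_of_le_one_right (by positivity) (norm_sub_le_one hz hz')))
      hjk (by positivity)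
      (by rw [abs_mul, abs_of_pos hs0]; gcongr; exact hμa (i, j) hj)
      (by rw [abs_mul, abs_of_pos hs0]; gcongr; exact hμa (i, k) hk)
    rw [← hgdef] at h1
    have h2 : s * (g * (μ - ε)) ≤ s * (2 * ε) := by linarith
    have h3 := le_of_mul_le_mul_left h2 hs0
    have h4 : ε ≤ g * μ / 20 := by
      rw [hε]
      nlinarith [mul_pos hg hμ]
    nlinarith [mul_pos hg hμ]
  have hex : ∀ i, ∃ j, a i j ≠ 0 := by
    intro i
    by_contra! h
    exact hadet.ne' (Matrix.det_eq_zero_of_row_eq_zero i h)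
  choose π hπ using hex
  have hπ0 : ∀ i k, k ≠ π i → a i k = 0 := by
    intro i k hk
    by_contra h
    exact hk (huniq i k (π i) h (hπ i))
  have hw : ∀ i, ∃ w, ∀ z ∈ dust n lam, Φ (boxMap lam u z) i =
      word lam w (if s * a i (π i) < 0 then 1 - z (π i) else z (π i)) := by
    intro i
    refine eq_word_of_near hl (hmem i) (δ := ε * s) (fun z hz z' hz' => ?_) (by positivity)
      (mul_ne_zero hs0.ne' (hπ i)) ?_
    · have := est i z hz z' hz'
      rwa [sum_mul_of_single (f := fun k => s * a i k) (k := π i) (fun k hk => by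
        rw [hπ0 i k hk, mul_zero])] at this
    · rw [abs_mul, abs_of_pos hs0, ← hgdef, hε]
      have := hμa (i, π i) (hπ i)
      have h1 : g ^ 2 / 20 * μ * s = g ^ 2 / 20 * (s * μ) := by ring
      rw [h1]
      gcongr
  choose R hR using hw
  refine ⟨_, sign_mem_specialOrthogonalGroup hadet hπ0, R, fun z hz => ?_⟩
  funext i
  rw [hR i z hz, boxMap, cubeMap_apply_entry (k := π i) fun k hk => by simp [hπ0 i k hk]]
  congr 1
  rcases lt_or_gt_of_ne (hπ i) with h | h
  · have h' : s * a i (π i) < 0 := mul_neg_of_pos_of_neg hs0 h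
    simp only [h', if_true, Matrix.of_apply, sign_neg h, SignType.coe_neg_one, Int.cast_neg,
      Int.cast_one]
    ring
  · have h' : ¬ s * a i (π i) < 0 := not_lt.2 (mul_pos hs0 h).le
    simp only [h', if_false, Matrix.of_apply, sign_pos h, SignType.coe_one, Int.cast_one]
    ring

theorem isCompact_dust (hl : 2 < lam) : IsCompact (dust n lam) :=
  isCompact_univ_pi fun _ => (centralCantor_attractor hl).1

/-- A diffeomorphism preserving the dust is affine on all small boxes of the same level. -/
theorem exists_level_boxToBox (hl : 2 < lam) {Φ : (Fin n → ℝ) → Fin n → ℝ}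
    (hC : ContDiff ℝ 1 Φ) (hdet : ∀ x, 0 < (fderiv ℝ Φ x).det)
    (hΦ : ∀ x ∈ dust n lam, Φ x ∈ dust n lam) :
    ∃ r : ℕ, ∀ u : Address n, (∀ i, (u i).length = r) →
      ∃ σ ∈ Matrix.specialOrthogonalGroup (Fin n) ℤ, ∃ R, BoxToBox lam Φ u σ R := by
  have hlt := one_div_lt_half hl
  choose U hUo hpU hU using fun p => exists_boxToBox_near hl
    (hC.contDiffAt (x := p).hasStrictFDerivAt one_ne_zero) (hdet p) hΦ
  -- With side less than a Lebesgue number, the dust in each cube of level `r` lies in one of the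
  -- neighbourhoods.
  obtain ⟨ε, hε, hball⟩ := lebesgue_number_lemma_of_metric (isCompact_dust (n := n) hl) hUo
    fun p _ => Set.mem_iUnion.2 ⟨p, hpU p⟩
  obtain ⟨r, hr⟩ := exists_pow_lt_of_lt_one hε (by linarith : 1 / lam < 1)
  refine ⟨r, fun u hu => ?_⟩
  obtain ⟨p, hp⟩ := hball _ (boxMap_mem (by linarith) u zero_mem_dust)
  refine hU p r u hu fun z hz => hp ?_
  rw [Metric.mem_ball, dist_eq_norm, boxMap_sub hu, norm_smul, Real.norm_eq_abs,
    abs_of_pos (pow_pos hlt.1 _)]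
  exact (mul_le_of_le_one_right (pow_pos hlt.1 _).le (norm_sub_le_one hz zero_mem_dust)).trans_lt hr

end Local

/-! ### Dyadic partitions and their refinements -/

section Partitions

variable {n : ℕ} {lam : ℝ}

theorem mem_box_iff {L : Address n} {x : Fin n → ℝ} :
    x ∈ box lam L ↔ ∀ i, ∃ y ∈ Set.Icc (0 : ℝ) 1, word lam (L i) y = x i := by
  constructor
  · rintro ⟨y, hy, rfl⟩ i
    exact ⟨y i, ⟨hy.1 i, hy.2 i⟩, rfl⟩
  · intro h
    choose y hy e using h
    exact ⟨y, ⟨fun i => (hy i).1, fun i => (hy i).2⟩, funext e⟩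

theorem dust_subset_Icc {z : Fin n → ℝ} (hz : z ∈ dust n lam) : z ∈ Set.Icc (0 : Fin n → ℝ) 1 :=
  ⟨fun i => (mem_Icc_of_mem_centralCantor (hz i trivial)).1,
    fun i => (mem_Icc_of_mem_centralCantor (hz i trivial)).2⟩

theorem exists_dust_of_mem_box (hl : 2 < lam) {L : Address n} {x : Fin n → ℝ}
    (hx : x ∈ dust n lam) (h : x ∈ box lam L) : ∃ y ∈ dust n lam, x = boxMap lam L y := by
  obtain ⟨y, hy, rfl⟩ := h
  exact ⟨y, fun i _ => mem_of_word_mem hl (L i) ⟨hy.1 i, hy.2 i⟩ (hx i trivial), rfl⟩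

theorem boxMap_mem_box {L : Address n} {y : Fin n → ℝ} (hy : y ∈ dust n lam) :
    boxMap lam L y ∈ box lam L :=
  ⟨y, dust_subset_Icc hy, rfl⟩

theorem box_half_subset (hl : 2 < lam) (L : Address n) (i : Fin n) (b : Bool) :
    box lam (half L i b) ⊆ box lam L := by
  rintro _ ⟨y, hy, rfl⟩
  rw [boxMap_half]
  refine ⟨_, ?_, rfl⟩
  have := ifs_mem_Icc (by linarith : 1 ≤ lam) b ⟨hy.1 i, hy.2 i⟩
  constructor
  · intro k
    by_cases hk : k = i
    · subst hk
      simpa using this.1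
    · simpa [hk] using hy.1 k
  · intro k
    by_cases hk : k = i
    · subst hk
      simpa using this.2
    · simpa [hk] using hy.2 k

theorem not_mem_both_halves (hl : 2 < lam) {L : Address n} {i : Fin n} {x : Fin n → ℝ}
    (h : x ∈ box lam (half L i false)) : x ∉ box lam (half L i true) := by
  intro h'
  obtain ⟨y, hy, e⟩ := mem_box_iff.1 h i
  obtain ⟨y', hy', e'⟩ := mem_box_iff.1 h' i
  rw [← e'] at e
  simp only [half, Function.update_self, word_append] at e
  exact Bool.false_ne_true (ifs_disjoint hl hy hy' (word_injective hl _ e))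

theorem mem_some_half (hl : 2 < lam) {L : Address n} (i : Fin n) {x : Fin n → ℝ}
    (hx : x ∈ dust n lam) (h : x ∈ box lam L) :
    x ∈ box lam (half L i false) ∨ x ∈ box lam (half L i true) := by
  obtain ⟨y, hy, rfl⟩ := exists_dust_of_mem_box hl hx h
  obtain ⟨b, t, ht, e⟩ := exists_ifs hl (hy i trivial)
  have : boxMap lam L y ∈ box lam (half L i b) := by
    have hy' : Function.update y i t ∈ dust n lam := by
      intro k _
      by_cases hk : k = i
      · subst hk
        simpa using ht
      · simpa [hk] using hy k trivial
    convert boxMap_mem_box (L := half L i b) hy' using 1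
    rw [boxMap_half]
    simp [← e]
  cases b
  exacts [Or.inl this, Or.inr this]

open scoped Classical in
/-- The number of boxes of the family `P` containing `x`. -/
def boxCount (lam : ℝ) (x : Fin n → ℝ) (P : Multiset (Address n)) : ℕ :=
  P.countP fun L => x ∈ box lam L

open scoped Classical in
theorem boxCount_cons (x : Fin n → ℝ) (L : Address n) (P : Multiset (Address n)) :
    boxCount lam x (L ::ₘ P) = boxCount lam x P + if x ∈ box lam L then 1 else 0 :=
  Multiset.countP_cons _ _ _

/-- The halves are disjoint and lie in the original box. Equality can fail only in the removed gap,
hence not on the dust. -/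
theorem boxCount_cut_le (hl : 2 < lam) (x : Fin n → ℝ) (L : Address n) (i : Fin n)
    (P : Multiset (Address n)) :
    boxCount lam x (half L i false ::ₘ half L i true ::ₘ P) ≤ boxCount lam x (L ::ₘ P) := by
  simp only [boxCount_cons]
  have h1 := @box_half_subset n lam hl L i false x
  have h2 := @box_half_subset n lam hl L i true x
  have h3 := @not_mem_both_halves n lam hl L i x
  split_ifs <;> first | omega | (exfalso; tauto)

theorem boxCount_cut (hl : 2 < lam) {x : Fin n → ℝ} (hx : x ∈ dust n lam) (L : Address n)
    (i : Fin n) (P : Multiset (Address n)) :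
    boxCount lam x (half L i false ::ₘ half L i true ::ₘ P) = boxCount lam x (L ::ₘ P) := by
  refine le_antisymm (boxCount_cut_le hl x L i P) ?_
  simp only [boxCount_cons]
  have h3 := @mem_some_half n lam hl L i x hx
  split_ifs <;> first | omega | (exfalso; tauto)

theorem boxCount_le_one (hl : 2 < lam) {P : Multiset (Address n)} (hP : IsDyadicPartition P)
    (x : Fin n → ℝ) : boxCount lam x P ≤ 1 := by
  induction hP with
  | cube =>
    rw [← Multiset.cons_zero, boxCount_cons]
    simp only [boxCount, Multiset.countP_zero]
    split_ifs <;> omega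
  | cut i _ ih => exact (boxCount_cut_le hl x _ i _).trans ih

theorem boxCount_eq_one (hl : 2 < lam) {P : Multiset (Address n)} (hP : IsDyadicPartition P)
    {x : Fin n → ℝ} (hx : x ∈ dust n lam) : boxCount lam x P = 1 := by
  induction hP with
  | cube =>
    rw [← Multiset.cons_zero, boxCount_cons, if_pos]
    · simp [boxCount]
    · exact ⟨x, dust_subset_Icc hx, rfl⟩
  | cut i _ ih => rw [boxCount_cut hl hx, ih]

theorem boxCount_cutSteps (hl : 2 < lam) {P Q : Multiset (Address n)}
    (h : Relation.ReflTransGen CutStep P Q) {x : Fin n → ℝ} (hx : x ∈ dust n lam) :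
    boxCount lam x Q = boxCount lam x P := by
  induction h with
  | refl => rfl
  | tail _ h ih =>
    obtain ⟨L, i, P', rfl, rfl⟩ := h
    rw [boxCount_cut hl hx, ih]

theorem IsDyadicPartition.cutSteps {P Q : Multiset (Address n)} (hP : IsDyadicPartition P)
    (h : Relation.ReflTransGen CutStep P Q) : IsDyadicPartition Q := by
  induction h with
  | refl => exact hP
  | tail _ h ih =>
    obtain ⟨L, i, P', rfl, rfl⟩ := h
    exact ih.cut i

theorem CutStep.add_left {P Q : Multiset (Address n)} (h : CutStep P Q)
    (A : Multiset (Address n)) : CutStep (A + P) (A + Q) := by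
  obtain ⟨L, i, P', rfl, rfl⟩ := h
  exact ⟨L, i, A + P', by simp, by simp⟩

theorem cutSteps_add {P Q P' Q' : Multiset (Address n)} (h : Relation.ReflTransGen CutStep P Q)
    (h' : Relation.ReflTransGen CutStep P' Q') :
    Relation.ReflTransGen CutStep (P + P') (Q + Q') := by
  have h1 := h'.lift (fun S => P + S) (fun _ _ h => CutStep.add_left h P)
  have h2 := h.lift (fun S => Q' + S) (fun _ _ h => CutStep.add_left h Q')
  simp only [add_comm Q'] at h2
  exact h1.trans h2

/-- Induction on the total number `N` of digits missing from the address; each cut supplies one. -/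
theorem exists_level_refinement_single (s : ℕ) (N : ℕ) (L : Address n)
    (hL : ∀ i, (L i).length ≤ s) (hN : ∑ i, (s - (L i).length) = N) :
    ∃ Q : Multiset (Address n), Relation.ReflTransGen CutStep {L} Q ∧
      ∀ R ∈ Q, ∀ i, (R i).length = s := by
  induction N generalizing L with
  | zero =>
    refine ⟨{L}, Relation.ReflTransGen.refl, fun R hR i => ?_⟩
    rw [Multiset.mem_singleton] at hR
    subst hR
    have := (Finset.sum_eq_zero_iff.1 hN) i (Finset.mem_univ i)
    have := hL i
    omega
  | succ N ih =>
    obtain ⟨i, hi⟩ : ∃ i, s - (L i).length ≠ 0 := by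
      by_contra! h
      simp [h] at hN
    have hlen : ∀ b k, (half L i b k).length = (L k).length + if k = i then 1 else 0 := by
      intro b k
      by_cases hk : k = i
      · subst hk
        simp [half]
      · simp [half, hk]
    have hle : ∀ b k, (half L i b k).length ≤ s := by
      intro b k
      rw [hlen]
      have := hL k
      split_ifs with hk
      · subst hk
        omega
      · omega
    have hsum : ∀ b, ∑ k, (s - (half L i b k).length) = N := by
      intro b
      have h1 : ∑ k, (s - (L k).length) =
          ∑ k, ((s - (half L i b k).length) + if k = i then 1 else 0) := by
        refine Finset.sum_congr rfl fun k _ => ?_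
        rw [hlen]
        have := hL k
        split_ifs with hk
        · subst hk
          omega
        · omega
      rw [h1, Finset.sum_add_distrib] at hN
      simpa using hN
    obtain ⟨Q, hQ, hQs⟩ := ih _ (hle false) (hsum false)
    obtain ⟨Q', hQ', hQs'⟩ := ih _ (hle true) (hsum true)
    refine ⟨Q + Q', Relation.ReflTransGen.head ⟨L, i, 0, rfl, rfl⟩ ?_, fun R hR => ?_⟩
    · simpa using cutSteps_add hQ hQ'
    · rcases Multiset.mem_add.1 hR with h | h
      exacts [hQs R h, hQs' R h]

theorem exists_level_refinement {s : ℕ} (P : Multiset (Address n))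
    (hP : ∀ L ∈ P, ∀ i, (L i).length ≤ s) :
    ∃ Q : Multiset (Address n), Relation.ReflTransGen CutStep P Q ∧
      ∀ R ∈ Q, ∀ i, (R i).length = s := by
  induction P using Multiset.induction with
  | empty => exact ⟨0, Relation.ReflTransGen.refl, by simp⟩
  | cons L P ih =>
    obtain ⟨Q, hQ, hQs⟩ := ih fun L hL => hP L (Multiset.mem_cons_of_mem hL)
    obtain ⟨Q', hQ', hQs'⟩ := exists_level_refinement_single s _ L
      (hP L (Multiset.mem_cons_self _ _)) rfl
    refine ⟨Q' + Q, by simpa using cutSteps_add hQ' hQ, fun R hR => ?_⟩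
    rcases Multiset.mem_add.1 hR with h | h
    exacts [hQs' R h, hQs R h]

theorem exists_level_partition (n s : ℕ) :
    ∃ Q : Multiset (Address n), IsDyadicPartition Q ∧ ∀ R ∈ Q, ∀ i, (R i).length = s := by
  obtain ⟨Q, hQ, hQs⟩ := exists_level_refinement (s := s) {(fun _ => [] : Address n)} (by simp)
  exact ⟨Q, IsDyadicPartition.cube.cutSteps hQ, hQs⟩

theorem eq_of_word_eq (hl : 2 < lam) {v w : List Bool} (h : v.length = w.length) {x y : ℝ}
    (hx : x ∈ Set.Icc (0 : ℝ) 1) (hy : y ∈ Set.Icc (0 : ℝ) 1) (e : word lam v x = word lam w y) :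
    v = w := by
  induction v generalizing w with
  | nil => exact (List.length_eq_zero_iff.1 h.symm).symm
  | cons b v ih =>
    cases w with
    | nil => simp at h
    | cons c w =>
      have hbc : b = c := ifs_disjoint hl (word_mem_Icc hl v hx) (word_mem_Icc hl w hy) e
      subst hbc
      rw [ih (by simpa using h) (ifs_injective hl b e)]

/-- At a fixed level, the lowest corner of a box lies in the dust and in no other box of that level,
so counting at corners recovers multiplicities. -/
theorem eq_of_boxCount_eq (hl : 2 < lam) {s : ℕ} {P Q : Multiset (Address n)}
    (hP : ∀ L ∈ P, ∀ i, (L i).length = s) (hQ : ∀ L ∈ Q, ∀ i, (L i).length = s)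
    (h : ∀ x ∈ dust n lam, boxCount lam x P = boxCount lam x Q) : P = Q := by
  classical
  ext v
  by_cases hv : ∀ i, (v i).length = s
  · have key : ∀ S : Multiset (Address n), (∀ L ∈ S, ∀ i, (L i).length = s) →
        boxCount lam (boxMap lam v 0) S = S.count v := by
      intro S hS
      unfold boxCount Multiset.count
      refine Multiset.countP_congr rfl fun L hL => eq_iff_iff.2 ?_
      constructor
      · intro hx
        funext i
        obtain ⟨y, hy, e⟩ := mem_box_iff.1 hx i
        exact eq_of_word_eq hl (by rw [hv, hS L hL]) (x := 0) (by simp) hy e.symm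
      · rintro rfl
        exact boxMap_mem_box zero_mem_dust
    rw [← key P hP, ← key Q hQ]
    exact h _ (boxMap_mem (by linarith) v zero_mem_dust)
  · rw [Multiset.count_eq_zero_of_notMem fun h => hv (hP v h),
      Multiset.count_eq_zero_of_notMem fun h => hv (hQ v h)]

theorem exists_numbering {α : Type*} (P : Multiset α) :
    ∃ (m : ℕ) (L : Fin m → α), Finset.univ.val.map L = P :=
  ⟨P.toList.length, P.toList.get, by
    rw [Fin.univ_val_map, List.ofFn_get, Multiset.coe_toList]⟩

theorem IsNumberedPattern.disjoint (hl : 2 < lam) {m : ℕ} {L : Fin m → Address n}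
    (hL : IsNumberedPattern L) :
    Pairwise fun j j' => Disjoint (box lam (L j)) (box lam (L j')) := by
  classical
  intro j j' hjj
  refine Set.disjoint_left.2 fun x hx hx' => ?_
  have h := boxCount_le_one hl hL x
  unfold boxCount at h
  rw [Multiset.countP_map, ← Finset.filter_val, Finset.card_val, Finset.card_le_one] at h
  exact hjj (h j (by simpa using hx) j' (by simpa using hx'))

theorem IsNumberedPattern.cover (hl : 2 < lam) {m : ℕ} {L : Fin m → Address n}
    (hL : IsNumberedPattern L) {x : Fin n → ℝ} (hx : x ∈ dust n lam) :
    ∃ j, x ∈ box lam (L j) := by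
  classical
  have h := boxCount_eq_one hl hL hx
  unfold boxCount at h
  rw [Multiset.countP_map, ← Finset.filter_val, Finset.card_val] at h
  obtain ⟨j, hj⟩ := Finset.card_pos.1 (h ▸ one_pos)
  exact ⟨j, (Finset.mem_filter.1 hj).2⟩

theorem MapsBox.mem_iff {h : dust n 3 ≃ₜ dust n 3} {L R : Address n}
    {σ : Matrix (Fin n) (Fin n) ℤ} (hσ : σ ∈ Matrix.specialOrthogonalGroup (Fin n) ℤ)
    (hh : MapsBox h L σ R) (x : dust n 3) :
    (h x : Fin n → ℝ) ∈ box 3 R ↔ (x : Fin n → ℝ) ∈ box 3 L := by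
  have key : ∀ {h : dust n 3 ≃ₜ dust n 3} {L R : Address n} {σ : Matrix (Fin n) (Fin n) ℤ},
      σ ∈ Matrix.specialOrthogonalGroup (Fin n) ℤ → MapsBox h L σ R → ∀ x : dust n 3,
      (x : Fin n → ℝ) ∈ box 3 L → (h x : Fin n → ℝ) ∈ box 3 R := by
    intro h L R σ hσ hh x hx
    obtain ⟨y, hy, e⟩ := exists_dust_of_mem_box (by norm_num) x.2 hx
    rw [hh x y hy e]
    exact boxMap_mem_box (cubeMap_mem (by norm_num) hσ hy)
  refine ⟨fun hx => ?_, key hσ hh x⟩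
  have := key (transpose_mem hσ) (mapsBox_inv hσ hh) (h x) hx
  have e : h⁻¹ (h x) = x := h.symm_apply_apply x
  rwa [e] at this

/-- A homeomorphism mapping boxes of a dyadic partition to boxes is a pattern map. -/
theorem isPatternMap_of_mapsBox {h : dust n 3 ≃ₜ dust n 3} {P : Multiset (Address n)}
    (hP : IsDyadicPartition P)
    (hh : ∀ L ∈ P, ∃ σ ∈ Matrix.specialOrthogonalGroup (Fin n) ℤ, ∃ R, MapsBox h L σ R) :
    IsPatternMap h := by
  classical
  choose! σ hσ R hR using hh
  rw [isPatternMap_iff]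
  set T : Multiset (Piece n) := P.map fun L => (L, σ L, R L) with hT
  have hT1 : T.map (fun t => t.1) = P := by simp [hT, Multiset.map_map]
  have hT2 : T.map (fun t => t.2.2) = P.map R := by simp [hT, Multiset.map_map]
  have hTd : Describes h T := by
    intro t ht
    obtain ⟨L, hL, rfl⟩ := Multiset.mem_map.1 ht
    exact ⟨hσ L hL, hR L hL⟩
  -- The targets are not known to arise by successive halvings. Cut down to one common level they
  -- can only form the full grid, which does.
  obtain ⟨s, hs⟩ : ∃ s, ∀ S ∈ P.map R, ∀ i, (S i).length ≤ s := by
    refine ⟨((P.map R).map fun S => ∑ i, (S i).length).sum, fun S hS i => ?_⟩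
    exact (Finset.single_le_sum (f := fun i => (S i).length) (fun _ _ => Nat.zero_le _)
      (Finset.mem_univ i)).trans
      (Multiset.single_le_sum (by simp) _ (Multiset.mem_map_of_mem _ hS))
  obtain ⟨Q, hQ, hQs⟩ := exists_level_refinement (P.map R) hs
  obtain ⟨Q', hQ', hQs'⟩ := exists_level_partition n s
  -- A point lies in as many targets as its preimage lies in sources, namely one, and cutting
  -- preserves this count on the dust.
  have hQQ : Q = Q' := by
    refine eq_of_boxCount_eq (lam := 3) (by norm_num) hQs hQs' fun x hx => ?_
    rw [boxCount_cutSteps (by norm_num) hQ hx, boxCount_eq_one (by norm_num) hQ' hx]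
    have e : h (h.symm ⟨x, hx⟩) = ⟨x, hx⟩ := h.apply_symm_apply _
    refine Eq.trans ?_ (boxCount_eq_one (lam := 3) (by norm_num) hP (h.symm ⟨x, hx⟩).2)
    unfold boxCount
    rw [Multiset.countP_map, Multiset.countP_eq_card_filter]
    congr 1
    refine Multiset.filter_congr fun L hL => ?_
    rw [← (hR L hL).mem_iff (hσ L hL), e]
  -- Each cut of a target is pulled back through its symmetry to a cut of the source.
  obtain ⟨T', hT', h1, h2⟩ := refine_target hTd (by rwa [hT1]) (hT2 ▸ hQ)
  exact ⟨T', hT', h1, by rwa [h2, hQQ]⟩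

end Partitions

/-! ### Coding of the Cantor set and conjugation between different ratios -/

section Coding

variable {n : ℕ} {lam : ℝ}

/-- The point of the central Cantor set with given binary address. -/
def code (lam : ℝ) (s : ℕ → Bool) : ℝ :=
  ∑' k, cond (s k) ((lam - 1) * (1 / lam) ^ (k + 1)) 0

theorem summable_code_bound (hl : 2 < lam) :
    Summable fun k : ℕ => (lam - 1) * (1 / lam) ^ (k + 1) := by
  have hlt := one_div_lt_half hl
  exact ((summable_nat_add_iff 1).2
    (summable_geometric_of_lt_one hlt.1.le (by linarith))).mul_left _

theorem code_term_bound (hl : 2 < lam) (b : Bool) (k : ℕ) :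
    ‖cond b ((lam - 1) * (1 / lam) ^ (k + 1)) 0‖ ≤ (lam - 1) * (1 / lam) ^ (k + 1) := by
  have hlt := one_div_lt_half hl
  have h : 0 ≤ (lam - 1) * (1 / lam) ^ (k + 1) :=
    mul_nonneg (by linarith) (pow_nonneg hlt.1.le _)
  cases b
  · simpa using h
  · rw [cond_true, Real.norm_eq_abs, abs_of_nonneg h]

theorem summable_code (hl : 2 < lam) (s : ℕ → Bool) :
    Summable fun k => cond (s k) ((lam - 1) * (1 / lam) ^ (k + 1)) 0 :=
  Summable.of_norm_bounded (summable_code_bound hl) fun k => code_term_bound hl (s k) k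

theorem continuous_code (hl : 2 < lam) : Continuous (code lam) := by
  refine continuous_tsum (fun k => ?_) (summable_code_bound hl)
    fun k s => code_term_bound hl (s k) k
  exact (continuous_of_discreteTopology (f := fun b : Bool =>
    (cond b ((lam - 1) * (1 / lam) ^ (k + 1)) 0 : ℝ))).comp (continuous_apply k)

theorem code_eq (hl : 2 < lam) (s : ℕ → Bool) :
    code lam s = ifs lam (s 0) (code lam fun k => s (k + 1)) := by
  have h0 : lam ≠ 0 := by linarith
  have e : ∀ k, cond (s (k + 1)) ((lam - 1) * (1 / lam) ^ (k + 1 + 1)) 0 =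
      cond (s (k + 1)) ((lam - 1) * (1 / lam) ^ (k + 1)) 0 * (1 / lam) := by
    intro k
    cases s (k + 1) <;> simp only [cond_true, cond_false] <;> ring
  unfold code
  rw [(summable_code hl s).tsum_eq_zero_add]
  simp only [e]
  rw [tsum_mul_right]
  cases s 0 <;> simp only [ifs, cond_true, cond_false] <;> ring

/-- The range is compact, as a continuous image of the binary sequences, and prefixing a digit shows
that it is self-similar; the attractor is unique. -/
theorem range_code (hl : 2 < lam) : Set.range (code lam) = centralCantor lam := by
  refine (centralCantor_eq_of_attractor hl _).1
    ⟨isCompact_range (continuous_code hl), Set.range_nonempty _, ?_⟩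
  ext x
  constructor
  · rintro ⟨s, rfl⟩
    rw [code_eq hl]
    cases s 0
    exacts [Or.inl ⟨_, ⟨_, rfl⟩, rfl⟩, Or.inr ⟨_, ⟨_, rfl⟩, rfl⟩]
  · have key : ∀ b s, ifs lam b (code lam s) ∈ Set.range (code lam) := fun b s =>
      ⟨fun k => Nat.casesOn k b s, code_eq hl _⟩
    rintro (⟨_, ⟨s, rfl⟩, rfl⟩ | ⟨_, ⟨s, rfl⟩, rfl⟩)
    exacts [key _ s, key _ s]

theorem code_mem (hl : 2 < lam) (s : ℕ → Bool) : code lam s ∈ centralCantor lam :=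
  range_code hl ▸ ⟨s, rfl⟩

theorem code_injective (hl : 2 < lam) : Function.Injective (code lam) := by
  intro s t h
  funext N
  induction N generalizing s t with
  | zero =>
    rw [code_eq hl s, code_eq hl t] at h
    exact ifs_disjoint hl (mem_Icc_of_mem_centralCantor (code_mem hl _))
      (mem_Icc_of_mem_centralCantor (code_mem hl _)) h
  | succ N ih =>
    rw [code_eq hl s, code_eq hl t] at h
    have h0 := ifs_disjoint hl (mem_Icc_of_mem_centralCantor (code_mem hl _))
      (mem_Icc_of_mem_centralCantor (code_mem hl _)) h
    rw [h0] at h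
    exact ih (ifs_injective hl _ h)

theorem code_not (hl : 2 < lam) (s : ℕ → Bool) : code lam (fun k => !(s k)) = 1 - code lam s := by
  have hlt := one_div_lt_half hl
  have h0 : lam ≠ 0 := by linarith
  have h1 : lam - 1 ≠ 0 := by linarith
  rw [eq_sub_iff_add_eq]
  unfold code
  rw [← (summable_code hl fun k => !(s k)).tsum_add (summable_code hl s)]
  have e : ∀ k, cond (!(s k)) ((lam - 1) * (1 / lam) ^ (k + 1)) 0 +
      cond (s k) ((lam - 1) * (1 / lam) ^ (k + 1)) 0 = (1 / lam) ^ k * ((lam - 1) / lam) := by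
    intro k
    cases s k <;> simp only [Bool.not_true, Bool.not_false, cond_true, cond_false] <;> ring
  simp only [e]
  rw [tsum_mul_right, tsum_geometric_of_lt_one hlt.1.le (by linarith)]
  field_simp

/-- The homeomorphism between binary sequences and the central Cantor set. -/
def codeHomeo (hl : 2 < lam) : (ℕ → Bool) ≃ₜ centralCantor lam :=
  Continuous.homeoOfEquivCompactToT2
    (f := Equiv.ofBijective (fun s => (⟨code lam s, code_mem hl s⟩ : centralCantor lam))
      ⟨fun _ _ h => code_injective hl (congrArg Subtype.val h), fun ⟨x, hx⟩ => by
        rw [← range_code hl] at hx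
        obtain ⟨s, rfl⟩ := hx
        exact ⟨s, rfl⟩⟩)
    ((continuous_code hl).subtype_mk _)

theorem codeHomeo_apply (hl : 2 < lam) (s : ℕ → Bool) : (codeHomeo hl s : ℝ) = code lam s := rfl

variable {lam' : ℝ}

/-- The homeomorphism between two central Cantor sets preserving addresses. -/
def cantorHomeo (hl : 2 < lam) (hl' : 2 < lam') : centralCantor lam ≃ₜ centralCantor lam' :=
  (codeHomeo hl).symm.trans (codeHomeo hl')

theorem cantorHomeo_code (hl : 2 < lam) (hl' : 2 < lam') {x : centralCantor lam} {s : ℕ → Bool}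
    (h : (x : ℝ) = code lam s) : (cantorHomeo hl hl' x : ℝ) = code lam' s := by
  have : x = codeHomeo hl s := Subtype.ext h
  subst this
  simp [cantorHomeo, codeHomeo_apply]

theorem cantorHomeo_ifs (hl : 2 < lam) (hl' : 2 < lam') (b : Bool) {x y : centralCantor lam}
    (h : (x : ℝ) = ifs lam b y) :
    (cantorHomeo hl hl' x : ℝ) = ifs lam' b (cantorHomeo hl hl' y) := by
  obtain ⟨y, hy⟩ := y
  obtain ⟨s, rfl⟩ := (range_code hl).symm ▸ hy
  rw [cantorHomeo_code hl hl' (x := ⟨code lam s, hy⟩) (s := s) rfl,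
    cantorHomeo_code hl hl' (x := x) (s := fun k => Nat.casesOn k b s)
      (h.trans (code_eq hl fun k => Nat.casesOn k b s).symm)]
  exact code_eq hl' _

theorem cantorHomeo_word (hl : 2 < lam) (hl' : 2 < lam') (w : List Bool)
    {x y : centralCantor lam} (h : (x : ℝ) = word lam w y) :
    (cantorHomeo hl hl' x : ℝ) = word lam' w (cantorHomeo hl hl' y) := by
  induction w generalizing x with
  | nil => rw [Subtype.ext h, word, id]
  | cons b w ih =>
    rw [cantorHomeo_ifs hl hl' b (y := ⟨word lam w y, word_mem (by linarith) w y.2⟩) h,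
      ih (x := ⟨word lam w y, word_mem (by linarith) w y.2⟩) rfl]
    rfl

theorem cantorHomeo_flip (hl : 2 < lam) (hl' : 2 < lam') {x y : centralCantor lam}
    (h : (x : ℝ) = 1 - y) : (cantorHomeo hl hl' x : ℝ) = 1 - cantorHomeo hl hl' y := by
  obtain ⟨y, hy⟩ := y
  obtain ⟨s, rfl⟩ := (range_code hl).symm ▸ hy
  rw [cantorHomeo_code hl hl' (x := ⟨code lam s, hy⟩) (s := s) rfl,
    cantorHomeo_code hl hl' (x := x) (s := fun k => !(s k)) (by rw [h, code_not hl])]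
  exact code_not hl' _

/-- The homeomorphism between the dusts of two ratios preserving addresses. -/
def dustHomeo (n : ℕ) (hl : 2 < lam) (hl' : 2 < lam') : dust n lam ≃ₜ dust n lam' where
  toFun x := ⟨fun i => cantorHomeo hl hl' ⟨x.1 i, x.2 i trivial⟩, fun _ _ => Subtype.property _⟩
  invFun x := ⟨fun i => (cantorHomeo hl hl').symm ⟨x.1 i, x.2 i trivial⟩,
    fun _ _ => Subtype.property _⟩
  left_inv x := by
    ext i
    simp
  right_inv x := by
    ext i
    simp
  continuous_toFun := (continuous_pi fun i => continuous_subtype_val.comp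
    ((cantorHomeo hl hl').continuous.comp
      (((continuous_apply i).comp continuous_subtype_val).subtype_mk _))).subtype_mk _
  continuous_invFun := (continuous_pi fun i => continuous_subtype_val.comp
    ((cantorHomeo hl hl').symm.continuous.comp
      (((continuous_apply i).comp continuous_subtype_val).subtype_mk _))).subtype_mk _

theorem dustHomeo_boxMap (hl : 2 < lam) (hl' : 2 < lam') (L : Address n) {x y : dust n lam}
    (h : (x : Fin n → ℝ) = boxMap lam L y) :
    (dustHomeo n hl hl' x : Fin n → ℝ) = boxMap lam' L (dustHomeo n hl hl' y) :=
  funext fun i => cantorHomeo_word hl hl' (L i) (congrFun h i)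

/-- A symmetry permutes coordinates and reflects some of them. A reflection complements every binary
digit, so the symmetry acts on addresses independently of the ratio. -/
theorem dustHomeo_cubeMap (hl : 2 < lam) (hl' : 2 < lam') {σ : Matrix (Fin n) (Fin n) ℤ}
    (hσ : σ ∈ Matrix.specialOrthogonalGroup (Fin n) ℤ) {x y : dust n lam}
    (h : (x : Fin n → ℝ) = cubeMap σ y) :
    (dustHomeo n hl hl' x : Fin n → ℝ) = cubeMap σ (dustHomeo n hl hl' y) := by
  funext i
  obtain ⟨k, hk, hr, -⟩ := exists_entry hσ i
  have hi := congrFun h i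
  rw [cubeMap_apply_entry hr] at hi ⊢
  rcases hk with hk | hk <;> rw [hk] at hi ⊢
  · have e : x.1 i = y.1 k := by
      rw [hi]
      push_cast
      ring
    have : (⟨x.1 i, x.2 i trivial⟩ : centralCantor lam) = ⟨y.1 k, y.2 k trivial⟩ := Subtype.ext e
    simp only [dustHomeo, Homeomorph.homeomorph_mk_coe, Equiv.coe_fn_mk, this]
    push_cast
    ring
  · have e : x.1 i = 1 - y.1 k := by
      rw [hi]
      push_cast
      ring
    have := cantorHomeo_flip hl hl' (x := ⟨x.1 i, x.2 i trivial⟩) (y := ⟨y.1 k, y.2 k trivial⟩) e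
    simp only [dustHomeo, Homeomorph.homeomorph_mk_coe, Equiv.coe_fn_mk, this]
    push_cast
    ring

/-- Conjugation by the homeomorphism between two dusts. -/
def dustConj (n : ℕ) (hl : 2 < lam) (hl' : 2 < lam') :
    (dust n lam ≃ₜ dust n lam) ≃* (dust n lam' ≃ₜ dust n lam') where
  toFun φ := (dustHomeo n hl hl').symm.trans (φ.trans (dustHomeo n hl hl'))
  invFun φ := (dustHomeo n hl hl').trans (φ.trans (dustHomeo n hl hl').symm)
  left_inv φ := by
    ext x
    simp
  right_inv φ := by
    ext x
    simp
  map_mul' φ ψ := by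
    ext x
    simp [Homeomorph.mul_apply]

/-- `φ` maps the part of the dust in the box `L` to the part in the box `R`, by the symmetry `σ`
of the cube followed by the affine identification. -/
def MapsBoxAt (φ : dust n lam ≃ₜ dust n lam) (L : Address n) (σ : Matrix (Fin n) (Fin n) ℤ)
    (R : Address n) : Prop :=
  ∀ x : dust n lam, ∀ y ∈ dust n lam, (x : Fin n → ℝ) = boxMap lam L y →
    (φ x : Fin n → ℝ) = boxMap lam R (cubeMap σ y)

theorem MapsBoxAt.conj (hl : 2 < lam) (hl' : 2 < lam') {φ : dust n lam ≃ₜ dust n lam}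
    {L R : Address n} {σ : Matrix (Fin n) (Fin n) ℤ}
    (hσ : σ ∈ Matrix.specialOrthogonalGroup (Fin n) ℤ) (h : MapsBoxAt φ L σ R) :
    MapsBoxAt (dustConj n hl hl' φ) L σ R := by
  intro x y hy hx
  set T := dustHomeo n hl hl' with hT
  obtain ⟨y', hy'⟩ := T.surjective ⟨y, hy⟩
  have hcube := cubeMap_mem (by linarith) hσ y'.2
  set x' : dust n lam := ⟨boxMap lam L y', boxMap_mem (by linarith) L y'.2⟩ with hx'
  have h1 : T x' = x := by
    refine Subtype.ext ?_
    rw [hT, dustHomeo_boxMap hl hl' L (y := y') rfl, ← hT, hy', hx]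
  have h2 := h x' y' y'.2 rfl
  have h3 : T.symm x = x' := by rw [← h1, T.symm_apply_apply]
  change ((T (φ (T.symm x)) : dust n lam') : Fin n → ℝ) = _
  rw [h3, hT, dustHomeo_boxMap hl hl' R (y := ⟨cubeMap σ y', hcube⟩) h2,
    dustHomeo_cubeMap hl hl' hσ (y := y') rfl, ← hT, hy']

theorem dustConj_symm (hl : 2 < lam) (hl' : 2 < lam') (φ : dust n lam' ≃ₜ dust n lam') :
    dustConj n hl' hl φ = (dustConj n hl hl').symm φ := rfl

end Coding

/-! ### Orientation preserving diffeomorphisms -/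

section Diffeos

open Topology

variable {n : ℕ}

/-- The group of orientation preserving `C ^ 1` diffeomorphisms of `ℝ ^ n`. -/
def orientedDiffeo (n : ℕ) : Subgroup (Equiv.Perm (Fin n → ℝ)) where
  carrier := {e | ContDiff ℝ 1 e ∧ ContDiff ℝ 1 e.symm ∧ ∀ x, 0 < (fderiv ℝ e x).det}
  one_mem' := by
    refine ⟨contDiff_id, contDiff_id, fun x => ?_⟩
    change 0 < (fderiv ℝ id x).det
    rw [fderiv_id]
    simp [ContinuousLinearMap.det]
  mul_mem' := by
    rintro f g ⟨hf, hf', hfd⟩ ⟨hg, hg', hgd⟩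
    refine ⟨hf.comp hg, hg'.comp hf', fun x => ?_⟩
    rw [Equiv.Perm.coe_mul, fderiv_comp x (hf.differentiable one_ne_zero _)
      (hg.differentiable one_ne_zero _)]
    have : ((fderiv ℝ f (g x)).comp (fderiv ℝ g x)).det =
        (fderiv ℝ f (g x)).det * (fderiv ℝ g x).det := LinearMap.det_comp _ _
    rw [this]
    exact mul_pos (hfd _) (hgd _)
  inv_mem' := by
    rintro f ⟨hf, hf', hfd⟩
    refine ⟨hf', hf, fun x => ?_⟩
    change 0 < (fderiv ℝ f.symm x).det
    have e : (fderiv ℝ f (f.symm x)).comp (fderiv ℝ f.symm x) =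
        ContinuousLinearMap.id ℝ (Fin n → ℝ) := by
      rw [← fderiv_comp x (hf.differentiable one_ne_zero _) (hf'.differentiable one_ne_zero _),
        ← fderiv_id (x := x)]
      congr 1
      funext y
      exact f.apply_symm_apply y
    have e2 : (fderiv ℝ f (f.symm x)).det * (fderiv ℝ f.symm x).det = 1 := by
      have : ((fderiv ℝ f (f.symm x)).comp (fderiv ℝ f.symm x)).det =
        (fderiv ℝ f (f.symm x)).det * (fderiv ℝ f.symm x).det := LinearMap.det_comp _ _
      rw [← this, e]
      simp [ContinuousLinearMap.det]
    exact pos_of_mul_pos_right (by rw [e2]; exact one_pos) (hfd _).le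

/-- Bijective `C ^ 1` maps with positive Jacobian are diffeomorphisms. -/
theorem mem_orientedDiffeo {e : Equiv.Perm (Fin n → ℝ)} (he : ContDiff ℝ 1 e)
    (hd : ∀ x, 0 < (fderiv ℝ e x).det) : e ∈ orientedDiffeo n := by
  refine ⟨he, ?_, hd⟩
  set f' : (Fin n → ℝ) → ((Fin n → ℝ) ≃L[ℝ] (Fin n → ℝ)) := fun x =>
    (fderiv ℝ e x).toContinuousLinearEquivOfDetNeZero (hd x).ne' with hf'
  have hs : ∀ x, HasStrictFDerivAt e (f' x : (Fin n → ℝ) →L[ℝ] (Fin n → ℝ)) x := by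
    intro x
    rw [hf', ContinuousLinearMap.coe_toContinuousLinearEquivOfDetNeZero]
    exact he.contDiffAt.hasStrictFDerivAt one_ne_zero
  exact (e.toHomeomorphOfContinuousOpen he.continuous
    (isOpenMap_of_hasStrictFDerivAt_equiv hs)).contDiff_symm (fun x => (hs x).hasFDerivAt) he

/-- Moving points along the `a`-th axis, by a bounded amount and monotonically. -/
theorem exists_axis_move {h : (Fin n → ℝ) → ℝ} (a : Fin n) (hC : ContDiff ℝ 1 h) {B κ : ℝ}
    (hB : ∀ x, |h x| ≤ B) (hκ : 0 < κ)
    (hmono : ∀ x, ∀ t, 0 ≤ t → (κ - 1) * t ≤ h (x + t • Pi.single a 1) - h x) :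
    ∃ e ∈ orientedDiffeo n, ∀ x, e x = x + h x • Pi.single a 1 := by
  set v : Fin n → ℝ := Pi.single a 1 with hv
  have hv0 : v ≠ 0 := by simp [hv]
  set F : (Fin n → ℝ) → Fin n → ℝ := fun x => x + h x • v with hF
  -- Along a line parallel to the axis, `F` advances by at least `κ * t`.
  have key : ∀ x, ∀ t : ℝ, 0 ≤ t → F (x + t • v) = F x → t = 0 := by
    intro x t ht he
    have h1 : (t + h (x + t • v) - h x) • v = 0 := by
      have : F (x + t • v) - F x = (t + h (x + t • v) - h x) • v := by
        simp only [hF]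
        module
      rw [← this, he, sub_self]
    have h2 := (smul_eq_zero.1 h1).resolve_right hv0
    have h3 := hmono x t ht
    nlinarith
  have hinj : Function.Injective F := by
    intro x y hxy
    have h1 : x = y + (h y - h x) • v := by
      have : x + h x • v = y + h y • v := hxy
      rw [sub_smul, ← add_sub_assoc, ← this, add_sub_cancel_right]
    rcases le_total 0 (h y - h x) with h0 | h0
    · have := key y _ h0 (by rw [← h1, hxy])
      rwa [this, zero_smul, add_zero] at h1
    · have h2 : y = x + (h x - h y) • v := by
        calc y = y + (h y - h x) • v + (h x - h y) • v := by module
          _ = x + (h x - h y) • v := by rw [← h1]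
      have := key x (h x - h y) (by linarith) (by rw [← h2, hxy])
      rw [this, zero_smul, add_zero] at h2
      exact h2.symm
  have hsurj : Function.Surjective F := by
    intro y
    have hcont : Continuous fun t : ℝ => t + h (y + t • v) := by
      have := hC.continuous
      fun_prop
    have hB0 : 0 ≤ B := (abs_nonneg _).trans (hB 0)
    obtain ⟨t, -, ht⟩ := intermediate_value_Icc (by linarith : -B ≤ B) hcont.continuousOn
      (show (0 : ℝ) ∈ Set.Icc _ _ from
        ⟨by linarith [(abs_le.1 (hB (y + -B • v))).2], by
          linarith [(abs_le.1 (hB (y + B • v))).1]⟩)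
    refine ⟨y + t • v, ?_⟩
    have h1 : h (y + t • v) = -t := by
      simp only at ht
      linarith
    simp only [hF, h1]
    module
  have hCF : ContDiff ℝ 1 F := by fun_prop
  refine ⟨Equiv.ofBijective F ⟨hinj, hsurj⟩, mem_orientedDiffeo hCF fun x => ?_, fun x => rfl⟩
  have hd : HasFDerivAt h (fderiv ℝ h x) x := (hC.differentiable one_ne_zero x).hasFDerivAt
  have hFd : HasFDerivAt F (ContinuousLinearMap.id ℝ _ + (fderiv ℝ h x).smulRight v) x :=
    (hasFDerivAt_id x).add (hd.smul_const v)
  change 0 < (fderiv ℝ F x).det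
  rw [hFd.fderiv]
  -- The derivative is a rank one perturbation of the identity, of determinant `1 + fderiv ℝ h x v`;
  -- the growth hypothesis makes this at least `κ`.
  have e : (ContinuousLinearMap.id ℝ _ + (fderiv ℝ h x).smulRight v).det =
      (LinearMap.transvection (fderiv ℝ h x : (Fin n → ℝ) →ₗ[ℝ] ℝ) v).det := by
    unfold ContinuousLinearMap.det
    congr 1
  rw [e, LinearMap.transvection.det]
  have hline : HasDerivAt (fun t : ℝ => h (x + t • v) - (κ - 1) * t)
      (fderiv ℝ h x v - (κ - 1)) 0 := by
    have h1 : HasDerivAt (fun t : ℝ => x + t • v) v 0 := by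
      simpa using ((hasDerivAt_id (0 : ℝ)).smul_const v).const_add x
    have h2 : HasFDerivAt h (fderiv ℝ h x) (x + (0 : ℝ) • v) := by simpa using hd
    have h3 := h2.comp_hasDerivAt (0 : ℝ) h1
    have h4 := h3.sub ((hasDerivAt_id (0 : ℝ)).const_mul (κ - 1))
    rw [mul_one] at h4
    exact h4
  have hm : Monotone fun t : ℝ => h (x + t • v) - (κ - 1) * t := by
    intro s t hst
    have := hmono (x + s • v) (t - s) (by linarith)
    have e : x + s • v + (t - s) • v = x + t • v := by module
    rw [e] at this
    simp only
    linarith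
  have h0 := hm.deriv_nonneg (x := 0)
  rw [hline.deriv] at h0
  change 0 < 1 + fderiv ℝ h x v
  linarith

/-- Finitely many affine germs are germs of one compactly supported function. -/
theorem exists_interpolation (s : Finset ℝ) (p q : ℝ → ℝ) :
    ∃ h : ℝ → ℝ, ContDiff ℝ 1 h ∧ HasCompactSupport h ∧
      ∀ t₀ ∈ s, ∀ᶠ t in 𝓝 t₀, h t = p t₀ + q t₀ * (t - t₀) := by
  induction s using Finset.induction_on with
  | empty => exact ⟨0, contDiff_const, HasCompactSupport.zero, by simp⟩
  | insert t₀ s ht₀ ih =>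
    obtain ⟨h, hC, hsupp, hs⟩ := ih
    have hopen : (↑s : Set ℝ)ᶜ ∈ 𝓝 t₀ := s.finite_toSet.isClosed.isOpen_compl.mem_nhds (by simpa)
    obtain ⟨δ, hδ, hball⟩ := Metric.mem_nhds_iff.1 hopen
    -- The bump is one near `t₀` and vanishes near the other points of `s`, so replacing `h` by the
    -- new germ there leaves the old germs intact.
    set χ : ContDiffBump t₀ := ⟨δ / 3, δ / 2, by positivity, by linarith⟩ with hχ
    refine ⟨fun t => h t + χ t * (p t₀ + q t₀ * (t - t₀) - h t), ?_, ?_, ?_⟩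
    · have := χ.contDiff (n := 1)
      fun_prop
    · exact hsupp.add χ.hasCompactSupport.mul_right
    · intro t₁ ht₁
      rcases Finset.mem_insert.1 ht₁ with rfl | ht₁
      · filter_upwards [χ.eventuallyEq_one] with t ht
        rw [ht]
        simp
      · have hd : δ / 2 < dist t₁ t₀ := by
          by_contra! hle
          have : t₁ ∈ Metric.ball t₀ δ := by
            rw [Metric.mem_ball]
            linarith
          exact hball this ht₁
        have hev : ∀ᶠ t in 𝓝 t₁, δ / 2 < dist t t₀ :=
          (continuous_id.dist continuous_const).continuousAt.eventually_const_lt hd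
        filter_upwards [hev, hs t₁ ht₁] with t h1 h2
        rw [χ.zero_of_le_dist h1.le, zero_mul, add_zero, h2]

/-- The displacement depends only on the `b`-th coordinate, so it is constant along the axis of
motion and any bounded profile is admissible. -/
theorem exists_shear {a b : Fin n} (hab : a ≠ b) (s : Finset ℝ) (p q : ℝ → ℝ) :
    ∃ e ∈ orientedDiffeo n, ∀ c : Fin n → ℝ, c b ∈ s →
      ∀ᶠ x in 𝓝 c, e x = x + (p (c b) + q (c b) * (x b - c b)) • Pi.single a 1 := by
  obtain ⟨h, hC, hsupp, hs⟩ := exists_interpolation s p q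
  obtain ⟨B, hB⟩ := hC.continuous.bounded_above_of_compact_support hsupp
  obtain ⟨e, he, hex⟩ := exists_axis_move (h := fun x => h (x b)) a (by fun_prop)
    (fun x => hB (x b)) one_pos (fun x t _ => by simp [Pi.single_eq_of_ne hab.symm])
  refine ⟨e, he, fun c hc => ?_⟩
  filter_upwards [(continuous_apply b).continuousAt.eventually (hs _ hc)] with x hx
  rw [hex, hx]

/-! ### Prescribing germs at finitely many points -/

/-- There is an orientation preserving diffeomorphism which near each `c j` is affine, with value
`d j` at `c j` and linear part `M j`. -/
def GermRel {ι : Type*} (c d : ι → Fin n → ℝ) (M : ι → Matrix (Fin n) (Fin n) ℝ) : Prop :=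
  ∃ e ∈ orientedDiffeo n, ∀ j, ∀ᶠ x in 𝓝 (c j), e x = d j + (M j).mulVec (x - c j)

variable {ι : Type*}

theorem GermRel.refl (c : ι → Fin n → ℝ) : GermRel c c 1 :=
  ⟨1, one_mem _, fun j => Filter.Eventually.of_forall fun x => by simp⟩

theorem GermRel.trans {c d f : ι → Fin n → ℝ} {M N : ι → Matrix (Fin n) (Fin n) ℝ}
    (h : GermRel c d M) (h' : GermRel d f N) : GermRel c f (N * M) := by
  obtain ⟨e, he, hj⟩ := h
  obtain ⟨e', he', hj'⟩ := h'
  refine ⟨e' * e, mul_mem he' he, fun j => ?_⟩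
  have h1 : e (c j) = d j := by simpa using (hj j).self_of_nhds
  have h2 : Filter.Tendsto e (𝓝 (c j)) (𝓝 (d j)) := by
    rw [← h1]
    exact he.1.continuous.continuousAt
  filter_upwards [hj j, h2.eventually (hj' j)] with x hx hx'
  rw [Equiv.Perm.mul_apply, hx', hx, add_sub_cancel_left, Matrix.mulVec_mulVec, Pi.mul_apply]

theorem GermRel.symm {c d : ι → Fin n → ℝ} (h : GermRel c d 1) : GermRel d c 1 := by
  obtain ⟨e, he, hj⟩ := h
  refine ⟨e⁻¹, inv_mem he, fun j => ?_⟩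
  have h1 : e (c j) = d j := by simpa using (hj j).self_of_nhds
  have h2 : Filter.Tendsto e.symm (𝓝 (d j)) (𝓝 (c j)) := by
    have : e.symm (d j) = c j := by rw [← h1, Equiv.symm_apply_apply]
    rw [← this]
    exact he.2.1.continuous.continuousAt
  filter_upwards [h2.eventually (hj j)] with y hy
  change e.symm y = _
  rw [Equiv.apply_symm_apply, Pi.one_apply, Matrix.one_mulVec] at hy
  have : y - d j = e.symm y - c j := by rw [sub_eq_iff_eq_add', ← hy]
  rw [Pi.one_apply, Matrix.one_mulVec, this]
  abel

variable [Finite ι]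

/-- A profile that is locally constant near the relevant values moves the points with germs that are
translations. -/
theorem germRel_shear (c : ι → Fin n → ℝ) {a b : Fin n} (hab : a ≠ b) (p : ℝ → ℝ) :
    GermRel c (fun j => c j + p (c j b) • Pi.single a 1) 1 := by
  have := Fintype.ofFinite ι
  obtain ⟨e, he, h⟩ := exists_shear hab (Finset.univ.image fun j => c j b) p 0
  refine ⟨e, he, fun j => ?_⟩
  filter_upwards [h (c j) (Finset.mem_image_of_mem _ (Finset.mem_univ j))] with x hx
  rw [hx, Pi.one_apply, Matrix.one_mulVec, Pi.zero_apply, zero_mul, add_zero]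
  abel

/-- Distinct `b`-th coordinates let the slope of the profile be chosen independently at each point;
its value is zero there, so the points stay fixed. -/
theorem germRel_transvection {d : ι → Fin n → ℝ} {a b : Fin n} (hab : a ≠ b)
    (hd : Function.Injective fun j => d j b) (q : ι → ℝ) :
    GermRel d d fun j => Matrix.transvection a b (q j) := by
  have := Fintype.ofFinite ι
  obtain ⟨e, he, h⟩ := exists_shear hab (Finset.univ.image fun j => d j b) 0
    (Function.extend (fun j => d j b) q 0)
  refine ⟨e, he, fun j => ?_⟩
  filter_upwards [h (d j) (Finset.mem_image_of_mem _ (Finset.mem_univ j))] with x hx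
  rw [hx, hd.extend_apply, Pi.zero_apply, zero_add, Matrix.transvection, Matrix.add_mulVec,
    Matrix.one_mulVec]
  have e : (Matrix.single a b (q j)).mulVec (x - d j) = (q j * (x b - d j b)) • Pi.single a 1 := by
    funext i
    by_cases hi : i = a
    · subst hi
      simp [Matrix.mulVec, dotProduct, Matrix.single_apply]
    · simp [Matrix.mulVec, dotProduct, Ne.symm hi, hi]
  rw [e]
  abel

end Diffeos

/-! ### Arbitrary germs of determinant one at distinct points -/

section Germs

variable {n : ℕ} {ι : Type*}

/-- Diagonal matrices of the form `diag (c, c⁻¹)` are products of transvections. -/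
theorem diag2n_eq_transvections {a b : Fin n} (hab : a ≠ b) {c : ℝ} (hc : c ≠ 0) :
    (Matrix.SpecialLinearGroup.diag2n hab c hc).1 =
      Matrix.transvection a b c * (Matrix.transvection b a (-c⁻¹) * (Matrix.transvection a b c *
        (Matrix.transvection a b (-1) * (Matrix.transvection b a 1 *
          Matrix.transvection a b (-1))))) := by
  rw [Matrix.SpecialLinearGroup.diag2n_coe]
  have last : ∀ i k, Matrix.transvection a b (-1 : ℝ) i k =
      (if i = k then 1 else 0) + if a = i ∧ b = k then -1 else 0 := by
    intro i k
    simp [Matrix.transvection, Matrix.one_apply, Matrix.single_apply]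
  ext i k
  by_cases hia : i = a
  · subst hia
    simp only [Matrix.transvection_mul_apply_same, last, ne_eq, hab, hab.symm, not_false_eq_true,
      Matrix.transvection_mul_apply_of_ne, Matrix.diagonal_apply, if_true, true_and, false_and,
      if_false]
    by_cases hki : i = k
    · subst hki
      simp [hab.symm]
      field_simp
      simp
    · by_cases hkb : b = k
      · subst hkb
        simp [hki, hc]
      · simp [hki, hkb]
  · by_cases hib : i = b
    · subst hib
      simp only [Matrix.transvection_mul_apply_same, last, ne_eq, hab, hia, not_false_eq_true,
        Matrix.transvection_mul_apply_of_ne, Matrix.diagonal_apply, if_true, true_and, false_and,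
        if_false]
      by_cases hki : i = k
      · subst hki
        simp [hab]
      · by_cases hkb : a = k
        · subst hkb
          simp [hki, hc]
        · simp [hki, hkb]
    · simp only [last, ne_eq, hia, hib, not_false_eq_true, Matrix.transvection_mul_apply_of_ne,
        Matrix.diagonal_apply, Ne.symm hia, false_and, if_false, add_zero]

theorem GermRel.mul {d : ι → Fin n → ℝ} {M N : ι → Matrix (Fin n) (Fin n) ℝ}
    (hM : GermRel d d M) (hN : GermRel d d N) : GermRel d d (M * N) :=
  hN.trans hM

theorem GermRel.trans_one {c d f : ι → Fin n → ℝ} (h : GermRel c d 1) (h' : GermRel d f 1) :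
    GermRel c f 1 := by
  simpa using h.trans h'

variable [Finite ι]

/-- The special linear group is generated by transvections, and a transvection with parameter zero
at the other points acts at `j₀` alone. -/
theorem germRel_single [DecidableEq ι] {d : ι → Fin n → ℝ} (hn : 2 ≤ n)
    (hd : ∀ b, Function.Injective fun j => d j b) (j₀ : ι)
    (N : Matrix.SpecialLinearGroup (Fin n) ℝ) :
    GermRel d d fun j => if j = j₀ then N.1 else 1 := by
  have : Nontrivial (Fin n) := Fin.nontrivial_iff_two_le.2 hn
  have hmul : ∀ A B : Matrix (Fin n) (Fin n) ℝ, (GermRel d d fun j => if j = j₀ then A else 1) →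
      (GermRel d d fun j => if j = j₀ then B else 1) →
      GermRel d d fun j => if j = j₀ then A * B else 1 := by
    intro A B hA hB
    convert hA.mul hB using 1
    funext j
    by_cases hj : j = j₀ <;> simp [hj]
  have htr : ∀ a b : Fin n, a ≠ b → ∀ c : ℝ,
      GermRel d d fun j => if j = j₀ then Matrix.transvection a b c else 1 := by
    intro a b hab c
    convert germRel_transvection hab (hd b) (fun j => if j = j₀ then c else 0) using 1
    funext j
    by_cases hj : j = j₀ <;> simp [hj]
  induction N using Matrix.SpecialLinearGroup.diagonal_transvection_induction' with
  | hdiag a b hab hc =>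
    rw [diag2n_eq_transvections hab hc]
    refine hmul _ _ (htr _ _ hab _) (hmul _ _ (htr _ _ hab.symm _) (hmul _ _ (htr _ _ hab _)
      (hmul _ _ (htr _ _ hab _) (hmul _ _ (htr _ _ hab.symm _) (htr _ _ hab _)))))
  | htransvec a b hab c => exact htr a b hab c
  | hmul A B hA hB => exact hmul _ _ hA hB

theorem germRel_specialLinear {d : ι → Fin n → ℝ} (hn : 2 ≤ n)
    (hd : ∀ b, Function.Injective fun j => d j b)
    (N : ι → Matrix.SpecialLinearGroup (Fin n) ℝ) : GermRel d d fun j => (N j).1 := by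
  classical
  have := Fintype.ofFinite ι
  have key : ∀ s : Finset ι, GermRel d d fun j => if j ∈ s then (N j).1 else 1 := by
    intro s
    induction s using Finset.induction_on with
    | empty =>
      convert GermRel.refl d using 1
      funext j
      simp
    | insert j₀ s hj₀ ih =>
      convert ih.mul (germRel_single hn hd j₀ (N j₀)) using 1
      funext j
      by_cases hj : j = j₀
      · subst hj
        simp [hj₀]
      · simp [hj]
  simpa using key Finset.univ

/-- Since the `b`-th coordinate labels the points, one shear can shift each point along the axis `a`
by its own amount. -/
theorem germRel_set_coord (c : ι → Fin n → ℝ) {a b : Fin n} (hab : a ≠ b)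
    (hc : Function.Injective fun j => c j b) (t : ι → ℝ) :
    GermRel c (fun j => Function.update (c j) a (t j)) 1 := by
  have := germRel_shear c hab (Function.extend (fun j => c j b) (fun j => t j - c j a) 0)
  convert this using 1
  funext j i
  rw [hc.extend_apply]
  by_cases hi : i = a
  · subst hi
    simp
  · simp [hi]

/-- Any configuration of distinct points can be moved to the diagonal. -/
theorem germRel_diagonal (hn : 2 ≤ n) {c : ι → Fin n → ℝ} (hc : Function.Injective c)
    {t : ι → ℝ} (ht : Function.Injective t) : GermRel c (fun j _ => t j) 1 := by
  classical
  have := Fintype.ofFinite ι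
  have : Nontrivial (Fin n) := Fin.nontrivial_iff_two_le.2 hn
  obtain ⟨a, b₀, hab₀⟩ := exists_pair_ne (Fin n)
  -- A linear form separating the points. The extra index `none` makes it nonzero on the `a`-th
  -- basis vector, so it can be normalised there.
  obtain ⟨f, hf⟩ := Module.exists_dual_forall_apply_ne_zero (K := ℝ)
    (fun q : Option {q : ι × ι // q.1 ≠ q.2} =>
      q.elim (Pi.single a 1 : Fin n → ℝ) fun q => c q.1.1 - c q.1.2) (by
      rintro (_ | ⟨⟨i, j⟩, hij⟩)
      · simp
      · exact sub_ne_zero.2 fun h => hij (hc h))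
  have hfa : f (Pi.single a 1) ≠ 0 := hf none
  have hfc : Function.Injective fun j => f (c j) := by
    intro i j hij
    by_contra hne
    refine hf (some ⟨(i, j), hne⟩) ?_
    simpa [sub_eq_zero] using hij
  set s : Fin n → ℝ := fun b => f (Pi.single b 1) / f (Pi.single a 1) with hs
  have hfs : ∀ x, x a + ∑ b ∈ Finset.univ.erase a, s b * x b = f x / f (Pi.single a 1) := by
    intro x
    have h1 : f x = ∑ b, f (Pi.single b 1) * x b := by
      conv_lhs => rw [LinearMap.pi_apply_eq_sum_univ f x]
      refine Finset.sum_congr rfl fun b _ => ?_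
      rw [smul_eq_mul, mul_comm]
      congr 2
      funext i
      simp [Pi.single_apply, eq_comm]
    rw [h1, ← Finset.add_sum_erase _ _ (Finset.mem_univ a), add_div, mul_div_cancel_left₀ _ hfa,
      Finset.sum_div]
    congr 1
    refine Finset.sum_congr rfl fun b _ => ?_
    simp only [hs]
    ring
  -- Shears add multiples of the other coordinates to the `a`-th one, until it equals the normalised
  -- form and so separates the points.
  have step1 : ∀ S : Finset (Fin n), a ∉ S →
      GermRel c (fun j => c j + (∑ b ∈ S, s b * c j b) • Pi.single a 1) 1 := by
    intro S
    induction S using Finset.induction_on with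
    | empty => simpa using GermRel.refl c
    | insert b S hb ih =>
      intro haS
      rw [Finset.mem_insert, not_or] at haS
      refine (ih haS.2).trans_one ?_
      convert germRel_shear (fun j => c j + (∑ b ∈ S, s b * c j b) • Pi.single a 1) haS.1
        (fun t => s b * t) using 1
      funext j
      rw [Finset.sum_insert hb]
      have : (c j + (∑ b ∈ S, s b * c j b) • (Pi.single a 1 : Fin n → ℝ)) b = c j b := by
        simp [Pi.single_eq_of_ne (Ne.symm haS.1)]
      rw [this, add_smul]
      abel
  have h1 := step1 (Finset.univ.erase a) (by simp)
  set c₁ : ι → Fin n → ℝ :=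
    fun j => c j + (∑ b ∈ Finset.univ.erase a, s b * c j b) • Pi.single a 1 with hc₁
  have hinj : Function.Injective fun j => c₁ j a := by
    intro i j hij
    have e : ∀ j, c₁ j a = f (c j) / f (Pi.single a 1) := by
      intro j
      rw [← hfs]
      simp [hc₁]
    simp only [e] at hij
    exact hfc ((div_left_inj' hfa).1 hij)
  -- The `a`-th coordinate now labels the points while the others are set to `t j`. One of those
  -- then labels the points while the `a`-th is set.
  have step2 : ∀ S : Finset (Fin n), a ∉ S →
      GermRel c₁ (fun j i => if i ∈ S then t j else c₁ j i) 1 := by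
    intro S
    induction S using Finset.induction_on with
    | empty => simpa using GermRel.refl c₁
    | insert b S hb ih =>
      intro haS
      rw [Finset.mem_insert, not_or] at haS
      refine (ih haS.2).trans_one ?_
      convert germRel_set_coord (fun j i => if i ∈ S then t j else c₁ j i) (Ne.symm haS.1)
        (by simpa [haS.2] using hinj) t using 1
      funext j i
      by_cases hi : i = b
      · subst hi
        simp
      · simp [hi]
  have h2 := step2 (Finset.univ.erase a) (by simp)
  refine (h1.trans_one h2).trans_one ?_
  convert germRel_set_coord (fun j i => if i ∈ Finset.univ.erase a then t j else c₁ j i) hab₀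
    (by simpa [hab₀.symm] using ht) t using 1
  funext j i
  by_cases hi : i = a
  · subst hi
    simp
  · simp [hi]

/-- Germs of affine maps of determinant one can be prescribed at distinct points. -/
theorem germRel_of_injective (hn : 2 ≤ n) {c d : ι → Fin n → ℝ} (hc : Function.Injective c)
    (hd : Function.Injective d) (N : ι → Matrix.SpecialLinearGroup (Fin n) ℝ) :
    GermRel c d fun j => (N j).1 := by
  obtain ⟨k, ⟨eq⟩⟩ := Finite.exists_equiv_fin ι
  have ht : Function.Injective fun j : ι => ((eq j : ℕ) : ℝ) := fun i j h =>
    eq.injective (Fin.ext (Nat.cast_injective h))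
  -- On the diagonal every coordinate separates the points, so the linear parts are inserted there,
  -- between two displacements with identity linear part.
  have h := ((germRel_diagonal hn hc ht).trans (germRel_specialLinear hn (fun _ => ht) N)).trans
    (germRel_diagonal hn hd ht).symm
  rwa [mul_one, one_mul] at h

end Germs

/-! ### Shrinking disjoint boxes -/

section Shrink

variable {n : ℕ}

/-- A cutoff: `1` on `[-ρ, ρ]`, vanishing when `ρ + η ≤ |t|`. -/
def cutoff (ρ η t : ℝ) : ℝ :=
  Real.smoothTransition (((ρ + η) ^ 2 - t ^ 2) / ((ρ + η) ^ 2 - ρ ^ 2))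

variable {ρ η : ℝ}

theorem cutoff_denom_pos (hρ : 0 < ρ) (hη : 0 < η) : 0 < (ρ + η) ^ 2 - ρ ^ 2 := by
  nlinarith [mul_pos hρ hη]

theorem cutoff_eq_one (hρ : 0 < ρ) (hη : 0 < η) {t : ℝ} (ht : |t| ≤ ρ) : cutoff ρ η t = 1 := by
  refine Real.smoothTransition.one_of_one_le ?_
  rw [one_le_div (cutoff_denom_pos hρ hη)]
  have := sq_le_sq' (abs_le.1 ht).1 (abs_le.1 ht).2
  linarith

theorem cutoff_eq_zero (hρ : 0 < ρ) (hη : 0 < η) {t : ℝ} (ht : ρ + η ≤ |t|) :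
    cutoff ρ η t = 0 := by
  refine Real.smoothTransition.zero_of_nonpos
    (div_nonpos_of_nonpos_of_nonneg ?_ (cutoff_denom_pos hρ hη).le)
  rw [← sq_abs t]
  have : (ρ + η) ^ 2 ≤ |t| ^ 2 := by gcongr
  linarith

theorem cutoff_nonneg (t : ℝ) : 0 ≤ cutoff ρ η t := Real.smoothTransition.nonneg _

theorem cutoff_le_one (t : ℝ) : cutoff ρ η t ≤ 1 := Real.smoothTransition.le_one _

theorem cutoff_antitone (hρ : 0 < ρ) (hη : 0 < η) {s t : ℝ} (h : |s| ≤ |t|) :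
    cutoff ρ η t ≤ cutoff ρ η s := by
  refine Real.smoothTransition.monotone ?_
  have h1 := cutoff_denom_pos hρ hη
  have h2 : s ^ 2 ≤ t ^ 2 := sq_le_sq.2 h
  gcongr

theorem contDiff_cutoff : ContDiff ℝ 1 (cutoff ρ η) :=
  Real.smoothTransition.contDiff.comp (by fun_prop)

/-- This slope bound makes `t + (ε - 1) * (t * cutoff ρ η t)` have slope at least `ε` when `ε ≤ 1`,
so the cut-off contraction remains invertible. -/
theorem mul_cutoff_sub_le (hρ : 0 < ρ) (hη : 0 < η) {s t : ℝ} (h : s ≤ t) :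
    t * cutoff ρ η t - s * cutoff ρ η s ≤ t - s := by
  have s0 := cutoff_nonneg (ρ := ρ) (η := η) s
  have s1 := cutoff_le_one (ρ := ρ) (η := η) s
  have t0 := cutoff_nonneg (ρ := ρ) (η := η) t
  have t1 := cutoff_le_one (ρ := ρ) (η := η) t
  rcases le_total 0 s with hs | hs
  · have := cutoff_antitone hρ hη (s := s) (t := t)
      (by rwa [abs_of_nonneg hs, abs_of_nonneg (hs.trans h)])
    nlinarith
  · rcases le_total 0 t with ht | ht
    · nlinarith
    · have := cutoff_antitone hρ hη (s := t) (t := s)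
        (by rw [abs_of_nonpos hs, abs_of_nonpos ht]; linarith)
      nlinarith

theorem abs_mul_cutoff_le (hρ : 0 < ρ) (hη : 0 < η) (t : ℝ) :
    |t * cutoff ρ η t| ≤ ρ + η := by
  have t0 := cutoff_nonneg (ρ := ρ) (η := η) t
  have t1 := cutoff_le_one (ρ := ρ) (η := η) t
  rcases le_total (ρ + η) |t| with h | h
  · rw [cutoff_eq_zero hρ hη h, mul_zero, abs_zero]
    linarith
  · rw [abs_mul, abs_of_nonneg t0]
    exact (mul_le_of_le_one_right (abs_nonneg t) t1).trans h

/-- Shrinking a box in one direction. -/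
theorem exists_shrink_axis (c ρ : Fin n → ℝ) (hρ : ∀ i, 0 < ρ i) {η : ℝ} (hη : 0 < η) (a : Fin n)
    {ε : ℝ} (hε : 0 < ε) (hε1 : ε ≤ 1) :
    ∃ e ∈ orientedDiffeo n,
      (∀ x, (∀ i, |x i - c i| ≤ ρ i) → e x = Function.update x a (c a + ε * (x a - c a))) ∧
      ∀ x, (∃ i, ρ i + η ≤ |x i - c i|) → e x = x := by
  set P : (Fin n → ℝ) → ℝ := fun x => ∏ i ∈ Finset.univ.erase a, cutoff (ρ i) η (x i - c i) with hP
  have hP0 : ∀ x, 0 ≤ P x := fun x => Finset.prod_nonneg fun i _ => cutoff_nonneg _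
  have hP1 : ∀ x, P x ≤ 1 :=
    fun x => Finset.prod_le_one (fun i _ => cutoff_nonneg _) fun i _ => cutoff_le_one _
  have hPC : ContDiff ℝ 1 P := contDiff_prod fun i _ => contDiff_cutoff.comp (by fun_prop)
  have hPt : ∀ x (t : ℝ), P (x + t • Pi.single a 1) = P x := by
    intro x t
    refine Finset.prod_congr rfl fun i hi => ?_
    simp [Pi.single_eq_of_ne (Finset.ne_of_mem_erase hi)]
  set q : (Fin n → ℝ) → ℝ := fun x => (x a - c a) * cutoff (ρ a) η (x a - c a) with hq
  have hqC : ContDiff ℝ 1 q := by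
    have h1 : ContDiff ℝ 1 fun x : Fin n → ℝ => cutoff (ρ a) η (x a - c a) :=
      contDiff_cutoff.comp (by fun_prop)
    fun_prop
  obtain ⟨e, he, hex⟩ := exists_axis_move (h := fun x => (ε - 1) * (q x * P x)) a
    (contDiff_const.mul (hqC.mul hPC)) (B := ρ a + η) (κ := ε) (fun x => by
      have h1 := abs_mul_cutoff_le (hρ a) hη (x a - c a)
      rw [abs_mul, abs_mul, abs_of_nonneg (hP0 x), abs_of_nonpos (by linarith : ε - 1 ≤ 0)]
      have h2 : |q x| * P x ≤ |q x| := mul_le_of_le_one_right (abs_nonneg _) (hP1 x)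
      have h3 : 0 ≤ |q x| * P x := mul_nonneg (abs_nonneg _) (hP0 x)
      change |q x| ≤ ρ a + η at h1
      nlinarith) hε (fun x t ht => by
      have h1 := mul_cutoff_sub_le (hρ a) hη (s := x a - c a) (t := x a - c a + t) (by linarith)
      have h2 : q (x + t • Pi.single a 1) =
          (x a - c a + t) * cutoff (ρ a) η (x a - c a + t) := by
        simp only [hq, Pi.add_apply, Pi.smul_apply, Pi.single_eq_same, smul_eq_mul, mul_one]
        rw [add_sub_right_comm]
      have h4 : q (x + t • Pi.single a 1) - q x ≤ t := by
        rw [h2]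
        simp only [hq]
        linarith
      rw [hPt]
      have h5 : (q (x + t • Pi.single a 1) - q x) * P x ≤ t := by
        rcases le_total 0 (q (x + t • Pi.single a 1) - q x) with h | h
        · exact (mul_le_of_le_one_right h (hP1 x)).trans h4
        · exact (mul_nonpos_of_nonpos_of_nonneg h (hP0 x)).trans ht
      nlinarith)
  refine ⟨e, he, fun x hx => ?_, fun x ⟨i, hi⟩ => ?_⟩
  · have h1 : P x = 1 := Finset.prod_eq_one fun i _ => cutoff_eq_one (hρ i) hη (hx i)
    have h2 : q x = x a - c a := by
      simp only [hq]
      rw [cutoff_eq_one (hρ a) hη (hx a), mul_one]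
    rw [hex, h1, h2]
    funext i
    by_cases hi : i = a
    · subst hi
      simp
      ring
    · simp [hi]
  · rw [hex]
    have : q x * P x = 0 := by
      by_cases hia : i = a
      · subst hia
        simp only [hq]
        rw [cutoff_eq_zero (hρ i) hη hi]
        ring
      · have : P x = 0 := Finset.prod_eq_zero (Finset.mem_erase.2 ⟨hia, Finset.mem_univ i⟩)
          (cutoff_eq_zero (hρ i) hη hi)
        rw [this, mul_zero]
    simp [this]

theorem abs_shrink_le {ε t r : ℝ} (hε : 0 < ε) (hε1 : ε ≤ 1) (ht : |t| ≤ r) : |ε * t| ≤ r := by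
  rw [abs_mul, abs_of_pos hε]
  exact (mul_le_of_le_one_left (abs_nonneg t) hε1).trans ht

/-- Shrinking a box, with support in a neighbourhood. -/
theorem exists_shrink_box (c ρ : Fin n → ℝ) (hρ : ∀ i, 0 < ρ i) {η : ℝ} (hη : 0 < η)
    {ε : Fin n → ℝ} (hε : ∀ i, 0 < ε i) (hε1 : ∀ i, ε i ≤ 1) :
    ∃ e ∈ orientedDiffeo n,
      (∀ x, (∀ i, |x i - c i| ≤ ρ i) → e x = fun i => c i + ε i * (x i - c i)) ∧
      ∀ x, (∃ i, ρ i + η ≤ |x i - c i|) → e x = x := by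
  have key : ∀ S : Finset (Fin n), ∃ e ∈ orientedDiffeo n,
      (∀ x, (∀ i, |x i - c i| ≤ ρ i) →
        e x = fun i => if i ∈ S then c i + ε i * (x i - c i) else x i) ∧
      ∀ x, (∃ i, ρ i + η ≤ |x i - c i|) → e x = x := by
    intro S
    induction S using Finset.induction_on with
    | empty => exact ⟨1, one_mem _, by simp, by simp⟩
    | insert a S ha ih =>
      obtain ⟨e, he, h1, h2⟩ := ih
      obtain ⟨e', he', h1', h2'⟩ := exists_shrink_axis c ρ hρ hη a (hε a) (hε1 a)
      refine ⟨e' * e, mul_mem he' he, fun x hx => ?_, fun x hx => ?_⟩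
      · rw [Equiv.Perm.mul_apply, h1', h1 x hx]
        · funext i
          by_cases hi : i = a
          · subst hi
            simp [ha]
          · simp [hi]
        · intro i
          rw [h1 x hx]
          by_cases hi : i ∈ S
          · simp only [hi, if_true, add_sub_cancel_left]
            exact abs_shrink_le (hε i) (hε1 i) (hx i)
          · simpa only [hi, if_false] using hx i
      · rw [Equiv.Perm.mul_apply, h2 x hx, h2' x hx]
  obtain ⟨e, he, h1, h2⟩ := key Finset.univ
  exact ⟨e, he, by simpa using h1, h2⟩

/-- Shrinking finitely many disjoint boxes. -/
theorem exists_shrink {ι : Type*} [Finite ι] (c ρ : ι → Fin n → ℝ) (hρ : ∀ j i, 0 < ρ j i)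
    (hdis : ∀ j j', j ≠ j' → ∃ i, ρ j i + ρ j' i < |c j i - c j' i|)
    {ε : ι → Fin n → ℝ} (hε : ∀ j i, 0 < ε j i) (hε1 : ∀ j i, ε j i ≤ 1) :
    ∃ e ∈ orientedDiffeo n, ∀ j x, (∀ i, |x i - c j i| ≤ ρ j i) →
      e x = fun i => c j i + ε j i * (x i - c j i) := by
  classical
  have := Fintype.ofFinite ι
  choose k hk using hdis
  -- The least slack between two boxes: enlarging one box by `η` keeps it off the others.
  obtain ⟨η, hη, hηle⟩ := exists_pos_le_of_ne_zero fun q : {q : ι × ι // q.1 ≠ q.2} =>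
    |c q.1.1 (k _ _ q.2) - c q.1.2 (k _ _ q.2)| - (ρ q.1.1 (k _ _ q.2) + ρ q.1.2 (k _ _ q.2))
  have hsep : ∀ j j', j ≠ j' → ∃ i, ρ j i + ρ j' i + η ≤ |c j i - c j' i| := by
    intro j j' hjj
    have h1 := sub_pos.2 (hk j j' hjj)
    have h2 := hηle ⟨(j, j'), hjj⟩ h1.ne'
    rw [abs_of_pos h1] at h2
    exact ⟨k j j' hjj, by linarith⟩
  have key : ∀ S : Finset ι, ∃ e ∈ orientedDiffeo n, ∀ j x, (∀ i, |x i - c j i| ≤ ρ j i) →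
      e x = if j ∈ S then fun i => c j i + ε j i * (x i - c j i) else x := by
    intro S
    induction S using Finset.induction_on with
    | empty => exact ⟨1, one_mem _, by simp⟩
    | insert j₀ S hj₀ ih =>
      obtain ⟨e, he, h⟩ := ih
      obtain ⟨e', he', h1, h2⟩ := exists_shrink_box (c j₀) (ρ j₀) (hρ j₀) hη (hε j₀) (hε1 j₀)
      refine ⟨e' * e, mul_mem he' he, fun j x hx => ?_⟩
      rw [Equiv.Perm.mul_apply, h j x hx]
      by_cases hj : j = j₀
      · subst hj
        simp only [hj₀, if_false, Finset.mem_insert_self, if_true]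
        exact h1 x hx
      · have hmem : j ∈ insert j₀ S ↔ j ∈ S := by simp [hj]
        simp only [hmem]
        refine h2 _ ?_
        obtain ⟨i, hi⟩ := hsep j j₀ hj
        refine ⟨i, ?_⟩
        -- Shrinking keeps the box `j` inside itself, hence where the move for `j₀` is the identity.
        have hle : |(if j ∈ S then fun i => c j i + ε j i * (x i - c j i) else x) i - c j i| ≤
            ρ j i := by
          by_cases hjS : j ∈ S
          · simp only [hjS, if_true, add_sub_cancel_left]
            exact abs_shrink_le (hε j i) (hε1 j i) (hx i)
          · simpa only [hjS, if_false] using hx i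
        set y := (if j ∈ S then fun i => c j i + ε j i * (x i - c j i) else x) i
        have := abs_sub_le (c j i) y (c j₀ i)
        rw [abs_sub_comm (c j i) y] at this
        linarith
  obtain ⟨e, he, h⟩ := key Finset.univ
  exact ⟨e, he, by simpa using h⟩

end Shrink

/-! ### Pattern maps and diffeomorphisms -/

section Main

variable {n : ℕ} {lam : ℝ}

theorem word_half_sub (w : List Bool) (y : ℝ) :
    word lam w y - word lam w (1 / 2) = (y - 1 / 2) * (1 / lam) ^ w.length :=
  word_sub w y _

theorem exists_abs_sub_le_of_abs_sub_le_add {c d p q : ℝ} (hp : 0 ≤ p) (hq : 0 ≤ q)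
    (h : |c - d| ≤ p + q) : ∃ x, |x - c| ≤ p ∧ |x - d| ≤ q := by
  have h' := abs_le.1 h
  have h1 := le_max_left (c - p) (d - q)
  have h2 := le_max_right (c - p) (d - q)
  have h3 : max (c - p) (d - q) ≤ c + p := max_le (by linarith) (by linarith)
  have h4 : max (c - p) (d - q) ≤ d + q := max_le (by linarith) (by linarith)
  exact ⟨max (c - p) (d - q), abs_le.2 ⟨by linarith, by linarith⟩,
    abs_le.2 ⟨by linarith, by linarith⟩⟩

/-- If the intervals met in every coordinate, common points of the intervals would assemble into a
common point of the boxes. -/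
theorem exists_separating_coord (hl : 2 < lam) {L R : Address n}
    (h : Disjoint (box lam L) (box lam R)) :
    ∃ i, (1 / lam) ^ (L i).length / 2 + (1 / lam) ^ (R i).length / 2 <
      |word lam (L i) (1 / 2) - word lam (R i) (1 / 2)| := by
  have hlt := one_div_lt_half hl
  by_contra! hc
  have key : ∀ i, ∃ x, (∃ y ∈ Set.Icc (0 : ℝ) 1, word lam (L i) y = x) ∧
      ∃ y ∈ Set.Icc (0 : ℝ) 1, word lam (R i) y = x := by
    intro i
    have hm : ∀ (w : List Bool) (x : ℝ), |x - word lam w (1 / 2)| ≤ (1 / lam) ^ w.length / 2 →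
        ∃ y ∈ Set.Icc (0 : ℝ) 1, word lam w y = x := by
      intro w x hx
      have hp : 0 < (1 / lam) ^ w.length := pow_pos hlt.1 _
      have hx' := abs_le.1 hx
      refine ⟨1 / 2 + (x - word lam w (1 / 2)) / (1 / lam) ^ w.length, ⟨?_, ?_⟩, ?_⟩
      · have : -(1 / 2) ≤ (x - word lam w (1 / 2)) / (1 / lam) ^ w.length := by
          rw [le_div_iff₀ hp]
          linarith
        linarith
      · have : (x - word lam w (1 / 2)) / (1 / lam) ^ w.length ≤ 1 / 2 := by
          rw [div_le_iff₀ hp]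
          linarith
        linarith
      · have := word_half_sub (lam := lam) w (1 / 2 + (x - word lam w (1 / 2)) / (1 / lam) ^ w.length)
        rw [add_sub_cancel_left, div_mul_cancel₀ _ hp.ne'] at this
        linarith
    have hi := abs_le.1 (hc i)
    have h1 : 0 < (1 / lam) ^ (L i).length := pow_pos hlt.1 _
    have h2 : 0 < (1 / lam) ^ (R i).length := pow_pos hlt.1 _
    obtain ⟨x, hx, hx'⟩ := exists_abs_sub_le_of_abs_sub_le_add (half_pos h1).le (half_pos h2).le
      (show |word lam (L i) (1 / 2) - word lam (R i) (1 / 2)| ≤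
        (1 / lam) ^ (L i).length / 2 + (1 / lam) ^ (R i).length / 2 from
          abs_le.2 ⟨by linarith, by linarith⟩)
    exact ⟨x, hm _ _ hx, hm _ _ hx'⟩
  choose x hx hx' using key
  exact Set.disjoint_left.1 h (mem_box_iff.2 hx) (mem_box_iff.2 hx')

theorem cubeMap_sub_half (σ : Matrix (Fin n) (Fin n) ℤ) (z : Fin n → ℝ) (i : Fin n) :
    cubeMap σ z i - 1 / 2 = (σ.map fun x => (x : ℝ)).mulVec (fun k => z k - 1 / 2) i := by
  simp [cubeMap, Matrix.mulVec, dotProduct]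

/-- Shrinking disjoint standard boxes to cubes of the same size. -/
theorem exists_shrink_to_cubes (hl : 2 < lam) {m : ℕ} {L : Fin m → Address n}
    (hL : Pairwise fun j j' => Disjoint (box lam (L j)) (box lam (L j'))) {ε : ℝ} (hε : 0 < ε)
    (hεL : ∀ j i, ε ≤ (1 / lam) ^ (L j i).length) :
    ∃ e ∈ orientedDiffeo n, ∀ j, ∀ z ∈ dust n lam, e (boxMap lam (L j) z) =
      fun i => boxMap lam (L j) (fun _ => 1 / 2) i + ε * (z i - 1 / 2) := by
  have hlt := one_div_lt_half hl
  have hp : ∀ j i, 0 < (1 / lam) ^ (L j i).length := fun j i => pow_pos hlt.1 _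
  obtain ⟨e, he, h⟩ := exists_shrink (fun j => boxMap lam (L j) fun _ => 1 / 2)
    (fun j i => (1 / lam) ^ (L j i).length / 2) (fun j i => half_pos (hp j i))
    (fun j j' hjj => exists_separating_coord hl (hL hjj))
    (ε := fun j i => ε / (1 / lam) ^ (L j i).length) (fun j i => div_pos hε (hp j i))
    (fun j i => (div_le_one (hp j i)).2 (hεL j i))
  refine ⟨e, he, fun j z hz => ?_⟩
  rw [h j]
  · funext i
    simp only [boxMap]
    rw [word_half_sub, div_mul_eq_mul_div, mul_comm (z i - 1 / 2), mul_left_comm,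
      mul_div_cancel_left₀ _ (hp j i).ne']
  · intro i
    have hzi := mem_Icc_of_mem_centralCantor (hz i trivial)
    simp only [boxMap]
    rw [word_half_sub, abs_mul, abs_of_pos (hp j i)]
    have : |z i - 1 / 2| ≤ 1 / 2 := by
      rw [abs_le]
      constructor <;> linarith [hzi.1, hzi.2]
    linarith [mul_le_mul_of_nonneg_right this (hp j i).le]

/-- The diffeomorphism is `q⁻¹ * (g * p)`: `p` and `q` contract source and target boxes to cubes of
one size, and `g` carries source centres to target centres with the rotations as germs. Cubes are
needed because a symmetry commutes with uniform scaling but does not preserve unequal side lengths.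
-/
theorem exists_diffeo_boxes (hn : 2 ≤ n) (hl : 2 < lam) {m : ℕ} {L R : Fin m → Address n}
    (hL : Pairwise fun j j' => Disjoint (box lam (L j)) (box lam (L j')))
    (hR : Pairwise fun j j' => Disjoint (box lam (R j)) (box lam (R j')))
    {σ : Fin m → Matrix (Fin n) (Fin n) ℤ}
    (hσ : ∀ j, σ j ∈ Matrix.specialOrthogonalGroup (Fin n) ℤ) :
    ∃ e ∈ orientedDiffeo n, ∀ j, BoxToBox lam e (L j) (σ j) (R j) := by
  have hlt := one_div_lt_half hl
  have hinj : ∀ L : Fin m → Address n,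
      (Pairwise fun j j' => Disjoint (box lam (L j)) (box lam (L j'))) →
      Function.Injective fun j => boxMap lam (L j) fun _ => 1 / 2 := by
    intro L hL j j' hjj
    by_contra hne
    obtain ⟨i, hi⟩ := exists_separating_coord hl (hL hne)
    have e : word lam (L j i) (1 / 2) = word lam (L j' i) (1 / 2) := congrFun hjj i
    rw [e, sub_self, abs_zero] at hi
    have := pow_pos hlt.1 (L j i).length
    have := pow_pos hlt.1 (L j' i).length
    linarith
  obtain ⟨g, hg, hgerm⟩ := germRel_of_injective hn (hinj L hL) (hinj R hR) fun j =>
    (⟨(σ j).map fun x => (x : ℝ), by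
      rw [← Int.cast_det, (Matrix.mem_specialOrthogonalGroup_iff.1 (hσ j)).2, Int.cast_one]⟩ :
      Matrix.SpecialLinearGroup (Fin n) ℝ)
  have hball : ∀ j, ∃ δ > 0, ∀ x : Fin n → ℝ, dist x (boxMap lam (L j) fun _ => 1 / 2) < δ →
      g x = (boxMap lam (R j) fun _ => 1 / 2) +
        ((σ j).map fun x => (x : ℝ)).mulVec (x - boxMap lam (L j) fun _ => 1 / 2) :=
    fun j => Metric.eventually_nhds_iff.1 (hgerm j)
  choose δ hδ hgδ using hball
  -- One size below all sides of the boxes and all radii on which the germs of `g` are affine.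
  obtain ⟨ε₀, hε₀, hle⟩ := exists_pos_le_of_ne_zero
    (fun q : (Fin m × Fin n) ⊕ (Fin m × Fin n) ⊕ Fin m =>
      q.elim (fun q => (1 / lam) ^ (L q.1 q.2).length)
        (fun q => q.elim (fun q => (1 / lam) ^ (R q.1 q.2).length) δ))
  have hL0 : ∀ j i, ε₀ ≤ (1 / lam) ^ (L j i).length := fun j i => by
    have h := pow_pos hlt.1 (L j i).length
    simpa [abs_of_pos (by linarith : 0 < lam)] using hle (Sum.inl (j, i)) h.ne'
  have hR0 : ∀ j i, ε₀ ≤ (1 / lam) ^ (R j i).length := fun j i => by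
    have h := pow_pos hlt.1 (R j i).length
    simpa [abs_of_pos (by linarith : 0 < lam)] using hle (Sum.inr (Sum.inl (j, i))) h.ne'
  have hδ0 : ∀ j, ε₀ ≤ δ j := fun j => by
    simpa [abs_of_pos (hδ j)] using hle (Sum.inr (Sum.inr j)) (hδ j).ne'
  obtain ⟨p, hp, hpL⟩ := exists_shrink_to_cubes hl hL hε₀ hL0
  obtain ⟨q, hq, hqR⟩ := exists_shrink_to_cubes hl hR hε₀ hR0
  refine ⟨q⁻¹ * (g * p), mul_mem (inv_mem hq) (mul_mem hg hp), fun j z hz => ?_⟩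
  have hcz := cubeMap_mem (by linarith) (hσ j) hz
  change q.symm (g (p (boxMap lam (L j) z))) = _
  rw [Equiv.symm_apply_eq, hqR j _ hcz, hpL j z hz]
  have hsub : (fun i => boxMap lam (L j) (fun _ => 1 / 2) i + ε₀ * (z i - 1 / 2)) -
      boxMap lam (L j) (fun _ => 1 / 2) = ε₀ • fun i => z i - 1 / 2 := by
    funext i
    simp
  rw [hgδ j, hsub, Matrix.mulVec_smul]
  · funext i
    rw [cubeMap_sub_half]
    rfl
  · rw [dist_eq_norm, hsub, norm_smul, Real.norm_eq_abs, abs_of_pos hε₀]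
    refine lt_of_lt_of_le ?_ (hδ0 j)
    refine mul_lt_of_lt_one_right hε₀ (lt_of_le_of_lt
      ((pi_norm_le_iff_of_nonneg (by norm_num : (0 : ℝ) ≤ 1 / 2)).2 fun i => ?_) (by norm_num))
    have hzi := mem_Icc_of_mem_centralCantor (hz i trivial)
    rw [Real.norm_eq_abs, abs_le]
    constructor <;> linarith [hzi.1, hzi.2]

theorem exists_level_mapsBoxAt (hl : 2 < lam) {φ : dust n lam ≃ₜ dust n lam}
    (hφ : φ ∈ diffPlus n lam) :
    ∃ P : Multiset (Address n), IsDyadicPartition P ∧ ∀ L ∈ P,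
      ∃ σ ∈ Matrix.specialOrthogonalGroup (Fin n) ℤ, ∃ R, MapsBoxAt φ L σ R := by
  obtain ⟨Φ, hdet, hΦ⟩ := hφ
  obtain ⟨r, hr⟩ := exists_level_boxToBox hl Φ.contMDiff.contDiff hdet fun x hx => by
    rw [hΦ ⟨x, hx⟩]
    exact (φ ⟨x, hx⟩).2
  obtain ⟨P, hP, hPr⟩ := exists_level_partition n r
  refine ⟨P, hP, fun L hL => ?_⟩
  obtain ⟨σ, hσ, R, h⟩ := hr L (hPr L hL)
  refine ⟨σ, hσ, R, fun x y hy hx => ?_⟩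
  rw [← hΦ x, hx, h y hy]

/-- The symmetry can be applied to the whole cube before rescaling: it sends the source interval to
itself or to its mirror image. Thus `a` is the lower end of that image, `b` the lower end of the
target, and the exponent is the difference of word lengths. -/
theorem exists_affine_form (hl : 2 < lam) (L R : Address n) {σ : Matrix (Fin n) (Fin n) ℤ}
    (hσ : σ ∈ Matrix.specialOrthogonalGroup (Fin n) ℤ) (i : Fin n) :
    ∃ k : ℤ, ∃ a ∈ centralCantor lam, ∃ b ∈ centralCantor lam, ∀ z,
      boxMap lam R (cubeMap σ z) i = b + lam ^ k * (cubeMap σ (boxMap lam L z) i - a) := by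
  have h0 : lam ≠ 0 := by linarith
  obtain ⟨k, hk, hr, -⟩ := exists_entry hσ i
  obtain ⟨a, ha, h⟩ : ∃ a ∈ centralCantor lam, ∀ z,
      cubeMap σ (boxMap lam L z) i - a = cubeMap σ z i * (1 / lam) ^ (L k).length := by
    rcases hk with hk | hk
    · refine ⟨word lam (L k) 0, word_mem (by linarith) _ zero_mem_centralCantor, fun z => ?_⟩
      rw [cubeMap_apply_entry hr, cubeMap_apply_entry hr, hk]
      have := word_sub (lam := lam) (L k) (z k) 0
      simp only [boxMap]
      push_cast
      linarith
    · refine ⟨1 - word lam (L k) 1, centralCantor_flip h0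
        (word_mem (by linarith) _ (one_mem_centralCantor hl)), fun z => ?_⟩
      rw [cubeMap_apply_entry hr, cubeMap_apply_entry hr, hk]
      have := word_sub (lam := lam) (L k) 1 (z k)
      simp only [boxMap]
      push_cast
      linarith
  refine ⟨(L k).length - (R i).length, a, ha, word lam (R i) 0,
    word_mem (by linarith) _ zero_mem_centralCantor, fun z => ?_⟩
  rw [h, boxMap, word_eq, zpow_sub₀ h0, zpow_natCast, zpow_natCast, one_div, inv_pow, inv_pow]
  field_simp

theorem mem_diffPlus_of_mapsBoxAt (hn : 2 ≤ n) (hl : 2 < lam) {φ : dust n lam ≃ₜ dust n lam}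
    {m : ℕ} {L R : Fin m → Address n} {σ : Fin m → Matrix (Fin n) (Fin n) ℤ}
    (hL : IsNumberedPattern L) (hR : IsNumberedPattern R)
    (h : ∀ j, σ j ∈ Matrix.specialOrthogonalGroup (Fin n) ℤ ∧ MapsBoxAt φ (L j) (σ j) (R j)) :
    φ ∈ diffPlus n lam := by
  obtain ⟨e, ⟨he, he', hdet⟩, hbox⟩ := exists_diffeo_boxes hn hl (hL.disjoint hl) (hR.disjoint hl)
    fun j => (h j).1
  refine ⟨⟨e, he.contMDiff, he'.contMDiff⟩, hdet, fun x => ?_⟩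
  obtain ⟨j, hj⟩ := hL.cover hl x.2
  obtain ⟨y, hy, hxy⟩ := exists_dust_of_mem_box hl x.2 hj
  rw [(h j).2 x y hy hxy, hxy]
  exact hbox j y hy

/-- Realisation by diffeomorphisms gives one implication, rigidity the other; the conjugation
carries box maps across in both directions. -/
theorem dustConj_mem_nVSym_iff (hn : 2 ≤ n) (hl : 2 < lam) (φ : dust n lam ≃ₜ dust n lam) :
    dustConj n hl (by norm_num : (2 : ℝ) < 3) φ ∈ nVSym n ↔ φ ∈ diffPlus n lam := by
  constructor
  · rintro ⟨m, L, R, σ, hL, hR, h⟩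
    refine mem_diffPlus_of_mapsBoxAt hn hl hL hR fun j => ⟨(h j).1, ?_⟩
    have := MapsBoxAt.conj (by norm_num : (2 : ℝ) < 3) hl (h j).1 (h j).2
    rwa [dustConj_symm, MulEquiv.symm_apply_apply] at this
  · intro hφ
    obtain ⟨P, hP, h⟩ := exists_level_mapsBoxAt hl hφ
    refine isPatternMap_of_mapsBox hP fun L hL => ?_
    obtain ⟨σ, hσ, R, hR⟩ := h L hL
    exact ⟨σ, hσ, R, hR.conj hl (by norm_num) hσ⟩

end Main

end CantorDust

end

theorem mainTheorem10 (n : ℕ) (hn : 2 ≤ n) (lam : ℝ) (hlam : 2 < lam) :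
    (∀ φ ∈ CantorDust.diffPlus n lam,
      ∃ (m : ℕ) (L : Fin m → CantorDust.Address n),
        Pairwise (fun j j' => Disjoint (CantorDust.box lam (L j)) (CantorDust.box lam (L j'))) ∧
        CantorDust.dust n lam ⊆ ⋃ j, CantorDust.box lam (L j) ∧
        ∃ (k : Fin m → Fin n → ℤ) (a b : Fin m → Fin n → ℝ)
          (S : Fin m → Matrix (Fin n) (Fin n) ℤ),
          (∀ j i, a j i ∈ CantorDust.centralCantor lam ∧ b j i ∈ CantorDust.centralCantor lam) ∧
          (∀ j, S j ∈ Matrix.specialOrthogonalGroup (Fin n) ℤ) ∧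
          ∀ j, ∀ x : CantorDust.dust n lam, (x : Fin n → ℝ) ∈ CantorDust.box lam (L j) →
            ∀ i, (φ x : Fin n → ℝ) i =
              b j i + lam ^ (k j i) * (CantorDust.cubeMap (S j) x i - a j i)) ∧
    Nonempty (CantorDust.diffPlus n lam ≃* CantorDust.nVSym n) := by
  constructor
  · intro φ hφ
    obtain ⟨P, hP, h⟩ := CantorDust.exists_level_mapsBoxAt hlam hφ
    obtain ⟨m, L, rfl⟩ := CantorDust.exists_numbering P
    have hL : CantorDust.IsNumberedPattern L := hP
    choose S hS R hR using fun j => h (L j) (Multiset.mem_map_of_mem L (Finset.mem_univ_val j))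
    choose k a ha b hb hab using fun j i =>
      CantorDust.exists_affine_form hlam (L j) (R j) (hS j) i
    refine ⟨m, L, hL.disjoint hlam, fun x hx => Set.mem_iUnion.2 (hL.cover hlam hx), k, a, b, S,
      fun j i => ⟨ha j i, hb j i⟩, hS, fun j x hx i => ?_⟩
    obtain ⟨y, hy, e⟩ := CantorDust.exists_dust_of_mem_box hlam x.2 hx
    rw [hR j x y hy e, hab j i y, e]
  · have hmap : (CantorDust.diffPlus n lam).map
        (CantorDust.dustConj n hlam (by norm_num : (2 : ℝ) < 3)).toMonoidHom =
        CantorDust.nVSym n := by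
      ext ψ
      constructor
      · rintro ⟨φ, hφ, rfl⟩
        exact (CantorDust.dustConj_mem_nVSym_iff hn hlam φ).2 hφ
      · intro hψ
        refine ⟨(CantorDust.dustConj n hlam (by norm_num : (2 : ℝ) < 3)).symm ψ, ?_,
          MulEquiv.apply_symm_apply _ _⟩
        refine (CantorDust.dustConj_mem_nVSym_iff hn hlam _).1 ?_
        rwa [MulEquiv.apply_symm_apply]
    exact ⟨((CantorDust.dustConj n hlam (by norm_num)).subgroupMap _).trans
      (MulEquiv.subgroupCongr hmap)⟩
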